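/- Work in the addition-comparison model: a unit-cost word RAM whose words have $b$ bits, with $2^b \ge (m+2)^d$ for a constant $d$ (that is, words of $O(\log m)$ bits suffice), with additional storage for real numbers, which may only be moved, added and compared; a randomized algorithm may also flip fair coins. A simple undirected graph $G=(V,E)$ with $V=\{0,\dots,n-1\}$ and $m$ edges, together with a weight function $w:E\to\mathbb{R}$, is given by $n$, $m$ and a list of its edges with their weights, in arbitrary order. The weight of a cycle is the sum of the weights of its edges. Finding a maximum-weight cycle of length $k$ means to output the successive vertices of a cycle of length $k$ in $G$ of maximum weight among all cycles of length $k$ if there is a cycle of length $k$, and to report that there is none otherwise. Let $k\ge 3$ be a fixed integer. Then, for graphs $G$ with $m\ge 1$ edges, $n$ vertices, none of them isolated, and arbitrary edge weights $w:E\to\mathbb{R}$: (1) with high probability, a maximum-weight cycle of length $k$ can be found in $O(m^{2-1/\lceil k/2\rceil})$ time; that is, for every constant $c$ there is a randomized algorithm that on every input and for all coin flips halts within $O(m^{2-1/\lceil k/2\rceil})$ steps, and that on every input answers correctly with probability at least $1-1/n^{c}$; (2) a maximum-weight cycle of length $k$ can be found by a deterministic algorithm in $O(m^{2-1/\lceil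 k/2\rceil}\log n)$ time. The algorithm, the constant $d$ and the implied constants depend only on $k$ (and, in (1), on $c$). -/

import Mathlib

open MeasureTheory

noncomputable section

namespace RealRAM

/-! A unit-cost word RAM with `b`-bit words, with additional storage for real numbers handled in
the addition-comparison model: reals can only be moved, added and compared.  A program is a
structured program over finitely many registers and arrays (those named in its text);
each elementary operation costs one step. -/

/-- Memory contents.  `reg x` and `mem a i` hold words (numbers below `2 ^ b`),
`rreg x` and `rmem a i` hold reals; `x` and `a` are names of registers and arrays, `i` is an index
into an array.  `coins` is the stream of coin flips that were not read yet. -/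
structure State where
  reg : ℕ → ℕ
  mem : ℕ → ℕ → ℕ
  rreg : ℕ → ℝ
  rmem : ℕ → ℕ → ℝ
  coins : ℕ → Bool

/-- Expressions of word type. -/
inductive WordExp where
  | const (c : ℕ)
  | reg (x : ℕ)
  | get (a : ℕ) (i : WordExp)
  | add (e f : WordExp)
  | sub (e f : WordExp)
  | mul (e f : WordExp)
  | div (e f : WordExp)

/-- Expressions of real type; there is no real constant, and addition is the only operation. -/
inductive RealExp where
  | reg (x : ℕ)
  | get (a : ℕ) (i : WordExp)
  | add (e f : RealExp)

/-- Tests. Reals enter the control flow through the comparison `rle` only. -/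
inductive Test where
  | eq (e f : WordExp)
  | lt (e f : WordExp)
  | rle (e f : RealExp)
  | not (p : Test)
  | and (p q : Test)

/-- Value of a word expression on a machine with `b`-bit words: sums and products are
taken modulo `2 ^ b`, subtraction is truncated at `0`, division rounds down. -/
def WordExp.eval (b : ℕ) (s : State) : WordExp → ℕ
  | .const c => c % 2 ^ b
  | .reg x => s.reg x
  | .get a i => s.mem a (i.eval b s)
  | .add e f => (e.eval b s + f.eval b s) % 2 ^ b
  | .sub e f => e.eval b s - f.eval b s
  | .mul e f => (e.eval b s * f.eval b s) % 2 ^ b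
  | .div e f => e.eval b s / f.eval b s

/-- Value of a real expression. -/
def RealExp.eval (b : ℕ) (s : State) : RealExp → ℝ
  | .reg x => s.rreg x
  | .get a i => s.rmem a (i.eval b s)
  | .add e f => e.eval b s + f.eval b s

/-- Truth of a test. -/
def Test.Holds (b : ℕ) (s : State) : Test → Prop
  | .eq e f => e.eval b s = f.eval b s
  | .lt e f => e.eval b s < f.eval b s
  | .rle e f => e.eval b s ≤ f.eval b s
  | .not p => ¬ p.Holds b s
  | .and p q => p.Holds b s ∧ q.Holds b s

/-- Number of elementary operations needed to evaluate a word expression. -/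
def WordExp.cost : WordExp → ℕ
  | .const _ => 1
  | .reg _ => 1
  | .get _ i => i.cost + 1
  | .add e f => e.cost + f.cost + 1
  | .sub e f => e.cost + f.cost + 1
  | .mul e f => e.cost + f.cost + 1
  | .div e f => e.cost + f.cost + 1

/-- Number of elementary operations needed to evaluate a real expression. -/
def RealExp.cost : RealExp → ℕ
  | .reg _ => 1
  | .get _ i => i.cost + 1
  | .add e f => e.cost + f.cost + 1

/-- Number of elementary operations needed to evaluate a test. -/
def Test.cost : Test → ℕ
  | .eq e f => e.cost + f.cost + 1
  | .lt e f => e.cost + f.cost + 1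
  | .rle e f => e.cost + f.cost + 1
  | .not p => p.cost + 1
  | .and p q => p.cost + q.cost + 1

/-- Programs. -/
inductive Program where
  | skip
  | assign (x : ℕ) (e : WordExp)
  | store (a : ℕ) (i e : WordExp)
  | rassign (x : ℕ) (e : RealExp)
  | rstore (a : ℕ) (i : WordExp) (e : RealExp)
  | coin (x : ℕ)
  | seq (P Q : Program)
  | ite (p : Test) (P Q : Program)
  | loop (p : Test) (P : Program)

/-- `Exec b P s t s'`: on a machine with `b`-bit words, the program `P` started in the state `s`
halts in the state `s'` after exactly `t` steps. -/
inductive Exec (b : ℕ) : Program → State → ℕ → State → Prop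
  | skip (s : State) : Exec b .skip s 1 s
  | assign (s : State) (x : ℕ) (e : WordExp) :
      Exec b (.assign x e) s (e.cost + 1)
        { s with reg := Function.update s.reg x (e.eval b s) }
  | store (s : State) (a : ℕ) (i e : WordExp) :
      Exec b (.store a i e) s (i.cost + e.cost + 1)
        { s with
          mem := Function.update s.mem a
            (Function.update (s.mem a) (i.eval b s) (e.eval b s)) }
  | rassign (s : State) (x : ℕ) (e : RealExp) :
      Exec b (.rassign x e) s (e.cost + 1)
        { s with rreg := Function.update s.rreg x (e.eval b s) }
  | rstore (s : State) (a : ℕ) (i : WordExp) (e : RealExp) :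
      Exec b (.rstore a i e) s (i.cost + e.cost + 1)
        { s with
          rmem := Function.update s.rmem a
            (Function.update (s.rmem a) (i.eval b s) (e.eval b s)) }
  | coin (s : State) (x : ℕ) :
      Exec b (.coin x) s 1
        { s with
          reg := Function.update s.reg x (if s.coins 0 then 1 else 0),
          coins := fun j => s.coins (j + 1) }
  | seq {P Q : Program} {s s' s'' : State} {t t' : ℕ} :
      Exec b P s t s' → Exec b Q s' t' s'' → Exec b (.seq P Q) s (t + t') s''
  | ite_true {p : Test} {P Q : Program} {s s' : State} {t : ℕ} :
      p.Holds b s → Exec b P s t s' → Exec b (.ite p P Q) s (p.cost + t) s'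
  | ite_false {p : Test} {P Q : Program} {s s' : State} {t : ℕ} :
      ¬ p.Holds b s → Exec b Q s t s' → Exec b (.ite p P Q) s (p.cost + t) s'
  | loop_true {p : Test} {P : Program} {s s' s'' : State} {t t' : ℕ} :
      p.Holds b s → Exec b P s t s' → Exec b (.loop p P) s' t' s'' →
        Exec b (.loop p P) s (p.cost + t + t') s''
  | loop_false {p : Test} {P : Program} {s : State} :
      ¬ p.Holds b s → Exec b (.loop p P) s p.cost s

/-- A program is deterministic if it contains no coin flip. -/
def Program.Deterministic : Program → Prop
  | .skip => True
  | .assign _ _ => True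
  | .store _ _ _ => True
  | .rassign _ _ => True
  | .rstore _ _ _ => True
  | .coin _ => False
  | .seq P Q => P.Deterministic ∧ Q.Deterministic
  | .ite _ P Q => P.Deterministic ∧ Q.Deterministic
  | .loop _ P => P.Deterministic

/-- The law of a sequence of independent fair coin flips. -/
def coinMeasure : Measure (ℕ → Bool) :=
  Measure.infinitePi fun _ : ℕ => (PMF.uniformOfFintype Bool).toMeasure

/-- The initial state for an edge-weighted graph with vertices `0, …, n - 1` that is given by a
list of `m` edges: registers `0` and `1` hold `n` and `m`, arrays `0` and `1` hold the
endpoints `src i` and `dst i` of the `i`-th edge, real array `0` holds its weight `wt i`, and all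
other cells are `0`. -/
def initState (n m : ℕ) (src dst : Fin m → Fin n) (wt : Fin m → ℝ) (coins : ℕ → Bool) :
    State where
  reg x := if x = 0 then n else if x = 1 then m else 0
  mem a i :=
    if h : i < m then
      if a = 0 then (src ⟨i, h⟩ : ℕ) else if a = 1 then (dst ⟨i, h⟩ : ℕ) else 0
    else 0
  rreg _ := 0
  rmem a i := if h : i < m then if a = 0 then wt ⟨i, h⟩ else 0 else 0
  coins := coins

/-- `src` and `dst` list every edge of `G` exactly once, in any order and with the two
endpoints in any order. -/
def ListsEdges {n m : ℕ} (G : SimpleGraph (Fin n)) (src dst : Fin m → Fin n) : Prop :=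
  Function.Injective (fun i => s(src i, dst i)) ∧
    Set.range (fun i => s(src i, dst i)) = G.edgeSet

/-- Total weight of the edges of a walk (for a cycle each of its edges is counted once). -/
def walkWeight {n : ℕ} {G : SimpleGraph (Fin n)} (w : Sym2 (Fin n) → ℝ) {u v : Fin n}
    (p : G.Walk u v) : ℝ :=
  (p.edges.map w).sum

/-- `p` is a cycle of length `k` in `G` of maximum weight among all such cycles. -/
def IsMaxCycle {n : ℕ} (G : SimpleGraph (Fin n)) (w : Sym2 (Fin n) → ℝ) (k : ℕ) {u : Fin n}
    (p : G.Walk u u) : Prop :=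
  p.IsCycle ∧ p.length = k ∧
    ∀ (v : Fin n) (q : G.Walk v v), q.IsCycle → q.length = k → walkWeight w q ≤ walkWeight w p

/-- The final state `s` is a correct answer: either register `2` holds `1` and the first `k`
cells of array `2` hold the successive vertices of a cycle of length `k` of maximum weight, or
register `2` holds `0` and there is no cycle of length `k`. -/
def CorrectAnswer {n : ℕ} (G : SimpleGraph (Fin n)) (w : Sym2 (Fin n) → ℝ) (k : ℕ)
    (s : State) : Prop :=
  (s.reg 2 = 1 ∧ ∃ (u : Fin n) (p : G.Walk u u), IsMaxCycle G w k p ∧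
      ∀ i < k, s.mem 2 i = (p.getVert i : ℕ)) ∨
    (s.reg 2 = 0 ∧ ¬ ∃ (u : Fin n) (p : G.Walk u u), p.IsCycle ∧ p.length = k)

end RealRAM

end

namespace RealRAM

/-! A single program that flips no coins and needs no logarithmic factor gives both parts: it is
correct for every coin stream, and since `n ≥ 2` the factor `Real.log n` only changes the constant.
Put `h = ⌈k/2⌉` and `a = ⌊k/2⌋`, so that `k = a + h`.

Let `Δ` be the least positive integer with `m ≤ Δ ^ h`; up to a factor 2 it is the `h`-th root of
`m`. Call a vertex heavy if its degree exceeds `Δ`. Degrees sum to `2 * m`, so there are at most `2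
* m / Δ` heavy vertices. The algorithm works on a list of triples `(v, w, u)`: a starting vertex `v`
and a directed edge `(w, u)`. Every heavy `v` is listed with all directed edges, and every `v` with
the last edges of walks from `v` of at most `h` edges whose inner vertices are light. This gives
`O(m ^ 2 / Δ + m * Δ ^ (h - 1))` triples, which is the claimed bound (`rpow_bound`). A cycle through
a heavy vertex may be started there; any other cycle has only light vertices. In both cases the
first `h` steps from the start, in either direction, are listed (`exists_covered`).

Dynamic programming over the list finds heavy paths of length at most `h` between given ends. One
heaviest path per pair of ends is not enough, because it may meet the rest of the cycle. Instead a
representative family is kept: whenever a path of length `ℓ` with listed steps misses a set `B` of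
at most `k - ℓ` vertices, some stored path with the same ends misses `B` and is at least as heavy.
The family is a search tree of size bounded in terms of `k`. A node stores the heaviest path offered
to it among those avoiding its forbidden vertices, and each child forbids one further vertex of the
stored path. Descending from the root while forbidding only elements of `B` ends after at most `|B|`
steps (`exists_slot_disjoint`). The property passes to the next length by adding the new end to `B`
(`rep_succ`).

Finally the two arcs of a given cycle are exchanged one after the other for stored paths that do not
meet (`exists_glue`). Since only genuine cycles are stored, the heaviest stored one is optimal.

The rest transfers this to the machine, by Hoare-style rules with step bounds (`Runs`) and frame
conditions (`Agree`). Tables with `n * n` entries cost nothing to create because memory starts at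
zero. -/

/-! ### Programs without loops -/

/-- A program without loops and coin flips. -/
def Program.LoopFree : Program → Prop
  | .coin _ => False
  | .seq P Q => P.LoopFree ∧ Q.LoopFree
  | .ite _ P Q => P.LoopFree ∧ Q.LoopFree
  | .loop _ _ => False
  | _ => True

/-- An upper bound on the number of steps of a loop-free program. -/
def Program.maxCost : Program → ℕ
  | .skip => 1
  | .assign _ e => e.cost + 1
  | .store _ i e => i.cost + e.cost + 1
  | .rassign _ e => e.cost + 1
  | .rstore _ i e => i.cost + e.cost + 1
  | .coin _ => 1
  | .seq P Q => P.maxCost + Q.maxCost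
  | .ite p P Q => p.cost + (P.maxCost + Q.maxCost)
  | .loop _ _ => 0

open Classical in
/-- The final state of a loop-free program. -/
noncomputable def Program.run (b : ℕ) : Program → State → State
  | .skip, s => s
  | .assign x e, s => { s with reg := Function.update s.reg x (e.eval b s) }
  | .store a i e, s =>
      { s with
        mem := Function.update s.mem a
          (Function.update (s.mem a) (i.eval b s) (e.eval b s)) }
  | .rassign x e, s => { s with rreg := Function.update s.rreg x (e.eval b s) }
  | .rstore a i e, s =>
      { s with
        rmem := Function.update s.rmem a
          (Function.update (s.rmem a) (i.eval b s) (e.eval b s)) }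
  | .coin _, s => s
  | .seq P Q, s => Q.run b (P.run b s)
  | .ite p P Q, s => if p.Holds b s then P.run b s else Q.run b s
  | .loop _ _, s => s

theorem Program.LoopFree.exec {b : ℕ} {P : Program} (hP : P.LoopFree) (s : State) :
    ∃ t, Exec b P s t (P.run b s) ∧ t ≤ P.maxCost := by
  induction P generalizing s with
  | skip => exact ⟨_, .skip s, le_rfl⟩
  | assign x e => exact ⟨_, .assign s x e, le_rfl⟩
  | store a i e => exact ⟨_, .store s a i e, le_rfl⟩
  | rassign x e => exact ⟨_, .rassign s x e, le_rfl⟩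
  | rstore a i e => exact ⟨_, .rstore s a i e, le_rfl⟩
  | coin x => exact hP.elim
  | seq P Q ihP ihQ =>
    obtain ⟨t, h, ht⟩ := ihP hP.1 s
    obtain ⟨t', h', ht'⟩ := ihQ hP.2 (P.run b s)
    exact ⟨_, .seq h h', Nat.add_le_add ht ht'⟩
  | ite p P Q ihP ihQ =>
    by_cases hp : p.Holds b s
    · obtain ⟨t, h, ht⟩ := ihP hP.1 s
      refine ⟨p.cost + t, ?_, ?_⟩
      · simpa [Program.run, hp] using Exec.ite_true hp h
      · simp only [Program.maxCost]; omega
    · obtain ⟨t, h, ht⟩ := ihQ hP.2 s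
      refine ⟨p.cost + t, ?_, ?_⟩
      · simpa [Program.run, hp] using Exec.ite_false hp h
      · simp only [Program.maxCost]; omega
  | loop p P => exact hP.elim

theorem Program.LoopFree.deterministic {P : Program} (hP : P.LoopFree) : P.Deterministic := by
  induction P with
  | seq P Q ihP ihQ => exact ⟨ihP hP.1, ihQ hP.2⟩
  | ite p P Q ihP ihQ => exact ⟨ihP hP.1, ihQ hP.2⟩
  | coin x => exact hP.elim
  | loop p P => exact hP.elim
  | _ => trivial

/-! ### Parts of the memory that a program may change -/

/-- Names of registers and arrays. -/
inductive Loc where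
  | reg (x : ℕ)
  | mem (a : ℕ)
  | rreg (x : ℕ)
  | rmem (a : ℕ)

/-- The registers and arrays that occur as targets in a program. -/
def Program.writes : Program → Set Loc
  | .skip => ∅
  | .assign x _ => {.reg x}
  | .store a _ _ => {.mem a}
  | .rassign x _ => {.rreg x}
  | .rstore a _ _ => {.rmem a}
  | .coin x => {.reg x}
  | .seq P Q => P.writes ∪ Q.writes
  | .ite _ P Q => P.writes ∪ Q.writes
  | .loop _ P => P.writes

/-- Two states agree outside of `W`. -/
structure Agree (W : Set Loc) (s s' : State) : Prop where
  reg : ∀ x, Loc.reg x ∉ W → s'.reg x = s.reg x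
  mem : ∀ a, Loc.mem a ∉ W → s'.mem a = s.mem a
  rreg : ∀ x, Loc.rreg x ∉ W → s'.rreg x = s.rreg x
  rmem : ∀ a, Loc.rmem a ∉ W → s'.rmem a = s.rmem a

theorem Agree.refl (W : Set Loc) (s : State) : Agree W s s :=
  ⟨fun _ _ => rfl, fun _ _ => rfl, fun _ _ => rfl, fun _ _ => rfl⟩

theorem Agree.trans {W : Set Loc} {s s' s'' : State} (h : Agree W s s') (h' : Agree W s' s'') :
    Agree W s s'' :=
  ⟨fun x hx => (h'.reg x hx).trans (h.reg x hx), fun x hx => (h'.mem x hx).trans (h.mem x hx),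
    fun x hx => (h'.rreg x hx).trans (h.rreg x hx),
    fun x hx => (h'.rmem x hx).trans (h.rmem x hx)⟩

theorem Agree.mono {W W' : Set Loc} (hW : W ⊆ W') {s s' : State} (h : Agree W s s') :
    Agree W' s s' :=
  ⟨fun x hx => h.reg x fun hm => hx (hW hm), fun x hx => h.mem x fun hm => hx (hW hm),
    fun x hx => h.rreg x fun hm => hx (hW hm), fun x hx => h.rmem x fun hm => hx (hW hm)⟩

/-- Write targets are read off the program text, so frame conditions need no knowledge of the run.
Arrays are framed as a whole. The coin stream is not tracked. -/
theorem agree_of_exec {b : ℕ} {P : Program} {s s' : State} {t : ℕ} (h : Exec b P s t s') :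
    Agree P.writes s s' := by
  induction h with
  | skip s => exact .refl _ _
  | assign s x e =>
    refine ⟨fun y hy => ?_, fun _ _ => rfl, fun _ _ => rfl, fun _ _ => rfl⟩
    exact Function.update_of_ne (fun h => hy (by simp [Program.writes, h])) _ _
  | store s a i e =>
    refine ⟨fun _ _ => rfl, fun y hy => ?_, fun _ _ => rfl, fun _ _ => rfl⟩
    exact Function.update_of_ne (fun h => hy (by simp [Program.writes, h])) _ _
  | rassign s x e =>
    refine ⟨fun _ _ => rfl, fun _ _ => rfl, fun y hy => ?_, fun _ _ => rfl⟩
    exact Function.update_of_ne (fun h => hy (by simp [Program.writes, h])) _ _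
  | rstore s a i e =>
    refine ⟨fun _ _ => rfl, fun _ _ => rfl, fun _ _ => rfl, fun y hy => ?_⟩
    exact Function.update_of_ne (fun h => hy (by simp [Program.writes, h])) _ _
  | coin s x =>
    refine ⟨fun y hy => ?_, fun _ _ => rfl, fun _ _ => rfl, fun _ _ => rfl⟩
    exact Function.update_of_ne (fun h => hy (by simp [Program.writes, h])) _ _
  | seq _ _ ih ih' =>
    exact (ih.mono Set.subset_union_left).trans (ih'.mono Set.subset_union_right)
  | ite_true _ _ ih => exact ih.mono Set.subset_union_left
  | ite_false _ _ ih => exact ih.mono Set.subset_union_right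
  | loop_true _ _ _ ih ih' => exact ih.trans ih'
  | loop_false _ => exact .refl _ _

theorem Program.LoopFree.agree {b : ℕ} {P : Program} (hP : P.LoopFree) (s : State) :
    Agree P.writes s (P.run b s) := by
  obtain ⟨t, h, -⟩ := hP.exec (b := b) s
  exact agree_of_exec h

/-! ### Total correctness with time bounds -/

/-- Started in `s`, the program `P` halts within `T` steps in a state with the property `Q`. -/
def Runs (b : ℕ) (P : Program) (s : State) (T : ℕ) (Q : State → Prop) : Prop :=
  ∃ t s', Exec b P s t s' ∧ t ≤ T ∧ Q s'

theorem Runs.mono {b : ℕ} {P : Program} {s : State} {T T' : ℕ} {Q Q' : State → Prop}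
    (h : Runs b P s T Q) (hT : T ≤ T') (hQ : ∀ s', Q s' → Q' s') : Runs b P s T' Q' := by
  obtain ⟨t, s', he, ht, hq⟩ := h
  exact ⟨t, s', he, ht.trans hT, hQ _ hq⟩

theorem Runs.frame {b : ℕ} {P : Program} {s : State} {T : ℕ} {Q : State → Prop}
    (h : Runs b P s T Q) : Runs b P s T (fun s' => Agree P.writes s s' ∧ Q s') := by
  obtain ⟨t, s', he, ht, hq⟩ := h
  exact ⟨t, s', he, ht, agree_of_exec he, hq⟩

theorem Runs.seq {b : ℕ} {P P' : Program} {s : State} {T T' : ℕ} {Q Q' : State → Prop}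
    (h : Runs b P s T Q) (h' : ∀ s', Q s' → Runs b P' s' T' Q') :
    Runs b (.seq P P') s (T + T') Q' := by
  obtain ⟨t, s', he, ht, hq⟩ := h
  obtain ⟨t', s'', he', ht', hq'⟩ := h' s' hq
  exact ⟨_, s'', .seq he he', Nat.add_le_add ht ht', hq'⟩

theorem Program.LoopFree.runs {b : ℕ} {P : Program} (hP : P.LoopFree) {s : State}
    {Q : State → Prop} (hQ : Q (P.run b s)) : Runs b P s P.maxCost Q := by
  obtain ⟨t, h, ht⟩ := hP.exec (b := b) s
  exact ⟨t, _, h, ht, hQ⟩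

theorem Program.LoopFree.runs_seq {b : ℕ} {P P' : Program} (hP : P.LoopFree) {s : State}
    {T : ℕ} {Q : State → Prop} (h : Runs b P' (P.run b s) T Q) :
    Runs b (.seq P P') s (P.maxCost + T) Q :=
  (hP.runs (Q := fun s' => s' = P.run b s) rfl).seq fun _ hs => hs ▸ h

/-- Induction on the number of remaining iterations. Agreement with the initial state off the writes
of the body is supplied to both hypotheses, so `I` need not mention registers that the body leaves
alone. -/
theorem Runs.loop {b : ℕ} {p : Test} {P : Program} {s₀ : State} (N : ℕ) (T : ℕ → ℕ)
    (I : ℕ → State → Prop) (h0 : I 0 s₀)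
    (htest : ∀ j ≤ N, ∀ s, Agree P.writes s₀ s → I j s → (p.Holds b s ↔ j < N))
    (hbody : ∀ j < N, ∀ s, Agree P.writes s₀ s → I j s → Runs b P s (T j) (I (j + 1))) :
    Runs b (.loop p P) s₀ (∑ j ∈ Finset.range N, (p.cost + T j) + p.cost) (I N) := by
  have key : ∀ d j, j + d = N → ∀ s, Agree P.writes s₀ s → I j s →
      Runs b (.loop p P) s (∑ i ∈ Finset.Ico j N, (p.cost + T i) + p.cost) (I N) := by
    intro d
    induction d with
    | zero =>
      intro j hj s hs hI
      obtain rfl : j = N := by omega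
      have : ¬ p.Holds b s := fun h => lt_irrefl _ ((htest j le_rfl s hs hI).1 h)
      exact ⟨_, s, .loop_false this, by simp, hI⟩
    | succ d ih =>
      intro j hj s hs hI
      have hlt : j < N := by omega
      obtain ⟨t, s', he, ht, hI'⟩ := hbody j hlt s hs hI
      obtain ⟨t', s'', he', ht', hI''⟩ :=
        ih (j + 1) (by omega) s' (hs.trans (agree_of_exec he)) hI'
      refine ⟨_, s'', .loop_true ((htest j hlt.le s hs hI).2 hlt) he he', ?_, hI''⟩
      rw [Finset.sum_eq_sum_Ico_succ_bot hlt]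
      omega
  have := key N 0 (by omega) s₀ (.refl _ _) h0
  rwa [← Finset.range_eq_Ico] at this

/-- `while x < y do (P; x := x + 1)` -/
def Program.forTo (x y : ℕ) (P : Program) : Program :=
  .loop (.lt (.reg x) (.reg y)) (.seq P (.assign x (.add (.reg x) (.const 1))))

/-- `hI` makes the invariant blind to the counter, so it survives the increment, and `N < 2 ^ b`
keeps the increment from wrapping around. An iteration costs 3 steps for the comparison and 4 for
the increment besides the body; the last 3 steps are the failing comparison. -/
theorem Runs.forTo {b x y : ℕ} {P : Program} {s₀ : State} (T : ℕ → ℕ)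
    (I : ℕ → State → Prop) (a N : ℕ) (hx : Loc.reg x ∉ P.writes) (hy : Loc.reg y ∉ P.writes)
    (hxy : y ≠ x)
    (ha : s₀.reg x = a) (hN : s₀.reg y = N) (haN : a ≤ N) (hb : N < 2 ^ b)
    (hI : ∀ j s v, I j s → I j { s with reg := Function.update s.reg x v })
    (h0 : I a s₀)
    (hbody : ∀ j, a ≤ j → j < N → ∀ s, Agree (P.forTo x y).writes s₀ s → s.reg x = j → I j s →
      Runs b P s (T j) (I (j + 1))) :
    Runs b (P.forTo x y) s₀ (∑ j ∈ Finset.Ico a N, (T j + 7) + 3)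
      (fun s' => s'.reg x = N ∧ I N s') := by
  have hw : ∀ {z}, z ≠ x → Loc.reg z ∉ P.writes → Loc.reg z ∉ (P.forTo x y).writes := by
    intro z hz hzP
    simp [Program.forTo, Program.writes, hz, hzP]
  have h := Runs.loop (b := b) (p := .lt (.reg x) (.reg y))
    (P := .seq P (.assign x (.add (.reg x) (.const 1)))) (s₀ := s₀) (N - a)
    (fun j => T (a + j) + 4) (fun j s => s.reg x = a + j ∧ I (a + j) s) ⟨ha, h0⟩ ?_ ?_
  · refine h.mono ?_ ?_
    · rw [Finset.sum_Ico_eq_sum_range]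
      simp only [Test.cost, WordExp.cost]
      refine Nat.add_le_add (Finset.sum_le_sum fun j _ => ?_) le_rfl
      omega
    · intro s' hs'
      rwa [Nat.add_sub_cancel' haN] at hs'
  · rintro j hj s hs ⟨hjx, -⟩
    have : s.reg y = N := by rw [hs.reg y (hw hxy hy), hN]
    simp only [Test.Holds, WordExp.eval, hjx, this]
    omega
  · rintro j hj s hs ⟨hjx, hIj⟩
    refine Runs.seq (T' := 4)
      (hbody (a + j) (by omega) (by omega) s hs hjx hIj).frame ?_
    rintro s' ⟨hag, hI'⟩
    have hlf : (Program.assign x (.add (.reg x) (.const 1))).LoopFree := trivial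
    refine hlf.runs ?_
    have hv : s'.reg x = a + j := by rw [hag.reg x hx, hjx]
    have h2 : a + j + 1 < 2 ^ b := by omega
    have h1 : 1 < 2 ^ b := by omega
    refine ⟨?_, hI _ _ _ hI'⟩
    simp [Program.run, WordExp.eval, hv, Nat.mod_eq_of_lt h1]
    rw [Nat.mod_eq_of_lt h2]
    omega

/-- Sequential composition of `f 0, …, f (N - 1)`. -/
def Program.seqN (f : ℕ → Program) : ℕ → Program
  | 0 => .skip
  | N + 1 => .seq (seqN f N) (f N)

theorem Program.loopFree_seqN {f : ℕ → Program} {N : ℕ} (h : ∀ j < N, (f j).LoopFree) :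
    (Program.seqN f N).LoopFree := by
  induction N with
  | zero => trivial
  | succ N ih => exact ⟨ih fun j hj => h j (by omega), h N (by omega)⟩

theorem Program.deterministic_seqN {f : ℕ → Program} {N : ℕ}
    (h : ∀ j < N, (f j).Deterministic) : (Program.seqN f N).Deterministic := by
  induction N with
  | zero => trivial
  | succ N ih => exact ⟨ih fun j hj => h j (by omega), h N (by omega)⟩

@[simp]
theorem Program.mem_writes_seqN {f : ℕ → Program} {N : ℕ} {l : Loc} :
    l ∈ (Program.seqN f N).writes ↔ ∃ j < N, l ∈ (f j).writes := by
  induction N with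
  | zero => simp [Program.seqN, Program.writes]
  | succ N ih =>
    simp only [Program.seqN, Program.writes, Set.mem_union, ih]
    constructor
    · rintro (⟨j, hj, h⟩ | h)
      · exact ⟨j, by omega, h⟩
      · exact ⟨N, by omega, h⟩
    · rintro ⟨j, hj, h⟩
      rcases Nat.lt_succ_iff_lt_or_eq.1 hj with h' | rfl
      · exact .inl ⟨j, h', h⟩
      · exact .inr h

theorem Program.run_seqN_induct {b : ℕ} {f : ℕ → Program} {N : ℕ} (hf : ∀ j < N, (f j).LoopFree)
    (I : ℕ → State → Prop) {s₀ : State} (h0 : I 0 s₀)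
    (hs : ∀ j < N, ∀ s, Agree (Program.seqN f N).writes s₀ s → I j s →
      I (j + 1) ((f j).run b s)) :
    I N ((Program.seqN f N).run b s₀) := by
  have key : ∀ M ≤ N, Agree (Program.seqN f N).writes s₀ ((Program.seqN f M).run b s₀) ∧
      I M ((Program.seqN f M).run b s₀) := by
    intro M
    induction M with
    | zero => exact fun _ => ⟨.refl _ _, h0⟩
    | succ M ih =>
      intro hM
      obtain ⟨h1, h2⟩ := ih (by omega)
      refine ⟨h1.trans (((hf M (by omega)).agree _).mono ?_), hs M (by omega) _ h1 h2⟩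
      intro l hl
      exact Program.mem_writes_seqN.2 ⟨M, by omega, hl⟩
  exact (key N le_rfl).2

theorem Runs.seqN {b : ℕ} {f : ℕ → Program} {N : ℕ} (I : ℕ → State → Prop) (T : ℕ) {s₀ : State}
    (h0 : I 0 s₀) (hs : ∀ j < N, ∀ s, I j s → Runs b (f j) s T (I (j + 1))) :
    Runs b (Program.seqN f N) s₀ (N * T + 1) (I N) := by
  induction N with
  | zero => exact ⟨1, s₀, .skip _, by simp, h0⟩
  | succ N ih =>
    refine ((ih fun j hj => hs j (by omega)).seq (hs N (by omega))).mono ?_ fun _ h => h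
    rw [Nat.succ_mul]; omega

/-- Conjunction of `f 0, …, f (N - 1)`. -/
def Test.allN (f : ℕ → Test) : ℕ → Test
  | 0 => .eq (.const 0) (.const 0)
  | N + 1 => .and (allN f N) (f N)

@[simp]
theorem Test.holds_allN {b : ℕ} {s : State} {f : ℕ → Test} {N : ℕ} :
    (Test.allN f N).Holds b s ↔ ∀ j < N, (f j).Holds b s := by
  induction N with
  | zero => simp [Test.allN, Test.Holds]
  | succ N ih =>
    simp only [Test.allN, Test.Holds, ih, Nat.lt_succ_iff_lt_or_eq, or_imp, forall_and,
      forall_eq]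

/-! ### Slots: tables that keep the heaviest record offered for each key -/

/-- Name of the `i`-th array of slot `g`. -/
def tab (g i : ℕ) : ℕ := 10 + Nat.pair g i

/-- Array of the validity flags of slot `g`. -/
def cV (g : ℕ) : ℕ := tab g 0

/-- Array of the `i`-th vertices of the records of slot `g`. -/
def cP (g i : ℕ) : ℕ := tab g (i + 1)

/-- Real array of the weights of the records of slot `g`. -/
def cW (g : ℕ) : ℕ := 2 + g

theorem tab_inj {g i g' i' : ℕ} : tab g i = tab g' i' ↔ g = g' ∧ i = i' := by
  simp [tab, Nat.pair_eq_pair]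

theorem ten_le_tab (g i : ℕ) : 10 ≤ tab g i := Nat.le_add_right _ _

@[simp] theorem cV_inj {g g' : ℕ} : cV g = cV g' ↔ g = g' := by simp [cV, tab_inj]
@[simp] theorem cP_inj {g g' i i' : ℕ} : cP g i = cP g' i' ↔ g = g' ∧ i = i' := by
  simp [cP, tab_inj]
@[simp] theorem cV_ne_cP {g g' i : ℕ} : cV g ≠ cP g' i := by simp [cV, cP, tab_inj]
@[simp] theorem cP_ne_cV {g g' i : ℕ} : cP g' i ≠ cV g := by simp [cV, cP, tab_inj]
@[simp] theorem cW_inj {g g' : ℕ} : cW g = cW g' ↔ g = g' := by simp [cW]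
theorem ten_le_cV (g : ℕ) : 10 ≤ cV g := ten_le_tab _ _
theorem ten_le_cP (g i : ℕ) : 10 ≤ cP g i := ten_le_tab _ _
theorem two_le_cW (g : ℕ) : 2 ≤ cW g := Nat.le_add_right _ _

/-- Writes the record in the registers `20, …, 20 + N - 1` and real register `0` into slot `g`
under the key in register `10`. -/
def put (g N : ℕ) : Program :=
  .seq (.store (cV g) (.reg 10) (.const 1))
    (.seq (.seqN (fun i => .store (cP g i) (.reg 10) (.reg (20 + i))) N)
      (.rstore (cW g) (.reg 10) (.reg 0)))

/-- If `p` holds, puts the current record into slot `g` unless a record at least as heavy is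
there already. -/
def offer (g N : ℕ) (p : Test) : Program :=
  .ite (.and p (.not (.and (.eq (.get (cV g) (.reg 10)) (.const 1))
    (.rle (.reg 0) (.get (cW g) (.reg 10)))))) (put g N) .skip

/-- The arrays of slot `g`. -/
def slotLocs (g : ℕ) : Set Loc :=
  {l | l = .mem (cV g) ∨ (∃ i, l = .mem (cP g i)) ∨ l = .rmem (cW g)}

theorem loopFree_put (g N : ℕ) : (put g N).LoopFree :=
  ⟨trivial, Program.loopFree_seqN fun _ _ => trivial, trivial⟩

theorem loopFree_offer (g N : ℕ) (p : Test) : (offer g N p).LoopFree :=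
  ⟨loopFree_put g N, trivial⟩

theorem writes_put (g N : ℕ) : (put g N).writes ⊆ slotLocs g := by
  intro l
  simp only [put, Program.writes, Set.mem_union, Set.mem_singleton_iff, Program.mem_writes_seqN,
    slotLocs, Set.mem_ofPred_eq]
  rintro (h | ⟨i, -, h⟩ | h)
  · exact .inl h
  · exact .inr (.inl ⟨i, h⟩)
  · exact .inr (.inr h)

theorem writes_offer (g N : ℕ) (p : Test) : (offer g N p).writes ⊆ slotLocs g := by
  intro l hl
  simp only [offer, Program.writes, Set.mem_union, Set.mem_empty_iff_false, or_false] at hl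
  exact writes_put g N hl

@[simp] theorem reg_notMem_slotLocs (g x : ℕ) : Loc.reg x ∉ slotLocs g := by simp [slotLocs]

theorem run_put {b g N : ℕ} (hb : 1 < 2 ^ b) (s : State) :
    ((put g N).run b s).mem (cV g) = Function.update (s.mem (cV g)) (s.reg 10) 1 ∧
    (∀ i < N, ((put g N).run b s).mem (cP g i) =
      Function.update (s.mem (cP g i)) (s.reg 10) (s.reg (20 + i))) ∧
    ((put g N).run b s).rmem (cW g) = Function.update (s.rmem (cW g)) (s.reg 10) (s.rreg 0) := by
  set s₁ : State := (Program.store (cV g) (.reg 10) (.const 1)).run b s with hs₁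
  have h1 : ∀ i, s₁.mem (cP g i) = s.mem (cP g i) := by
    intro i; simp [hs₁, Program.run]
  have hV : s₁.mem (cV g) = Function.update (s.mem (cV g)) (s.reg 10) 1 := by
    simp [hs₁, Program.run, WordExp.eval, Nat.mod_eq_of_lt hb]
  have hr : s₁.reg = s.reg := rfl
  -- The invariant splits the columns at `j`: those below are written, the others are still as
  -- before.
  have key := Program.run_seqN_induct (b := b)
    (f := fun i => .store (cP g i) (.reg 10) (.reg (20 + i))) (N := N) (fun _ _ => trivial)
    (fun j s' => s'.mem (cV g) = s₁.mem (cV g) ∧ (∀ i < j, s'.mem (cP g i) =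
      Function.update (s.mem (cP g i)) (s.reg 10) (s.reg (20 + i))) ∧
      (∀ i ≥ j, s'.mem (cP g i) = s₁.mem (cP g i))) (s₀ := s₁) ⟨rfl, by simp, by simp⟩ (by
    rintro j hj s' hag ⟨hv, h2, h3⟩
    have hreg : ∀ x, s'.reg x = s.reg x := fun x => by
      rw [← hr]; apply hag.reg; simp [Program.writes]
    refine ⟨?_, ?_, ?_⟩
    · simp [Program.run, hv]
    · intro i hi
      rcases Nat.lt_succ_iff_lt_or_eq.1 hi with h | rfl
      · have : cP g i ≠ cP g j := by simp; omega
        simp [Program.run, Function.update_of_ne this, h2 i h]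
      · simp [Program.run, WordExp.eval, hreg, h3 i le_rfl, h1]
    · intro i hi
      have : cP g i ≠ cP g j := by simp; omega
      simp [Program.run, Function.update_of_ne this, h3 i (by omega)])
  have hag := (Program.loopFree_seqN (f := fun i => .store (cP g i) (.reg 10) (.reg (20 + i)))
    (N := N) (fun _ _ => trivial)).agree (b := b) s₁
  refine ⟨key.1.trans hV, key.2.1, ?_⟩
  change Function.update (Program.run b _ s₁).rmem (cW g) _ (cW g) = _
  rw [Function.update_self]
  simp only [WordExp.eval, RealExp.eval]
  rw [hag.rmem _ (by simp [Program.writes]), hag.reg _ (by simp [Program.writes]),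
    hag.rreg _ (by simp [Program.writes])]
  rfl

/-- Slot `g` holds a record of weight at least `r` under `key`. -/
def Has (g key : ℕ) (r : ℝ) (s : State) : Prop :=
  s.mem (cV g) key = 1 ∧ r ≤ s.rmem (cW g) key

/-- All records of slot `g` are good. -/
def Sound (g : ℕ) (Good : ℕ → (ℕ → ℕ) → ℝ → Prop) (s : State) : Prop :=
  ∀ key, s.mem (cV g) key = 1 →
    Good key (fun i => s.mem (cP g i) key) (s.rmem (cW g) key)

open Classical in
theorem run_offer {b g N : ℕ} {p : Test} (s : State) :
    (offer g N p).run b s = if p.Holds b s ∧ ¬ (s.mem (cV g) (s.reg 10) = 1 % 2 ^ b ∧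
      s.rreg 0 ≤ s.rmem (cW g) (s.reg 10)) then (put g N).run b s else s := by
  rw [offer, Program.run]
  exact if_congr Iff.rfl rfl rfl

/-- A valid record is only ever replaced by a strictly heavier one, so lower bounds persist. -/
theorem Has.run_offer {b g N : ℕ} (hb : 1 < 2 ^ b) {p : Test} {s : State} {key : ℕ} {r : ℝ}
    (h : Has g key r s) : Has g key r ((offer g N p).run b s) := by
  rw [RealRAM.run_offer]
  split_ifs with hc
  · obtain ⟨h1, -, h3⟩ := run_put (g := g) (N := N) hb s
    rw [Has, h1, h3]
    by_cases hk : key = s.reg 10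
    · subst hk
      rw [Nat.mod_eq_of_lt hb] at hc
      simp only [Function.update_self, true_and]
      by_contra hlt
      exact hc.2 ⟨h.1, (not_le.1 hlt).le.trans h.2⟩
    · rw [Function.update_of_ne hk, Function.update_of_ne hk]
      exact h
  · exact h

/-- Either the record is stored, or it was refused because one at least as heavy is present. -/
theorem has_run_offer {b g N : ℕ} (hb : 1 < 2 ^ b) {p : Test} {s : State}
    (hp : p.Holds b s) : Has g (s.reg 10) (s.rreg 0) ((offer g N p).run b s) := by
  rw [run_offer]
  split_ifs with hc
  · obtain ⟨h1, -, h3⟩ := run_put (g := g) (N := N) hb s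
    rw [Has, h1, h3]
    simp
  · rw [Nat.mod_eq_of_lt hb] at hc
    by_contra h
    exact hc ⟨hp, h⟩

/-- `hG` is needed because only the first `N` coordinates of the record are copied; the further
columns keep their old contents. -/
theorem Sound.run_offer {b g N : ℕ} (hb : 1 < 2 ^ b) {p : Test} {s : State}
    {Good : ℕ → (ℕ → ℕ) → ℝ → Prop}
    (hG : ∀ key x y r, (∀ i < N, x i = y i) → Good key x r → Good key y r)
    (h : Sound g Good s)
    (hp : p.Holds b s → Good (s.reg 10) (fun i => s.reg (20 + i)) (s.rreg 0)) :
    Sound g Good ((offer g N p).run b s) := by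
  rw [RealRAM.run_offer]
  split_ifs with hc
  · obtain ⟨h1, h2, h3⟩ := run_put (g := g) (N := N) hb s
    intro key hkey
    rw [h1] at hkey
    rw [h3]
    by_cases hk : key = s.reg 10
    · subst hk
      rw [Function.update_self]
      refine hG _ _ _ _ (fun i hi => ?_) (hp hc.1)
      rw [h2 i hi, Function.update_self]
    · rw [Function.update_of_ne hk] at hkey ⊢
      refine hG _ _ _ _ (fun i hi => ?_) (h key hkey)
      rw [h2 i hi, Function.update_of_ne hk]
  · exact h

/-- Loads the values of `f 0, …, f (N - 1)` into the registers `20, …, 20 + N - 1`. -/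
def load (f : ℕ → WordExp) (N : ℕ) : Program := .seqN (fun i => .assign (20 + i) (f i)) N

theorem loopFree_load (f : ℕ → WordExp) (N : ℕ) : (load f N).LoopFree :=
  Program.loopFree_seqN fun _ _ => trivial

theorem mem_writes_load {f : ℕ → WordExp} {N : ℕ} {l : Loc} :
    l ∈ (load f N).writes ↔ ∃ i < N, l = .reg (20 + i) := by
  simp [load, Program.writes]

/-- The side condition excludes expressions that depend on registers from 20 on, which earlier
assignments of the same load overwrite. -/
theorem run_load {b : ℕ} {f : ℕ → WordExp} {N : ℕ} (s : State)
    (hf : ∀ i < N, ∀ s' : State, s'.mem = s.mem → (∀ x < 20, s'.reg x = s.reg x) →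
      (f i).eval b s' = (f i).eval b s) :
    ∀ i < N, ((load f N).run b s).reg (20 + i) = (f i).eval b s := by
  refine Program.run_seqN_induct (b := b) (f := fun i => .assign (20 + i) (f i)) (N := N)
    (fun _ _ => trivial) (fun j s' => ∀ i < j, s'.reg (20 + i) = (f i).eval b s) (by simp) ?_
  intro j hj s' hag h i hi
  rcases Nat.lt_succ_iff_lt_or_eq.1 hi with h' | rfl
  · have : 20 + i ≠ 20 + j := by omega
    simp only [Program.run]
    rw [Function.update_of_ne this, h i h']
  · simp only [Program.run, Function.update_self]
    refine hf i hj s' (funext fun a => ?_) fun x hx => ?_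
    · exact hag.mem a (by simp [Program.writes])
    · refine hag.reg x ?_
      simp only [Program.mem_writes_seqN, Program.writes, Set.mem_singleton_iff, Loc.reg.injEq]
      omega

/-! ### Representative families as search trees -/

/-- `x` avoids the vertices on the way from the root of the search tree to the node `t`; the
`i`-th child of the node `j` is `j * k + i + 1`, reached by forbidding the vertex `P j i`. -/
def Avoid (k L : ℕ) (V : ℕ → Prop) (P : ℕ → ℕ → ℕ) : ℕ → (ℕ → ℕ) → Prop
  | 0, _ => True
  | j + 1, x => Avoid k L V P (j / k) x ∧ V (j / k) ∧ ∀ i ≤ L, x i ≠ P (j / k) (j % k)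
decreasing_by exact Nat.lt_succ_of_le (Nat.div_le_self j k)

/-- The nodes of depth at most `q` lie below `treeSize k q`. -/
def treeSize (k : ℕ) : ℕ → ℕ
  | 0 => 1
  | q + 1 => k * treeSize k q + 1

theorem treeSize_mono {k : ℕ} (hk : 1 ≤ k) : Monotone (treeSize k) :=
  monotone_nat_of_le_succ fun q => by
    simp only [treeSize]; nlinarith [Nat.zero_le (treeSize k q)]

/-- Descend from the root, keeping the set `D ⊆ B` of vertices forbidden at the current node. As `x`
avoids `D`, completeness puts a record of weight at least `r` there. If it misses `B`, it is the
answer. Otherwise it contains some vertex of `B`, which is not in `D` by soundness, and the child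
that forbids this vertex is next. So `D` grows until it equals `B`. -/
theorem exists_slot_disjoint {k L q S : ℕ} (hL : L < k) {V : ℕ → Prop} {P : ℕ → ℕ → ℕ}
    {W : ℕ → ℝ} (hS : treeSize k q ≤ S)
    (hsound : ∀ t < S, V t → Avoid k L V P t (P t)) {x : ℕ → ℕ} {r : ℝ}
    (hcomp : ∀ t < S, Avoid k L V P t x → V t ∧ r ≤ W t) {B : Finset ℕ} (hB : B.card ≤ q)
    (hx : ∀ i ≤ L, x i ∉ B) : ∃ t < S, V t ∧ r ≤ W t ∧ ∀ i ≤ L, P t i ∉ B := by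
  have key : ∀ d, ∀ t, ∀ D ⊆ B, D.card + d = B.card → t < treeSize k D.card →
      (∀ y, Avoid k L V P t y ↔ ∀ i ≤ L, y i ∉ D) →
      ∃ t < S, V t ∧ r ≤ W t ∧ ∀ i ≤ L, P t i ∉ B := by
    intro d
    induction d with
    | zero =>
      intro t D hD hd ht hA
      -- Nothing of `B` is left to forbid, so soundness alone makes the record miss `B`.
      obtain rfl : D = B := Finset.eq_of_subset_of_card_le hD (by omega)
      have htS : t < S := ht.trans_le ((treeSize_mono (by omega) hB).trans hS)
      obtain ⟨hV, hr⟩ := hcomp t htS ((hA x).2 hx)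
      exact ⟨t, htS, hV, hr, (hA _).1 (hsound t htS hV)⟩
    | succ d ih =>
      intro t D hD hd ht hA
      have htS : t < S := ht.trans_le ((treeSize_mono (by omega) (by omega)).trans hS)
      obtain ⟨hV, hr⟩ := hcomp t htS ((hA x).2 fun i hi h => hx i hi (hD h))
      by_cases hPB : ∀ i ≤ L, P t i ∉ B
      · exact ⟨t, htS, hV, hr, hPB⟩
      push Not at hPB
      obtain ⟨i, hi, hiB⟩ := hPB
      have hiD : P t i ∉ D := (hA _).1 (hsound t htS hV) i hi
      have hcard : (insert (P t i) D).card = D.card + 1 := Finset.card_insert_of_notMem hiD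
      refine ih (t * k + i + 1) (insert (P t i) D) (Finset.insert_subset hiB hD) (by omega) ?_ ?_
      · rw [hcard]
        simp only [treeSize]
        nlinarith
      · intro y
        -- Since `i ≤ L < k`, quotient and remainder by `k` recover the parent and the branching
        -- position.
        have h1 : (t * k + i) / k = t := by
          rw [mul_comm, Nat.mul_add_div (by omega), Nat.div_eq_of_lt (by omega), add_zero]
        have h2 : (t * k + i) % k = i := by
          rw [mul_comm, Nat.mul_add_mod, Nat.mod_eq_of_lt (by omega)]
        rw [Avoid, h1, h2, hA]
        simp only [Finset.mem_insert, not_or]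
        constructor
        · rintro ⟨h3, -, h4⟩ j hj
          exact ⟨h4 j hj, h3 j hj⟩
        · intro h
          exact ⟨fun j hj => (h j hj).2, hV, fun j hj => (h j hj).1⟩
  refine key B.card 0 ∅ (Finset.empty_subset _) (by simp) (by simp [treeSize]) fun y => ?_
  simp [Avoid]

/-- Ancestors have smaller numbers, so only slots below `t` are consulted. Hence the condition is
stable while slot `t` itself is being filled. -/
theorem Avoid.congr {k L : ℕ} {V V' : ℕ → Prop} {P P' : ℕ → ℕ → ℕ} {x y : ℕ → ℕ} :
    ∀ {t : ℕ}, (∀ j < t, V j ↔ V' j) → (∀ j < t, ∀ i, P j i = P' j i) →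
      (∀ i ≤ L, x i = y i) → Avoid k L V P t x → Avoid k L V' P' t y
  | 0, _, _, _, _ => by simp [Avoid]
  | j + 1, hV, hP, hxy, h => by
    have hlt : j / k < j + 1 := Nat.lt_succ_of_le (Nat.div_le_self j k)
    rw [Avoid] at h ⊢
    refine ⟨Avoid.congr (fun i hi => hV i (by omega)) (fun i hi => hP i (by omega)) hxy h.1,
      (hV _ hlt).1 h.2.1, fun i hi => ?_⟩
    rw [← hxy i hi, ← hP _ hlt]
    exact h.2.2 i hi

/-! ### Paths -/

/-- `x 0, …, x L` are the successive vertices of a path of weight `r` from `v` to `u`, with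
respect to the adjacency relation `A` and the weights `ω`. -/
structure GoodPath (A : ℕ → ℕ → Prop) (ω : ℕ → ℕ → ℝ) (L v u : ℕ) (x : ℕ → ℕ) (r : ℝ) :
    Prop where
  start : x 0 = v
  finish : x L = u
  adj : ∀ i < L, A (x i) (x (i + 1))
  inj : ∀ i ≤ L, ∀ j ≤ L, x i = x j → i = j
  weight : r = ∑ i ∈ Finset.range L, ω (x i) (x (i + 1))

theorem GoodPath.congr {A : ℕ → ℕ → Prop} {ω : ℕ → ℕ → ℝ} {L v u : ℕ} {x y : ℕ → ℕ} {r : ℝ}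
    (hxy : ∀ i ≤ L, x i = y i) (h : GoodPath A ω L v u x r) : GoodPath A ω L v u y r where
  start := by rw [← hxy 0 (by omega), h.start]
  finish := by rw [← hxy L le_rfl, h.finish]
  adj i hi := by rw [← hxy i hi.le, ← hxy (i + 1) hi]; exact h.adj i hi
  inj i hi j hj := by rw [← hxy i hi, ← hxy j hj]; exact h.inj i hi j hj
  weight := by
    rw [h.weight]
    refine Finset.sum_congr rfl fun i hi => ?_
    rw [Finset.mem_range] at hi
    rw [hxy i hi.le, hxy (i + 1) hi]

theorem GoodPath.extend {A : ℕ → ℕ → Prop} {ω : ℕ → ℕ → ℝ} {L v w u : ℕ} {x y : ℕ → ℕ} {r : ℝ}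
    (h : GoodPath A ω L v w x r) (hA : A w u) (hu : ∀ i ≤ L, x i ≠ u)
    (hxy : ∀ i ≤ L, y i = x i) (hy : y (L + 1) = u) :
    GoodPath A ω (L + 1) v u y (r + ω w u) where
  start := by rw [hxy 0 (by omega), h.start]
  finish := hy
  adj i hi := by
    rcases Nat.lt_succ_iff_lt_or_eq.1 hi with h' | rfl
    · rw [hxy i h'.le, hxy (i + 1) h']; exact h.adj i h'
    · rw [hxy i le_rfl, hy, h.finish]; exact hA
  inj i hi j hj hij := by
    rcases Nat.le_succ_iff.1 hi with h1 | rfl <;> rcases Nat.le_succ_iff.1 hj with h2 | rfl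
    · rw [hxy i h1, hxy j h2] at hij
      exact h.inj i h1 j h2 hij
    · rw [hxy i h1, hy] at hij
      exact (hu i h1 hij).elim
    · rw [hxy j h2, hy] at hij
      exact (hu j h2 hij.symm).elim
    · rfl
  weight := by
    rw [Finset.sum_range_succ, hxy L le_rfl, hy, h.finish, h.weight]
    congr 1
    refine Finset.sum_congr rfl fun i hi => ?_
    rw [Finset.mem_range] at hi
    rw [hxy i hi.le, hxy (i + 1) hi]

/-! ### Scanning the list of triples -/

/-- Loads the triple `(v, w, u)` at the index in register `5`, and the indices of the
pairs `(v, w)`, `(w, u)`, `(v, u)`. -/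
def loadTriple : Program :=
  .seq (.assign 6 (.get 5 (.reg 5))) <| .seq (.assign 7 (.get 6 (.reg 5))) <|
  .seq (.assign 8 (.get 7 (.reg 5))) <|
  .seq (.assign 9 (.add (.mul (.reg 6) (.reg 0)) (.reg 7))) <|
  .seq (.assign 11 (.add (.mul (.reg 7) (.reg 0)) (.reg 8)))
    (.assign 12 (.add (.mul (.reg 6) (.reg 0)) (.reg 8)))

/-- Runs `f 0, …, f (N - 1)` for each triple of the list. -/
def scan (f : ℕ → Program) (N : ℕ) : Program :=
  .seq (.assign 5 (.const 0)) (.forTo 5 4 (.seq loadTriple (.seqN f N)))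

/-- What a program executed for a triple may change. -/
def bodyLocs (g : ℕ) : Set Loc :=
  {l | l = .reg 10 ∨ (∃ x, 20 ≤ x ∧ l = .reg x) ∨ (∃ x, l = .rreg x) ∨ l ∈ slotLocs g}

/-- What a scan may change. -/
def scanLocs (g : ℕ) : Set Loc :=
  {l | (∃ x, 5 ≤ x ∧ l = .reg x) ∨ (∃ x, l = .rreg x) ∨ l ∈ slotLocs g}

/-- The input graph, given by its adjacency relation `A` on numbers below `n` and weights `ω`,
is represented in the memory, and so is a list of triples. -/
structure Ctx (b n : ℕ) (A : ℕ → ℕ → Prop) (ω : ℕ → ℕ → ℝ) (s : State) : Prop where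
  reg_zero : s.reg 0 = n
  len : s.reg 4 < 2 ^ b
  valid : ∀ i < s.reg 4, s.mem 5 i < n ∧ A (s.mem 6 i) (s.mem 7 i)
  weight : ∀ x y, A x y → s.rmem 1 (x * n + y) = ω x y

/-- `(v, w, u)` occurs in the list of triples. -/
def Trip (s : State) (v w u : ℕ) : Prop :=
  ∃ i < s.reg 4, s.mem 5 i = v ∧ s.mem 6 i = w ∧ s.mem 7 i = u

/-- The triple `(v, w, u)` is the current one. -/
structure Loaded (n v w u : ℕ) (s : State) : Prop where
  reg6 : s.reg 6 = v
  reg7 : s.reg 7 = w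
  reg8 : s.reg 8 = u
  reg9 : s.reg 9 = v * n + w
  reg11 : s.reg 11 = w * n + u
  reg12 : s.reg 12 = v * n + u

theorem pair_index_lt {n v u : ℕ} (hv : v < n) (hu : u < n) : v * n + u < n * n := by
  nlinarith

theorem pair_index_inj {n v u v' u' : ℕ} (hu : u < n) (hu' : u' < n)
    (h : v * n + u = v' * n + u') : v = v' ∧ u = u' := by
  have hn : 0 < n := by omega
  have h1 : (v * n + u) / n = v := by
    rw [mul_comm, Nat.mul_add_div hn, Nat.div_eq_of_lt hu, add_zero]
  have h2 : (v' * n + u') / n = v' := by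
    rw [mul_comm, Nat.mul_add_div hn, Nat.div_eq_of_lt hu', add_zero]
  have : v = v' := by rw [← h1, ← h2, h]
  subst this
  exact ⟨rfl, by omega⟩

/-- Evaluation of an index of a pair is exact if words are long enough. -/
theorem pair_index_mod {b n v u : ℕ} (hb : n * n ≤ 2 ^ b) (hv : v < n) (hu : u < n) :
    (v * n % 2 ^ b + u) % 2 ^ b = v * n + u := by
  have := pair_index_lt hv hu
  rw [Nat.mod_eq_of_lt (by omega : v * n < 2 ^ b), Nat.mod_eq_of_lt (by omega)]

theorem loopFree_loadTriple : loadTriple.LoopFree :=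
  ⟨trivial, trivial, trivial, trivial, trivial, trivial⟩

theorem loaded_run_loadTriple {b n : ℕ} (hb : n * n ≤ 2 ^ b) {s : State} (hn : s.reg 0 = n)
    {i v w u : ℕ} (hi : s.reg 5 = i) (hv : s.mem 5 i = v) (hw : s.mem 6 i = w)
    (hu : s.mem 7 i = u) (hvn : v < n) (hwn : w < n) (hun : u < n) :
    Loaded n v w u (loadTriple.run b s) := by
  subst hi hv hw hu hn
  constructor <;> simp [loadTriple, Program.run, WordExp.eval]
  · simpa using pair_index_mod hb hvn hwn
  · simpa using pair_index_mod hb hwn hun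
  · simpa using pair_index_mod hb hvn hun

theorem Agree.loaded {g n v w u : ℕ} {s s' : State} (h : Agree (bodyLocs g) s s')
    (hs : Loaded n v w u s) : Loaded n v w u s' := by
  have : ∀ x < 20, x ≠ 10 → s'.reg x = s.reg x := fun x hx hx' => h.reg x <| by
    simp [bodyLocs, hx']; omega
  constructor
  · rw [this 6 (by omega) (by omega), hs.reg6]
  · rw [this 7 (by omega) (by omega), hs.reg7]
  · rw [this 8 (by omega) (by omega), hs.reg8]
  · rw [this 9 (by omega) (by omega), hs.reg9]
  · rw [this 11 (by omega) (by omega), hs.reg11]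
  · rw [this 12 (by omega) (by omega), hs.reg12]

theorem bodyLocs_subset_scanLocs (g : ℕ) : bodyLocs g ⊆ scanLocs g := by
  rintro l (h | ⟨x, hx, h⟩ | h | h)
  · exact .inl ⟨10, by omega, h⟩
  · exact .inl ⟨x, by omega, h⟩
  · exact .inr (.inl h)
  · exact .inr (.inr h)

theorem writes_loadTriple_subset (g : ℕ) : loadTriple.writes ⊆ scanLocs g := by
  intro l hl
  simp only [loadTriple, Program.writes, Set.mem_union, Set.mem_singleton_iff] at hl
  rcases hl with h | h | h | h | h | h <;> exact .inl ⟨_, by omega, h⟩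

theorem Agree.scan_reg {g : ℕ} {s s' : State} (h : Agree (scanLocs g) s s') {x : ℕ} (hx : x < 5) :
    s'.reg x = s.reg x := by
  refine h.reg x ?_
  simp [scanLocs]
  omega

theorem Agree.scan_mem {g : ℕ} {s s' : State} (h : Agree (scanLocs g) s s') {a : ℕ}
    (hV : a ≠ cV g) (hP : ∀ i, a ≠ cP g i) : s'.mem a = s.mem a := by
  refine h.mem a ?_
  simp [scanLocs, slotLocs, hV, hP]

theorem Agree.scan_mem_lt {g : ℕ} {s s' : State} (h : Agree (scanLocs g) s s') {a : ℕ}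
    (ha : a < 10) : s'.mem a = s.mem a :=
  h.scan_mem (by have := ten_le_cV g; omega) fun i => by have := ten_le_cP g i; omega

theorem Agree.scan_rmem {g : ℕ} {s s' : State} (h : Agree (scanLocs g) s s') {a : ℕ}
    (ha : a ≠ cW g) : s'.rmem a = s.rmem a := by
  refine h.rmem a ?_
  simp [scanLocs, slotLocs, ha]

theorem Agree.trip {g : ℕ} {s s' : State} (h : Agree (scanLocs g) s s') {v w u : ℕ} :
    Trip s' v w u ↔ Trip s v w u := by
  simp only [Trip, h.scan_reg (show 4 < 5 by omega), h.scan_mem_lt (show 5 < 10 by omega),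
    h.scan_mem_lt (show 6 < 10 by omega), h.scan_mem_lt (show 7 < 10 by omega)]

theorem Agree.ctx {b n : ℕ} {A : ℕ → ℕ → Prop} {ω : ℕ → ℕ → ℝ} {g : ℕ} {s s' : State}
    (h : Agree (scanLocs g) s s') (hs : Ctx b n A ω s) : Ctx b n A ω s' where
  reg_zero := by rw [h.scan_reg (show 0 < 5 by omega), hs.reg_zero]
  len := by rw [h.scan_reg (show 4 < 5 by omega)]; exact hs.len
  valid := by
    rw [h.scan_reg (show 4 < 5 by omega), h.scan_mem_lt (show 5 < 10 by omega),
      h.scan_mem_lt (show 6 < 10 by omega), h.scan_mem_lt (show 7 < 10 by omega)]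
    exact hs.valid
  weight := by
    rw [h.scan_rmem (show 1 ≠ cW g by have := two_le_cW g; omega)]
    exact hs.weight

/-- The loop rule shared by path extension and gluing. Candidates, keys and weights are parameters
that do not vary with the state, which is possible because a scan only changes slot `g` and scratch
registers. Each program preserves the lower bounds reached before, so what one triple achieves
survives the rest of the scan. -/
theorem runs_scan {b n : ℕ} {A : ℕ → ℕ → Prop} {ω : ℕ → ℕ → ℝ}
    (hA : ∀ x y, A x y → x < n ∧ y < n) (hb : n * n ≤ 2 ^ b) {s₀ : State}
    (hctx : Ctx b n A ω s₀) {g N : ℕ} {f : ℕ → Program} (hlf : ∀ j < N, (f j).LoopFree)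
    (hw : ∀ j < N, (f j).writes ⊆ bodyLocs g) {Good : ℕ → (ℕ → ℕ) → ℝ → Prop}
    {Cand : ℕ → ℕ → ℕ → ℕ → Prop} {key : ℕ → ℕ → ℕ → ℕ} {R : ℕ → ℕ → ℕ → ℕ → ℝ}
    (hf : ∀ v w u, v < n → A w u → ∀ j < N, ∀ s, Agree (scanLocs g) s₀ s →
      Loaded n v w u s → Sound g Good s →
      Sound g Good ((f j).run b s) ∧ (∀ κ r, Has g κ r s → Has g κ r ((f j).run b s)) ∧
      (Cand v w u j → Has g (key v w u) (R v w u j) ((f j).run b s)))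
    (hsound : Sound g Good s₀) :
    Runs b (scan f N) s₀
      (((loadTriple.maxCost + (Program.seqN f N).maxCost) + 7) * (s₀.reg 4 + 1))
      (fun s => Agree (scanLocs g) s₀ s ∧ Sound g Good s ∧
        ∀ v w u, Trip s₀ v w u → ∀ j < N, Cand v w u j → Has g (key v w u) (R v w u j) s) := by
  have hlfb : (Program.seq loadTriple (Program.seqN f N)).LoopFree :=
    ⟨loopFree_loadTriple, Program.loopFree_seqN hlf⟩
  have hwb : (Program.seq loadTriple (Program.seqN f N)).writes ⊆ scanLocs g := by
    intro l hl
    simp only [Program.writes, Set.mem_union, Program.mem_writes_seqN] at hl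
    rcases hl with h | ⟨j, hj, h⟩
    · exact writes_loadTriple_subset g h
    · exact bodyLocs_subset_scanLocs g (hw j hj h)
  have hx5 : Loc.reg 5 ∉ (Program.seq loadTriple (Program.seqN f N)).writes := by
    intro hl
    simp only [Program.writes, loadTriple, Set.mem_union, Program.mem_writes_seqN,
      Set.mem_singleton_iff, Loc.reg.injEq] at hl
    rcases hl with h | ⟨j, hj, h⟩
    · omega
    · have := hw j hj h
      simp [bodyLocs] at this
  have hx4 : Loc.reg 4 ∉ (Program.seq loadTriple (Program.seqN f N)).writes := by
    intro hl
    have := hwb hl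
    simp [scanLocs] at this
  set s₁ := (Program.assign 5 (.const 0)).run b s₀ with hs₁
  have h01 : Agree (scanLocs g) s₀ s₁ := by
    refine ((show (Program.assign 5 (.const 0)).LoopFree from trivial).agree s₀).mono ?_
    rintro l rfl
    exact .inl ⟨5, le_rfl, rfl⟩
  have hloop : Runs b (.forTo 5 4 (.seq loadTriple (.seqN f N))) s₁ _ _ :=
    Runs.forTo (b := b) (x := 5) (y := 4) (s₀ := s₁)
      (fun _ => (Program.seq loadTriple (Program.seqN f N)).maxCost)
      (fun i s => Agree (scanLocs g) s₀ s ∧ Sound g Good s ∧ ∀ i' < i, ∀ j < N,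
        Cand (s₀.mem 5 i') (s₀.mem 6 i') (s₀.mem 7 i') j →
        Has g (key (s₀.mem 5 i') (s₀.mem 6 i') (s₀.mem 7 i'))
          (R (s₀.mem 5 i') (s₀.mem 6 i') (s₀.mem 7 i') j) s) 0 (s₀.reg 4) hx5 hx4 (by omega)
      (by simp [hs₁, Program.run, WordExp.eval]) (by simp [hs₁, Program.run]) (Nat.zero_le _)
      hctx.len (fun i s v h => ⟨h.1.trans ⟨fun x hx => ?_, fun _ _ => rfl, fun _ _ => rfl,
        fun _ _ => rfl⟩, h.2.1, h.2.2⟩)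
      ⟨h01, hsound, by simp⟩ ?_
  · refine (Program.LoopFree.runs_seq (P := .assign 5 (.const 0)) trivial hloop).mono ?_ ?_
    · simp only [Program.maxCost, WordExp.cost, Finset.sum_const, Nat.card_Ico, smul_eq_mul,
        Nat.sub_zero]
      ring_nf
      omega
    · rintro s ⟨-, hag, hs, hc⟩
      refine ⟨hag, hs, ?_⟩
      rintro v w u ⟨i, hi, rfl, rfl, rfl⟩ j hj hcand
      exact hc i hi j hj hcand
  · have : x ≠ 5 := by
      rintro rfl
      exact hx (.inl ⟨5, le_rfl, rfl⟩)
    simp [this]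
  · rintro i - hi s - hs5 ⟨hag, hs, hc⟩
    refine hlfb.runs ?_
    set v := s₀.mem 5 i
    set w := s₀.mem 6 i
    set u := s₀.mem 7 i
    obtain ⟨hv, hA'⟩ := hctx.valid i hi
    obtain ⟨hwn, hun⟩ := hA _ _ hA'
    set s' := loadTriple.run b s with hs'
    have hload : Loaded n v w u s' := by
      refine loaded_run_loadTriple hb ?_ hs5 ?_ ?_ ?_ hv hwn hun
      · rw [hag.scan_reg (show 0 < 5 by omega), hctx.reg_zero]
      · rw [hag.scan_mem_lt (show 5 < 10 by omega)]
      · rw [hag.scan_mem_lt (show 6 < 10 by omega)]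
      · rw [hag.scan_mem_lt (show 7 < 10 by omega)]
    have hag' : Agree (scanLocs g) s₀ s' :=
      hag.trans ((loopFree_loadTriple.agree s).mono (writes_loadTriple_subset g))
    have hmem : s'.mem = s.mem := rfl
    have hrmem : s'.rmem = s.rmem := rfl
    have hsnd : Sound g Good s' := by
      intro κ hκ; rw [hmem, hrmem]; exact hs κ hκ
    -- Besides the finished triples, the inner invariant records the bounds reached by the programs
    -- already run on the current one.
    have key := Program.run_seqN_induct (b := b) (f := f) (N := N) hlf (s₀ := s')
      (fun j s => Agree (scanLocs g) s₀ s ∧ Loaded n v w u s ∧ Sound g Good s ∧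
        (∀ i' < i, ∀ j < N, Cand (s₀.mem 5 i') (s₀.mem 6 i') (s₀.mem 7 i') j →
        Has g (key (s₀.mem 5 i') (s₀.mem 6 i') (s₀.mem 7 i'))
          (R (s₀.mem 5 i') (s₀.mem 6 i') (s₀.mem 7 i') j) s) ∧
        ∀ j' < j, Cand v w u j' → Has g (key v w u) (R v w u j') s)
      ⟨hag', hload, hsnd, hc, by simp⟩ ?_
    · obtain ⟨h1, -, h3, h4, h5⟩ := key
      refine ⟨h1, h3, fun i' hi' => ?_⟩
      rcases Nat.lt_succ_iff_lt_or_eq.1 hi' with h | rfl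
      · exact h4 i' h
      · exact h5
    · rintro j hj s - ⟨h1, h2, h3, h4, h5⟩
      have hagj : Agree (bodyLocs g) s ((f j).run b s) := ((hlf j hj).agree s).mono (hw j hj)
      obtain ⟨h6, hhas, h7⟩ := hf v w u hv hA' j hj s h1 h2 h3
      refine ⟨h1.trans (hagj.mono (bodyLocs_subset_scanLocs g)), hagj.loaded h2, h6,
        fun i' hi' j' hj' hcand => hhas _ _ (h4 i' hi' j' hj' hcand), ?_⟩
      intro j' hj' hcand
      rcases Nat.lt_succ_iff_lt_or_eq.1 hj' with h | rfl
      · exact hhas _ _ (h5 j' h hcand)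
      · exact h7 hcand

/-! ### Dynamic programming over paths -/

/-- The slot for the node `t` of the search tree for paths of length `ℓ`. -/
def sl (ℓ t : ℕ) : ℕ := Nat.pair ℓ t

@[simp] theorem sl_inj {ℓ t ℓ' t' : ℕ} : sl ℓ t = sl ℓ' t' ↔ ℓ = ℓ' ∧ t = t' := Nat.pair_eq_pair

/-- Slot `(ℓ, t)` holds a path for the pair with index `key`. -/
def SV (s : State) (ℓ key t : ℕ) : Prop := s.mem (cV (sl ℓ t)) key = 1

/-- The path that slot `(ℓ, t)` holds for the pair with index `key`. -/
def SP (s : State) (ℓ key t i : ℕ) : ℕ := s.mem (cP (sl ℓ t) i) key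

/-- The weight of the path that slot `(ℓ, t)` holds for the pair with index `key`. -/
noncomputable def SW (s : State) (ℓ key t : ℕ) : ℝ := s.rmem (cW (sl ℓ t)) key

/-- Test whether the path in the registers `20, …` avoids the vertices on the way to node `t`. -/
def avoidTest (k L : ℕ) : ℕ → Test
  | 0 => .eq (.const 0) (.const 0)
  | j + 1 => .and (avoidTest k L (j / k)) (.and (.eq (.get (cV (sl L (j / k))) (.reg 12)) (.const 1))
      (.allN (fun i => .not (.eq (.reg (20 + i)) (.get (cP (sl L (j / k)) (j % k)) (.reg 12))))
        (L + 1)))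
decreasing_by exact Nat.lt_succ_of_le (Nat.div_le_self j k)

theorem holds_avoidTest {b k L : ℕ} (hb : 1 < 2 ^ b) {s : State} : ∀ {t : ℕ},
    (avoidTest k L t).Holds b s ↔
      Avoid k L (SV s L (s.reg 12)) (SP s L (s.reg 12)) t (fun i => s.reg (20 + i))
  | 0 => by simp [avoidTest, Avoid, Test.Holds]
  | j + 1 => by
    have hlt : j / k < j + 1 := Nat.lt_succ_of_le (Nat.div_le_self j k)
    rw [avoidTest, Avoid]
    simp only [Test.Holds, holds_avoidTest hb (t := j / k), Test.holds_allN, WordExp.eval,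
      Nat.mod_eq_of_lt hb, SV, SP, Nat.lt_succ_iff]

/-- Extends the path in slot `(ℓ, t')` for `(v, w)` by `u`, and offers it to slot `(ℓ + 1, t)`. -/
def tryExt (k ℓ t t' : ℕ) : Program :=
  .seq (.assign 10 (.reg 12)) <|
  .seq (load (fun i => if i ≤ ℓ then .get (cP (sl ℓ t') i) (.reg 9) else .reg 8) (ℓ + 2)) <|
  .seq (.rassign 0 (.add (.get (cW (sl ℓ t')) (.reg 9)) (.get 1 (.reg 11))))
    (offer (sl (ℓ + 1) t) (ℓ + 2) (.and (.eq (.get (cV (sl ℓ t')) (.reg 9)) (.const 1))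
      (.and (.allN (fun i => .not (.eq (.reg (20 + i)) (.reg 8))) (ℓ + 1))
        (avoidTest k (ℓ + 1) t))))

theorem loopFree_tryExt (k ℓ t t' : ℕ) : (tryExt k ℓ t t').LoopFree :=
  ⟨trivial, loopFree_load _ _, trivial, loopFree_offer _ _ _⟩

theorem writes_tryExt (k ℓ t t' : ℕ) : (tryExt k ℓ t t').writes ⊆ bodyLocs (sl (ℓ + 1) t) := by
  intro l hl
  simp only [tryExt, Program.writes, Set.mem_union, Set.mem_singleton_iff, mem_writes_load] at hl
  rcases hl with h | ⟨i, -, h⟩ | h | h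
  · exact .inl h
  · exact .inr (.inl ⟨20 + i, by omega, h⟩)
  · exact .inr (.inr (.inl ⟨0, h⟩))
  · exact .inr (.inr (.inr (writes_offer _ _ _ h)))

/-- The path `x 0, …, x ℓ, u`. -/
def snoc (ℓ : ℕ) (x : ℕ → ℕ) (u i : ℕ) : ℕ := if i ≤ ℓ then x i else u

/-- The state in which the extended path is offered. -/
theorem exists_run_tryExt {b k ℓ t t' n v w u : ℕ} (hb : 1 < 2 ^ b) {s : State}
    (hs : Loaded n v w u s) :
    ∃ (s' : State) (p : Test), (tryExt k ℓ t t').run b s = (offer (sl (ℓ + 1) t) (ℓ + 2) p).run b s' ∧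
      s'.mem = s.mem ∧ s'.rmem = s.rmem ∧ s'.reg 10 = v * n + u ∧
      (∀ i < ℓ + 2, s'.reg (20 + i) = snoc ℓ (SP s ℓ (v * n + w) t') u i) ∧
      s'.rreg 0 = SW s ℓ (v * n + w) t' + s.rmem 1 (w * n + u) ∧
      (p.Holds b s' ↔ SV s ℓ (v * n + w) t' ∧ (∀ i ≤ ℓ, SP s ℓ (v * n + w) t' i ≠ u) ∧
        Avoid k (ℓ + 1) (SV s (ℓ + 1) (v * n + u)) (SP s (ℓ + 1) (v * n + u)) t
          (snoc ℓ (SP s ℓ (v * n + w) t') u)) := by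
  set s₁ := (Program.assign 10 (.reg 12)).run b s with hs₁
  have h1 : ∀ x < 20, x ≠ 10 → s₁.reg x = s.reg x := by
    intro x hx hx'
    simp [hs₁, Program.run, hx']
  set f : ℕ → WordExp := fun i => if i ≤ ℓ then .get (cP (sl ℓ t') i) (.reg 9) else .reg 8
  set s₂ := (load f (ℓ + 2)).run b s₁ with hs₂
  have hag := (loopFree_load f (ℓ + 2)).agree (b := b) s₁
  have h2 : ∀ x < 20, s₂.reg x = s₁.reg x := by
    intro x hx
    refine hag.reg x ?_
    rw [mem_writes_load]
    rintro ⟨i, -, h⟩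
    rw [Loc.reg.injEq] at h
    omega
  have hmem : s₂.mem = s.mem := funext fun a => hag.mem a (by simp [mem_writes_load])
  have hrmem : s₂.rmem = s.rmem := funext fun a => hag.rmem a (by simp [mem_writes_load])
  have hload : ∀ i < ℓ + 2, s₂.reg (20 + i) = snoc ℓ (SP s ℓ (v * n + w) t') u i := by
    intro i hi
    rw [hs₂, run_load s₁ ?_ i hi]
    · simp only [f, snoc]
      split_ifs
      · simp [WordExp.eval, h1, hs.reg9, SP]; rfl
      · simp [WordExp.eval, h1, hs.reg8]
    · intro j _ s' hm hr
      simp only [f]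
      split_ifs
      · simp [WordExp.eval, hm, hr]
      · simp [WordExp.eval, hr]
  have h9 : s₂.reg 9 = v * n + w := by rw [h2 9 (by omega), h1 9 (by omega) (by omega), hs.reg9]
  have h8 : s₂.reg 8 = u := by rw [h2 8 (by omega), h1 8 (by omega) (by omega), hs.reg8]
  have h11 : s₂.reg 11 = w * n + u := by
    rw [h2 11 (by omega), h1 11 (by omega) (by omega), hs.reg11]
  have h12 : s₂.reg 12 = v * n + u := by
    rw [h2 12 (by omega), h1 12 (by omega) (by omega), hs.reg12]
  have h10 : s₂.reg 10 = v * n + u := by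
    rw [h2 10 (by omega)]
    simp [hs₁, Program.run, WordExp.eval, hs.reg12]
  refine ⟨_, _, rfl, hmem, hrmem, h10, hload, ?_, ?_⟩
  · have : ((Program.rassign 0 (.add (.get (cW (sl ℓ t')) (.reg 9)) (.get 1 (.reg 11)))).run b
        s₂).rreg 0 = SW s ℓ (v * n + w) t' + s.rmem 1 (w * n + u) := by
      simp [Program.run, RealExp.eval, WordExp.eval, h9, h11, hrmem, SW]
    exact this
  · set s₃ := (Program.rassign 0 (.add (.get (cW (sl ℓ t')) (.reg 9)) (.get 1 (.reg 11)))).run b s₂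
    have hr3 : s₃.reg = s₂.reg := rfl
    have hm3 : s₃.mem = s.mem := hmem
    have e1 : ∀ i ≤ ℓ, s₂.reg (20 + i) = SP s ℓ (v * n + w) t' i := by
      intro i hi
      rw [hload i (by omega), snoc, if_pos hi]
    change Test.Holds b s₃ _ ↔ _
    simp only [Test.Holds, Test.holds_allN, holds_avoidTest hb, WordExp.eval, hr3, hm3, h9, h8,
      h12, Nat.mod_eq_of_lt hb, Nat.lt_succ_iff]
    refine and_congr Iff.rfl (and_congr ?_ ?_)
    · exact forall₂_congr fun i hi => by rw [e1 i hi]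
    · have hSV : SV s₃ = SV s := by funext ℓ key t; simp only [SV, hm3]
      have hSP : SP s₃ = SP s := by funext ℓ key t i; simp only [SP, hm3]
      rw [hSV, hSP]
      constructor
      · exact Avoid.congr (fun _ _ => Iff.rfl) (fun _ _ _ => rfl) fun i hi => hload i (by omega)
      · exact Avoid.congr (fun _ _ => Iff.rfl) (fun _ _ _ => rfl)
          fun i hi => (hload i (by omega)).symm

/-- The records of the slots for paths of length `ℓ` are paths. -/
def GoodKey (n : ℕ) (A : ℕ → ℕ → Prop) (ω : ℕ → ℕ → ℝ) (ℓ key : ℕ) (x : ℕ → ℕ) (r : ℝ) : Prop :=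
  ∃ v u, v < n ∧ u < n ∧ key = v * n + u ∧ GoodPath A ω ℓ v u x r

/-- Slot `(ℓ + 1, t)` has been filled. -/
structure NodeDone (k n S : ℕ) (A : ℕ → ℕ → Prop) (ω : ℕ → ℕ → ℝ) (ℓ t : ℕ) (s : State) :
    Prop where
  sound : ∀ key, SV s (ℓ + 1) key t →
    GoodKey n A ω (ℓ + 1) key (SP s (ℓ + 1) key t) (SW s (ℓ + 1) key t) ∧
      Avoid k (ℓ + 1) (SV s (ℓ + 1) key) (SP s (ℓ + 1) key) t (SP s (ℓ + 1) key t)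
  complete : ∀ v w u, Trip s v w u → ∀ t' < S, SV s ℓ (v * n + w) t' →
    (∀ i ≤ ℓ, SP s ℓ (v * n + w) t' i ≠ u) →
    Avoid k (ℓ + 1) (SV s (ℓ + 1) (v * n + u)) (SP s (ℓ + 1) (v * n + u)) t
      (snoc ℓ (SP s ℓ (v * n + w) t') u) →
    SV s (ℓ + 1) (v * n + u) t ∧
      SW s ℓ (v * n + w) t' + ω w u ≤ SW s (ℓ + 1) (v * n + u) t

/-- All records for paths of length `ℓ` are paths. -/
def LevelSound (n S : ℕ) (A : ℕ → ℕ → Prop) (ω : ℕ → ℕ → ℝ) (ℓ : ℕ) (s : State) : Prop :=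
  ∀ t < S, ∀ key, SV s ℓ key t → GoodKey n A ω ℓ key (SP s ℓ key t) (SW s ℓ key t)

/-- Fills slot `(ℓ + 1, t)`. -/
def fill (k S ℓ t : ℕ) : Program := scan (tryExt k ℓ t) S

theorem Agree.slot {g : ℕ} {s s' : State} (h : Agree (scanLocs g) s s') {ℓ t : ℕ}
    (hg : sl ℓ t ≠ g) (key : ℕ) :
    (SV s' ℓ key t ↔ SV s ℓ key t) ∧ SP s' ℓ key t = SP s ℓ key t ∧
      SW s' ℓ key t = SW s ℓ key t := by
  refine ⟨?_, ?_, ?_⟩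
  · rw [SV, SV, h.scan_mem (by simpa using hg) (by simp)]
  · funext i
    rw [SP, SP, h.scan_mem (by simp) (by simp [hg])]
  · rw [SW, SW, h.scan_rmem (by simpa using hg)]

/-- Number of steps spent on a triple. -/
def fillCost (k S ℓ t : ℕ) : ℕ :=
  (loadTriple.maxCost + (Program.seqN (tryExt k ℓ t) S).maxCost) + 7

/-- Filling node `t` of level `ℓ + 1` depends on level `ℓ` and on earlier nodes of its own level,
none of which the scan touches. So the condition for accepting an extended path is constant during
the scan and can be stated in the initial state. Soundness starts out vacuously because the slot is
empty. -/
theorem runs_fill {b n k S ℓ t : ℕ} {A : ℕ → ℕ → Prop} {ω : ℕ → ℕ → ℝ}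
    (hA : ∀ x y, A x y → x < n ∧ y < n) (hb : n * n ≤ 2 ^ b) (hb1 : 1 < 2 ^ b) {s₀ : State}
    (hctx : Ctx b n A ω s₀) (hs : LevelSound n S A ω ℓ s₀)
    (hempty : ∀ key, ¬ SV s₀ (ℓ + 1) key t) :
    Runs b (fill k S ℓ t) s₀ (fillCost k S ℓ t * (s₀.reg 4 + 1))
      (fun s => Agree (scanLocs (sl (ℓ + 1) t)) s₀ s ∧ NodeDone k n S A ω ℓ t s) := by
  have hne : ∀ {t' : ℕ}, sl ℓ t' ≠ sl (ℓ + 1) t := by intro t'; simp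
  have hne' : ∀ {t' : ℕ}, t' < t → sl (ℓ + 1) t' ≠ sl (ℓ + 1) t := by
    intro t' h; simp; omega
  have hav : ∀ {s s' : State} {key : ℕ} {x y : ℕ → ℕ},
      Agree (scanLocs (sl (ℓ + 1) t)) s s' → (∀ i ≤ ℓ + 1, x i = y i) →
      (Avoid k (ℓ + 1) (SV s' (ℓ + 1) key) (SP s' (ℓ + 1) key) t x ↔
        Avoid k (ℓ + 1) (SV s (ℓ + 1) key) (SP s (ℓ + 1) key) t y) := by
    intro s s' key x y hag hxy
    constructor
    · exact Avoid.congr (fun j hj => (hag.slot (hne' hj) key).1)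
        (fun j hj i => by rw [(hag.slot (hne' hj) key).2.1]) hxy
    · exact Avoid.congr (fun j hj => (hag.slot (hne' hj) key).1.symm)
        (fun j hj i => by rw [(hag.slot (hne' hj) key).2.1]) fun i hi => (hxy i hi).symm
  have h := runs_scan (b := b) hA hb hctx (g := sl (ℓ + 1) t) (N := S) (f := tryExt k ℓ t)
    (fun j _ => loopFree_tryExt k ℓ t j) (fun j _ => writes_tryExt k ℓ t j)
    (Good := fun key x r => GoodKey n A ω (ℓ + 1) key x r ∧
      Avoid k (ℓ + 1) (SV s₀ (ℓ + 1) key) (SP s₀ (ℓ + 1) key) t x)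
    (Cand := fun v w u t' => SV s₀ ℓ (v * n + w) t' ∧ (∀ i ≤ ℓ, SP s₀ ℓ (v * n + w) t' i ≠ u) ∧
        Avoid k (ℓ + 1) (SV s₀ (ℓ + 1) (v * n + u)) (SP s₀ (ℓ + 1) (v * n + u)) t
          (snoc ℓ (SP s₀ ℓ (v * n + w) t') u))
    (key := fun v w u => v * n + u)
    (R := fun v w u t' => SW s₀ ℓ (v * n + w) t' + ω w u) ?_
    (fun key hkey => (hempty key hkey).elim)
  · refine h.mono le_rfl ?_
    rintro s ⟨hag, hsnd, hcomp⟩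
    refine ⟨hag, ⟨fun key hkey => ?_, ?_⟩⟩
    · obtain ⟨h1, h2⟩ := hsnd key hkey
      exact ⟨h1, (hav hag fun _ _ => rfl).2 h2⟩
    · intro v w u htrip t' ht' h1 h2 h3
      obtain ⟨e1, e2, e3⟩ := hag.slot (hne (t' := t')) (v * n + w)
      rw [e2] at h2 h3
      rw [e3]
      exact hcomp v w u (hag.trip.1 htrip) t' ht' ⟨e1.1 h1, h2, (hav hag fun _ _ => rfl).1 h3⟩
  · intro v w u hv hwu t' ht' s hag hl hsnd
    obtain ⟨hw, hu⟩ := hA _ _ hwu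
    obtain ⟨s', p, he, hm, hr, h10, hreg, hw0, hp⟩ :=
      exists_run_tryExt (b := b) (k := k) (ℓ := ℓ) (t := t) (t' := t') hb1 hl
    obtain ⟨e1, e2, e3⟩ := hag.slot (hne (t' := t')) (v * n + w)
    have hω : s.rmem 1 (w * n + u) = ω w u := (hag.ctx hctx).weight _ _ hwu
    rw [hω, e3] at hw0
    rw [e1, e2, hav hag fun _ _ => rfl] at hp
    rw [e2] at hreg
    rw [he]
    refine ⟨Sound.run_offer hb1 ?_ ?_ ?_, fun κ r hH => Has.run_offer hb1 ?_, ?_⟩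
    · rintro key x y r hxy ⟨⟨v, u, hv, hu, hk, hg⟩, ha⟩
      exact ⟨⟨v, u, hv, hu, hk, hg.congr fun i hi => hxy i (by omega)⟩,
        ha.congr (fun _ _ => Iff.rfl) (fun _ _ _ => rfl) fun i hi => hxy i (by omega)⟩
    · intro key hkey
      rw [hm] at hkey ⊢
      rw [hr]
      exact hsnd key hkey
    · intro hp'
      obtain ⟨h1, h2, h3⟩ := hp.1 hp'
      rw [h10, hw0]
      refine ⟨⟨v, u, hv, hu, rfl, ?_⟩, ?_⟩
      · obtain ⟨v', w', hv', hw', hkey, hg⟩ := hs t' ht' _ h1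
        -- The ends of a stored path are known only through its key and have to be decoded from it.
        obtain ⟨rfl, rfl⟩ := pair_index_inj hw hw' hkey
        refine hg.extend hwu h2 (fun i hi => ?_) ?_
        · rw [hreg i (by omega), snoc, if_pos hi]
        · rw [hreg (ℓ + 1) (by omega), snoc, if_neg (by omega)]
      · exact h3.congr (fun _ _ => Iff.rfl) (fun _ _ _ => rfl)
          fun i hi => (hreg i (by omega)).symm
    · rw [Has, hm, hr]; exact hH
    · intro hc
      have := has_run_offer (g := sl (ℓ + 1) t) (N := ℓ + 2) hb1 (hp.2 hc)
      rwa [h10, hw0] at this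

/-- Every path of length `ℓ` all of whose steps are listed is represented in the slots: for each
set `B` of at most `k - ℓ` vertices that the path avoids, some slot holds a path between the same
vertices that avoids `B` and is at least as heavy. -/
def Rep (k n S : ℕ) (A : ℕ → ℕ → Prop) (ω : ℕ → ℕ → ℝ) (ℓ : ℕ) (s : State) : Prop :=
  ∀ v u x r, v < n → GoodPath A ω ℓ v u x r → (∀ i < ℓ, Trip s v (x i) (x (i + 1))) →
    ∀ B : Finset ℕ, B.card ≤ k - ℓ → (∀ i ≤ ℓ, x i ∉ B) →
      ∃ t < S, SV s ℓ (v * n + u) t ∧ r ≤ SW s ℓ (v * n + u) t ∧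
        ∀ i ≤ ℓ, SP s ℓ (v * n + u) t i ∉ B

/-- The path without its last vertex `u` is exchanged for a stored one that misses `B` and also `u`;
the extra forbidden vertex is why level `ℓ` allows `k - ℓ` of them. Extended by `u`, this stored
path is a candidate at each node of level `ℓ + 1` whose forbidden vertices it avoids, which is what
the descent in the search tree requires. -/
theorem rep_succ {k n S ℓ : ℕ} {A : ℕ → ℕ → Prop} {ω : ℕ → ℕ → ℝ}
    (hA : ∀ x y, A x y → x < n ∧ y < n) (hℓ : ℓ + 1 < k) (hS : treeSize k k ≤ S) {s : State}
    (hr : Rep k n S A ω ℓ s)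
    (hd : ∀ t < S, NodeDone k n S A ω ℓ t s) : Rep k n S A ω (ℓ + 1) s := by
  intro v u x r hv hx htrip B hB hxB
  have hAl := hx.adj ℓ (by omega)
  rw [hx.finish] at hAl
  obtain ⟨hw, hu⟩ := hA _ _ hAl
  have hpre : GoodPath A ω ℓ v (x ℓ) x (∑ i ∈ Finset.range ℓ, ω (x i) (x (i + 1))) :=
    ⟨hx.start, rfl, fun i hi => hx.adj i (by omega),
      fun i hi j hj => hx.inj i (by omega) j (by omega), rfl⟩
  obtain ⟨t', ht', h1, h2, h3⟩ := hr v (x ℓ) x _ hv hpre (fun i hi => htrip i (by omega))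
    (insert u B) ((Finset.card_insert_le _ _).trans (by omega)) (fun i hi => by
      rw [Finset.mem_insert, not_or]
      refine ⟨fun h => ?_, hxB i (by omega)⟩
      rw [← hx.finish] at h
      have := hx.inj i (by omega) (ℓ + 1) le_rfl h
      omega)
  simp only [Finset.mem_insert, not_or] at h3
  have ht := htrip ℓ (by omega)
  rw [hx.finish] at ht
  have hmono : treeSize k (k - (ℓ + 1)) ≤ S := (treeSize_mono (by omega) (by omega)).trans hS
  obtain ⟨t, htS, h4, h5, h6⟩ := exists_slot_disjoint hℓ (V := SV s (ℓ + 1) (v * n + u))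
    (P := SP s (ℓ + 1) (v * n + u)) (W := SW s (ℓ + 1) (v * n + u)) hmono
    (fun t ht h => ((hd t ht).sound _ h).2) (x := snoc ℓ (SP s ℓ (v * n + x ℓ) t') u)
    (r := SW s ℓ (v * n + x ℓ) t' + ω (x ℓ) u)
    (fun t htS ha => (hd t htS).complete v (x ℓ) u ht t' ht' h1 (fun i hi => (h3 i hi).1) ha)
    hB (fun i hi => by
      rw [snoc]
      split_ifs with h
      · exact (h3 i h).2
      · rw [← hx.finish]; exact hxB _ le_rfl)
  refine ⟨t, htS, h4, le_trans ?_ h5, h6⟩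
  rw [hx.weight, Finset.sum_range_succ, hx.finish]
  linarith

/-- What the dynamic programming may change. -/
def dpLocs : Set Loc :=
  {l | (∃ x, 5 ≤ x ∧ l = .reg x) ∨ (∃ x, l = .rreg x) ∨ (∃ a, 10 ≤ a ∧ l = .mem a) ∨
    ∃ a, 2 ≤ a ∧ l = .rmem a}

theorem scanLocs_subset_dpLocs (g : ℕ) : scanLocs g ⊆ dpLocs := by
  rintro l (h | h | h | ⟨i, h⟩ | h)
  · exact .inl h
  · exact .inr (.inl h)
  · exact .inr (.inr (.inl ⟨_, ten_le_cV g, h⟩))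
  · exact .inr (.inr (.inl ⟨_, ten_le_cP g i, h⟩))
  · exact .inr (.inr (.inr ⟨_, two_le_cW g, h⟩))

theorem Agree.dp_reg {s s' : State} (h : Agree dpLocs s s') {x : ℕ} (hx : x < 5) :
    s'.reg x = s.reg x := by
  refine h.reg x ?_
  simp [dpLocs]
  omega

theorem Agree.dp_mem {s s' : State} (h : Agree dpLocs s s') {x : ℕ} (hx : x < 10) :
    s'.mem x = s.mem x := by
  refine h.mem x ?_
  simp [dpLocs]
  omega

theorem Agree.dp_trip {s s' : State} (h : Agree dpLocs s s') {v w u : ℕ} :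
    Trip s' v w u ↔ Trip s v w u := by
  simp only [Trip, h.dp_reg (show 4 < 5 by omega), h.dp_mem (show 5 < 10 by omega),
    h.dp_mem (show 6 < 10 by omega), h.dp_mem (show 7 < 10 by omega)]

/-- Filling a later node affects neither `t'`, nor its ancestors, nor level `ℓ`. -/
theorem NodeDone.transport {k n S ℓ t t' : ℕ} {A : ℕ → ℕ → Prop} {ω : ℕ → ℕ → ℝ} {s s' : State}
    (h : NodeDone k n S A ω ℓ t' s) (ht : t' < t)
    (hag : Agree (scanLocs (sl (ℓ + 1) t)) s s') : NodeDone k n S A ω ℓ t' s' := by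
  have hle : ∀ {j : ℕ}, j ≤ t' → sl (ℓ + 1) j ≠ sl (ℓ + 1) t := by
    intro j hj; simp; omega
  have hne : ∀ {j : ℕ}, sl ℓ j ≠ sl (ℓ + 1) t := by intro j; simp
  have hav : ∀ {key : ℕ} {x : ℕ → ℕ},
      Avoid k (ℓ + 1) (SV s' (ℓ + 1) key) (SP s' (ℓ + 1) key) t' x ↔
        Avoid k (ℓ + 1) (SV s (ℓ + 1) key) (SP s (ℓ + 1) key) t' x := by
    intro key x
    constructor
    · exact Avoid.congr (fun j hj => (hag.slot (hle hj.le) key).1)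
        (fun j hj i => by rw [(hag.slot (hle hj.le) key).2.1]) fun _ _ => rfl
    · exact Avoid.congr (fun j hj => (hag.slot (hle hj.le) key).1.symm)
        (fun j hj i => by rw [(hag.slot (hle hj.le) key).2.1]) fun _ _ => rfl
  constructor
  · intro key hkey
    obtain ⟨e1, e2, e3⟩ := hag.slot (hle le_rfl) key
    rw [e2, e3, hav]
    exact h.sound key (e1.1 hkey)
  · intro v w u htrip j hj h1 h2 h3
    obtain ⟨e1, e2, e3⟩ := hag.slot (hne (j := j)) (v * n + w)
    obtain ⟨e4, e5, e6⟩ := hag.slot (hle le_rfl) (v * n + u)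
    rw [e2] at h2 h3
    rw [hav] at h3
    rw [e4, e6, e3]
    exact h.complete v w u (hag.trip.1 htrip) j hj (e1.1 h1) h2 h3

theorem LevelSound.transport {n S ℓ g : ℕ} {A : ℕ → ℕ → Prop} {ω : ℕ → ℕ → ℝ} {s s' : State}
    (h : LevelSound n S A ω ℓ s) (hg : ∀ t, sl ℓ t ≠ g) (hag : Agree (scanLocs g) s s') :
    LevelSound n S A ω ℓ s' := by
  intro t ht key hkey
  obtain ⟨e1, e2, e3⟩ := hag.slot (hg t) key
  rw [e2, e3]
  exact h t ht key (e1.1 hkey)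

theorem Rep.transport {k n S ℓ g : ℕ} {A : ℕ → ℕ → Prop} {ω : ℕ → ℕ → ℝ} {s s' : State}
    (h : Rep k n S A ω ℓ s) (hg : ∀ t, sl ℓ t ≠ g) (hag : Agree (scanLocs g) s s') :
    Rep k n S A ω ℓ s' := by
  intro v u x r hv hx htrip B hB hxB
  obtain ⟨t, ht, h1, h2, h3⟩ := h v u x r hv hx (fun i hi => hag.trip.1 (htrip i hi)) B hB hxB
  obtain ⟨e1, e2, e3⟩ := hag.slot (hg t) (v * n + u)
  refine ⟨t, ht, e1.2 h1, by rwa [e3], by rwa [e2]⟩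

/-- The slots for paths of length at most `L` are filled, the others are empty. -/
structure Filled (b k n S : ℕ) (A : ℕ → ℕ → Prop) (ω : ℕ → ℕ → ℝ) (L : ℕ) (s : State) :
    Prop where
  ctx : Ctx b n A ω s
  sound : ∀ ℓ ≤ L, LevelSound n S A ω ℓ s
  rep : ∀ ℓ ≤ L, Rep k n S A ω ℓ s
  empty : ∀ ℓ > L, ∀ t key, ¬ SV s ℓ key t

/-- Fills the slots for paths of length `ℓ + 1`. -/
def fillLevel (k S ℓ : ℕ) : Program := .seqN (fill k S ℓ) S

/-- Number of steps spent on a triple for all nodes. -/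
def levelCost (k S ℓ : ℕ) : ℕ := S * (∑ t ∈ Finset.range S, fillCost k S ℓ t) + 1

theorem runs_fillLevel {b n k S ℓ : ℕ} {A : ℕ → ℕ → Prop} {ω : ℕ → ℕ → ℝ}
    (hA : ∀ x y, A x y → x < n ∧ y < n) (hb : n * n ≤ 2 ^ b) (hb1 : 1 < 2 ^ b)
    (hℓ : ℓ + 1 < k) (hS : treeSize k k ≤ S) {s₀ : State} (h₀ : Filled b k n S A ω ℓ s₀) :
    Runs b (fillLevel k S ℓ) s₀ (levelCost k S ℓ * (s₀.reg 4 + 1))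
      (fun s => Agree dpLocs s₀ s ∧ Filled b k n S A ω (ℓ + 1) s) := by
  -- Nodes are filled in increasing order, hence ancestors first. Emptiness of the nodes from `t` on
  -- is carried along as the precondition of the next fill.
  have h := Runs.seqN (b := b) (f := fill k S ℓ) (N := S)
    (fun t s => Agree dpLocs s₀ s ∧ Ctx b n A ω s ∧ (∀ ℓ' ≤ ℓ, LevelSound n S A ω ℓ' s) ∧
      (∀ ℓ' ≤ ℓ, Rep k n S A ω ℓ' s) ∧ (∀ t' < t, NodeDone k n S A ω ℓ t' s) ∧
      (∀ t' ≥ t, ∀ key, ¬ SV s (ℓ + 1) key t') ∧ ∀ ℓ' > ℓ + 1, ∀ t key, ¬ SV s ℓ' key t)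
    ((∑ t ∈ Finset.range S, fillCost k S ℓ t) * (s₀.reg 4 + 1)) (s₀ := s₀)
    ⟨.refl _ _, h₀.ctx, h₀.sound, h₀.rep, by simp, fun t _ => h₀.empty _ (by omega) t,
      fun ℓ' h => h₀.empty _ (by omega)⟩ ?_
  · refine h.mono ?_ ?_
    · rw [levelCost]
      nlinarith
    · rintro s ⟨h1, h2, h3, h4, h5, h6, h7⟩
      have hs : LevelSound n S A ω (ℓ + 1) s := fun t ht key hkey => ((h5 t ht).sound key hkey).1
      refine ⟨h1, h2, fun ℓ' hℓ' => ?_, fun ℓ' hℓ' => ?_, h7⟩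
      · rcases Nat.le_succ_iff.1 hℓ' with h | rfl
        · exact h3 ℓ' h
        · exact hs
      · rcases Nat.le_succ_iff.1 hℓ' with h | rfl
        · exact h4 ℓ' h
        · exact rep_succ hA hℓ hS (h4 ℓ le_rfl) h5
  · rintro t ht s ⟨h1, h2, h3, h4, h5, h6, h7⟩
    refine (runs_fill hA hb hb1 h2 (h3 ℓ le_rfl) (h6 t le_rfl)).mono ?_ ?_
    · rw [h1.dp_reg (show 4 < 5 by omega)]
      exact Nat.mul_le_mul_right _
        -- `Runs.seqN` wants one bound for all programs; the sum of all costs serves as a crude one.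
        (Finset.single_le_sum (f := fillCost k S ℓ) (fun _ _ => Nat.zero_le _)
          (Finset.mem_range.2 ht))
    · rintro s' ⟨hag, hd⟩
      have hne : ∀ ℓ' ≤ ℓ, ∀ t', sl ℓ' t' ≠ sl (ℓ + 1) t := by
        intro ℓ' hℓ' t'; simp; omega
      refine ⟨h1.trans (hag.mono (scanLocs_subset_dpLocs _)), hag.ctx h2,
        fun ℓ' hℓ' => (h3 ℓ' hℓ').transport (hne ℓ' hℓ') hag,
        fun ℓ' hℓ' => (h4 ℓ' hℓ').transport (hne ℓ' hℓ') hag, fun t' ht' => ?_,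
        fun t' ht' key => ?_, fun ℓ' hℓ' t' key => ?_⟩
      · rcases Nat.lt_succ_iff_lt_or_eq.1 ht' with h | rfl
        · exact (h5 t' h).transport h hag
        · exact hd
      · rw [(hag.slot (by simp; omega) key).1]
        exact h6 t' (by omega) key
      · rw [(hag.slot (by simp; omega) key).1]
        exact h7 ℓ' hℓ' t' key

/-- Fills the slots for paths of length up to `h`. -/
def dynProg (k S h : ℕ) : Program := .seqN (fillLevel k S) h

/-- Number of steps of `dynProg` per triple. -/
def dynCost (k S h : ℕ) : ℕ := h * (∑ ℓ ∈ Finset.range h, levelCost k S ℓ) + 1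

theorem runs_dynProg {b n k S h : ℕ} {A : ℕ → ℕ → Prop} {ω : ℕ → ℕ → ℝ}
    (hA : ∀ x y, A x y → x < n ∧ y < n) (hb : n * n ≤ 2 ^ b) (hb1 : 1 < 2 ^ b)
    (hh : h < k) (hS : treeSize k k ≤ S) {s₀ : State} (h₀ : Filled b k n S A ω 0 s₀) :
    Runs b (dynProg k S h) s₀ (dynCost k S h * (s₀.reg 4 + 1))
      (fun s => Agree dpLocs s₀ s ∧ Filled b k n S A ω h s) := by
  refine (Runs.seqN (b := b) (f := fillLevel k S) (N := h)
    (fun ℓ s => Agree dpLocs s₀ s ∧ Filled b k n S A ω ℓ s)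
    ((∑ ℓ ∈ Finset.range h, levelCost k S ℓ) * (s₀.reg 4 + 1)) (s₀ := s₀)
    ⟨.refl _ _, h₀⟩ ?_).mono ?_ fun _ h => h
  · rintro ℓ hℓ s ⟨h1, h2⟩
    refine (runs_fillLevel hA hb hb1 (by omega) hS h2).mono ?_
      fun s' ⟨h3, h4⟩ => ⟨h1.trans h3, h4⟩
    rw [h1.dp_reg (show 4 < 5 by omega)]
    exact Nat.mul_le_mul_right _
      (Finset.single_le_sum (f := levelCost k S) (fun _ _ => Nat.zero_le _)
        (Finset.mem_range.2 hℓ))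
  · rw [dynCost]
    nlinarith

theorem deterministic_scan {f : ℕ → Program} {N : ℕ} (hf : ∀ j < N, (f j).LoopFree) :
    (scan f N).Deterministic :=
  ⟨trivial, ⟨loopFree_loadTriple.deterministic,
    Program.deterministic_seqN fun j hj => (hf j hj).deterministic⟩, trivial⟩

theorem deterministic_dynProg (k S h : ℕ) : (dynProg k S h).Deterministic :=
  Program.deterministic_seqN fun _ _ => Program.deterministic_seqN fun _ _ =>
    deterministic_scan fun _ _ => loopFree_tryExt _ _ _ _

/-! ### Combining paths to cycles -/

/-- `x 0, …, x k = x 0` are the successive vertices of a cycle of length `k` and weight `r`. -/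
structure GoodCycle (A : ℕ → ℕ → Prop) (ω : ℕ → ℕ → ℝ) (k : ℕ) (x : ℕ → ℕ) (r : ℝ) : Prop where
  closed : x k = x 0
  adj : ∀ i < k, A (x i) (x (i + 1))
  inj : ∀ i < k, ∀ j < k, x i = x j → i = j
  weight : r = ∑ i ∈ Finset.range k, ω (x i) (x (i + 1))

theorem GoodCycle.congr {A : ℕ → ℕ → Prop} {ω : ℕ → ℕ → ℝ} {k : ℕ} {x y : ℕ → ℕ} {r : ℝ}
    (hxy : ∀ i ≤ k, x i = y i) (h : GoodCycle A ω k x r) : GoodCycle A ω k y r where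
  closed := by rw [← hxy 0 (by omega), ← hxy k le_rfl, h.closed]
  adj i hi := by rw [← hxy i hi.le, ← hxy (i + 1) hi]; exact h.adj i hi
  inj i hi j hj := by rw [← hxy i hi.le, ← hxy j hj.le]; exact h.inj i hi j hj
  weight := by
    rw [h.weight]
    refine Finset.sum_congr rfl fun i hi => ?_
    rw [Finset.mem_range] at hi
    rw [hxy i hi.le, hxy (i + 1) hi]

/-- Goes along `x` for `a` steps and then back along `y`. -/
def glue (k a : ℕ) (x y : ℕ → ℕ) (i : ℕ) : ℕ := if i ≤ a then x i else y (k - i)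

/-- The second path is traversed backwards, which is where symmetry of `A` and `ω` enters.
Distinctness of the vertices is a hypothesis, because the program tests it. -/
theorem GoodPath.glue {A : ℕ → ℕ → Prop} {ω : ℕ → ℕ → ℝ} (hA : ∀ x y, A x y → A y x)
    (hω : ∀ x y, ω x y = ω y x) {a h v u : ℕ} {x y : ℕ → ℕ} {r r' : ℝ} (ha : 1 ≤ a)
    (hx : GoodPath A ω a v u x r) (hy : GoodPath A ω h v u y r')
    (hinj : ∀ i < a + h, ∀ j < i, glue (a + h) a x y i ≠ glue (a + h) a x y j) :
    GoodCycle A ω (a + h) (glue (a + h) a x y) (r + r') := by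
  have h1 : ∀ i ≤ a, RealRAM.glue (a + h) a x y i = x i := fun i hi => if_pos hi
  have h2 : ∀ i ≤ h, RealRAM.glue (a + h) a x y (a + i) = y (h - i) := by
    intro i hi
    rw [RealRAM.glue]
    split_ifs with hc
    · obtain rfl : i = 0 := by omega
      rw [add_zero, hx.finish, Nat.sub_zero, hy.finish]
    · congr 1; omega
  refine ⟨?_, ?_, ?_, ?_⟩
  · rw [h2 h le_rfl, h1 0 (by omega), hx.start, Nat.sub_self, hy.start]
  · intro i hi
    rcases lt_or_ge i a with hia | hia
    · rw [h1 i hia.le, h1 (i + 1) hia]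
      exact hx.adj i hia
    · obtain ⟨j, rfl⟩ := Nat.exists_eq_add_of_le hia
      rw [h2 j (by omega), add_assoc, h2 (j + 1) (by omega)]
      have := hy.adj (h - (j + 1)) (by omega)
      rw [show h - (j + 1) + 1 = h - j by omega] at this
      exact hA _ _ this
  · intro i hi j hj hij
    rcases lt_trichotomy i j with hlt | rfl | hlt
    · exact (hinj j hj i hlt hij.symm).elim
    · rfl
    · exact (hinj i hi j hlt hij).elim
  · rw [Finset.sum_range_add, hx.weight, hy.weight]
    congr 1
    · refine Finset.sum_congr rfl fun i hi => ?_
      rw [Finset.mem_range] at hi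
      rw [h1 i hi.le, h1 (i + 1) hi]
    · rw [← Finset.sum_range_reflect]
      refine Finset.sum_congr rfl fun i hi => ?_
      rw [Finset.mem_range] at hi
      rw [h2 i hi.le, add_assoc, h2 (i + 1) hi, hω, show h - 1 - i + 1 = h - i by omega,
        show h - 1 - i = h - (i + 1) by omega]

/-- The slot for the cycles. -/
def outSlot (k : ℕ) : ℕ := sl (k + 1) 0

/-- Combines the path of length `a` in slot `(a, j / S)` with the path of length `h` in slot
`(h, j % S)`, and offers the result as a cycle. -/
def tryGlue (S a h j : ℕ) : Program :=
  .seq (.assign 10 (.const 0)) <|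
  .seq (load (fun i => if i ≤ a then .get (cP (sl a (j / S)) i) (.reg 12)
    else .get (cP (sl h (j % S)) (a + h - i)) (.reg 12)) (a + h + 1)) <|
  .seq (.rassign 0 (.add (.get (cW (sl a (j / S))) (.reg 12)) (.get (cW (sl h (j % S))) (.reg 12))))
    (offer (outSlot (a + h)) (a + h + 1) (.and (.eq (.get (cV (sl a (j / S))) (.reg 12)) (.const 1))
      (.and (.eq (.get (cV (sl h (j % S))) (.reg 12)) (.const 1))
        (.allN (fun i => .allN (fun i' => .not (.eq (.reg (20 + i)) (.reg (20 + i')))) i)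
          (a + h)))))

theorem loopFree_tryGlue (S a h j : ℕ) : (tryGlue S a h j).LoopFree :=
  ⟨trivial, loopFree_load _ _, trivial, loopFree_offer _ _ _⟩

theorem writes_tryGlue (S a h j : ℕ) : (tryGlue S a h j).writes ⊆ bodyLocs (outSlot (a + h)) := by
  intro l hl
  simp only [tryGlue, Program.writes, Set.mem_union, Set.mem_singleton_iff, mem_writes_load] at hl
  rcases hl with h | ⟨i, -, h⟩ | h | h
  · exact .inl h
  · exact .inr (.inl ⟨20 + i, by omega, h⟩)
  · exact .inr (.inr (.inl ⟨0, h⟩))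
  · exact .inr (.inr (.inr (writes_offer _ _ _ h)))

theorem exists_run_tryGlue {b S a h j n v w u : ℕ} (hb : 1 < 2 ^ b) {s : State}
    (hs : Loaded n v w u s) :
    ∃ (s' : State) (p : Test),
      (tryGlue S a h j).run b s = (offer (outSlot (a + h)) (a + h + 1) p).run b s' ∧
      s'.mem = s.mem ∧ s'.rmem = s.rmem ∧ s'.reg 10 = 0 ∧
      (∀ i < a + h + 1, s'.reg (20 + i) =
        glue (a + h) a (SP s a (v * n + u) (j / S)) (SP s h (v * n + u) (j % S)) i) ∧
      s'.rreg 0 = SW s a (v * n + u) (j / S) + SW s h (v * n + u) (j % S) ∧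
      (p.Holds b s' ↔ SV s a (v * n + u) (j / S) ∧ SV s h (v * n + u) (j % S) ∧
        ∀ i < a + h, ∀ i' < i,
          glue (a + h) a (SP s a (v * n + u) (j / S)) (SP s h (v * n + u) (j % S)) i ≠
          glue (a + h) a (SP s a (v * n + u) (j / S)) (SP s h (v * n + u) (j % S)) i') := by
  set s₁ := (Program.assign 10 (.const 0)).run b s with hs₁
  have h1 : ∀ x < 20, x ≠ 10 → s₁.reg x = s.reg x := by
    intro x hx hx'
    simp [hs₁, Program.run, hx']
  set f : ℕ → WordExp := fun i => if i ≤ a then .get (cP (sl a (j / S)) i) (.reg 12)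
    else .get (cP (sl h (j % S)) (a + h - i)) (.reg 12) with hf
  set s₂ := (load f (a + h + 1)).run b s₁ with hs₂
  have hag := (loopFree_load f (a + h + 1)).agree (b := b) s₁
  have h2 : ∀ x < 20, s₂.reg x = s₁.reg x := by
    intro x hx
    refine hag.reg x ?_
    rw [mem_writes_load]
    rintro ⟨i, -, h⟩
    rw [Loc.reg.injEq] at h
    omega
  have hmem : s₂.mem = s.mem := funext fun a => hag.mem a (by simp [mem_writes_load])
  have hrmem : s₂.rmem = s.rmem := funext fun a => hag.rmem a (by simp [mem_writes_load])
  have hload : ∀ i < a + h + 1, s₂.reg (20 + i) =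
      glue (a + h) a (SP s a (v * n + u) (j / S)) (SP s h (v * n + u) (j % S)) i := by
    intro i hi
    rw [hs₂, run_load s₁ ?_ i hi]
    · simp only [f, glue]
      split_ifs
      · simp [WordExp.eval, h1, hs.reg12, SP]; rfl
      · simp [WordExp.eval, h1, hs.reg12, SP]; rfl
    · intro j _ s' hm hr
      simp only [f]
      split_ifs
      · simp [WordExp.eval, hm, hr]
      · simp [WordExp.eval, hm, hr]
  have h12 : s₂.reg 12 = v * n + u := by
    rw [h2 12 (by omega), h1 12 (by omega) (by omega), hs.reg12]
  have h10 : s₂.reg 10 = 0 := by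
    rw [h2 10 (by omega)]
    simp [hs₁, Program.run, WordExp.eval]
  refine ⟨_, _, rfl, hmem, hrmem, h10, hload, ?_, ?_⟩
  · have : ((Program.rassign 0 (.add (.get (cW (sl a (j / S))) (.reg 12))
        (.get (cW (sl h (j % S))) (.reg 12)))).run b s₂).rreg 0 =
        SW s a (v * n + u) (j / S) + SW s h (v * n + u) (j % S) := by
      simp [Program.run, RealExp.eval, WordExp.eval, h12, hrmem, SW]
    exact this
  · set s₃ := (Program.rassign 0 (.add (.get (cW (sl a (j / S))) (.reg 12))
        (.get (cW (sl h (j % S))) (.reg 12)))).run b s₂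
    have hr3 : s₃.reg = s₂.reg := rfl
    have hm3 : s₃.mem = s.mem := hmem
    change Test.Holds b s₃ _ ↔ _
    simp only [Test.Holds, Test.holds_allN, WordExp.eval, hr3, hm3, h12, Nat.mod_eq_of_lt hb]
    refine and_congr Iff.rfl (and_congr Iff.rfl ?_)
    refine forall₂_congr fun i hi => forall₂_congr fun i' hi' => ?_
    rw [hload i (by omega), hload i' (by omega)]

/-- All steps of both ways around the cycle `c` are listed, up to half of its length. -/
def Covered (k h : ℕ) (s : State) (c : ℕ → ℕ) : Prop :=
  ∀ i < h, Trip s (c 0) (c i) (c (i + 1)) ∧ Trip s (c 0) (c (k - i)) (c (k - (i + 1)))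

/-- Exchange the arcs one at a time. The arc of length `a` is replaced by a stored path that misses
the inner vertices of the other arc, of which there are `h - 1 ≤ k - a`. Then the other arc, run
from the same start, is replaced by a stored path that misses the inner vertices of the new first
path, of which there are `a - 1 ≤ k - h`. No exchange loses weight, and the results meet only in
their common ends. -/
theorem exists_glue {b n S a h : ℕ} {A : ℕ → ℕ → Prop} {ω : ℕ → ℕ → ℝ}
    (hA : ∀ x y, A x y → x < n ∧ y < n) (hAs : ∀ x y, A x y → A y x)
    (hω : ∀ x y, ω x y = ω y x) (ha : 1 ≤ a) (hah : a ≤ h) {s : State}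
    (hs : Filled b (a + h) n S A ω h s) {c : ℕ → ℕ} {r : ℝ} (hc : GoodCycle A ω (a + h) c r)
    (hcov : Covered (a + h) h s c) :
    ∃ t < S, ∃ t' < S, SV s a (c 0 * n + c a) t ∧ SV s h (c 0 * n + c a) t' ∧
      r ≤ SW s a (c 0 * n + c a) t + SW s h (c 0 * n + c a) t' ∧
      ∀ i < a + h, ∀ i' < i,
          glue (a + h) a (SP s a (c 0 * n + c a) t) (SP s h (c 0 * n + c a) t') i ≠
          glue (a + h) a (SP s a (c 0 * n + c a) t) (SP s h (c 0 * n + c a) t') i' := by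
  set v := c 0 with hv
  set u := c a with hu
  have hvn : v < n := (hA _ _ (hc.adj 0 (by omega))).1
  have hun : u < n := (hA _ _ (hc.adj a (by omega))).1
  set y : ℕ → ℕ := fun i => c (a + h - i) with hy
  have hx : GoodPath A ω a v u c (∑ i ∈ Finset.range a, ω (c i) (c (i + 1))) :=
    ⟨rfl, rfl, fun i hi => hc.adj i (by omega),
      fun i hi j hj => hc.inj i (by omega) j (by omega), rfl⟩
  have hy0 : y 0 = v := hc.closed
  have hyh : y h = u := by simp [hy, hu]
  have hyp : GoodPath A ω h v u y (∑ i ∈ Finset.range h, ω (y i) (y (i + 1))) := by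
    refine ⟨hy0, hyh, fun i hi => ?_, fun i hi j hj hij => ?_, rfl⟩
    · have := hc.adj (a + h - (i + 1)) (by omega)
      rw [show a + h - (i + 1) + 1 = a + h - i by omega] at this
      exact hAs _ _ this
    · rcases Nat.eq_zero_or_pos i with rfl | hi0 <;> rcases Nat.eq_zero_or_pos j with rfl | hj0
      · rfl
      · rw [hy0] at hij
        have := hc.inj 0 (by omega) (a + h - j) (by omega) hij
        omega
      · rw [hy0] at hij
        have := hc.inj (a + h - i) (by omega) 0 (by omega) hij
        omega
      · have := hc.inj (a + h - i) (by omega) (a + h - j) (by omega) hij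
        omega
  have hr : r = (∑ i ∈ Finset.range a, ω (c i) (c (i + 1))) +
      ∑ i ∈ Finset.range h, ω (y i) (y (i + 1)) := by
    rw [hc.weight, Finset.sum_range_add]
    congr 1
    rw [← Finset.sum_range_reflect]
    refine Finset.sum_congr rfl fun i hi => ?_
    rw [Finset.mem_range] at hi
    simp only [hy]
    rw [hω, show a + (h - 1 - i) + 1 = a + h - i by omega,
      show a + (h - 1 - i) = a + h - (i + 1) by omega]
  -- Open intervals: the ends lie on both arcs, so they must stay out of the forbidden set.
  obtain ⟨t, ht, h1, h2, h3⟩ := hs.rep a hah v u c _ hvn hx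
    (fun i hi => (hcov i (by omega)).1) ((Finset.Ioo 0 h).image y)
    (Finset.card_image_le.trans (by simp)) (by
      intro i hi hmem
      simp only [Finset.mem_image, Finset.mem_Ioo] at hmem
      obtain ⟨j, hj, hji⟩ := hmem
      have := hc.inj (a + h - j) (by omega) i (by omega) hji
      omega)
  have hP : GoodPath A ω a v u (SP s a (v * n + u) t) (SW s a (v * n + u) t) := by
    obtain ⟨v', u', hv', hu', he, hg⟩ := hs.sound a hah t ht _ h1
    obtain ⟨rfl, rfl⟩ := pair_index_inj hun hu' he
    exact hg
  obtain ⟨t', ht', h4, h5, h6⟩ := hs.rep h le_rfl v u y _ hvn hyp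
    (fun i hi => (hcov i hi).2) ((Finset.Ioo 0 a).image (SP s a (v * n + u) t))
    (Finset.card_image_le.trans (by simp)) (by
      intro j hj hmem
      simp only [Finset.mem_image, Finset.mem_Ioo] at hmem
      obtain ⟨i, hi, hij⟩ := hmem
      rcases Nat.eq_zero_or_pos j with rfl | hj0
      · have := hP.inj i (by omega) 0 (by omega) (by rw [hij, hy0, hP.start])
        omega
      · rcases hj.lt_or_eq with hjh | rfl
        · refine h3 i (by omega) ?_
          rw [hij]
          exact Finset.mem_image_of_mem _ (Finset.mem_Ioo.2 ⟨hj0, hjh⟩)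
        · have := hP.inj i (by omega) a le_rfl (by rw [hij, hyh, hP.finish])
          omega)
  have hQ : GoodPath A ω h v u (SP s h (v * n + u) t') (SW s h (v * n + u) t') := by
    obtain ⟨v', u', hv', hu', he, hg⟩ := hs.sound h le_rfl t' ht' _ h4
    obtain ⟨rfl, rfl⟩ := pair_index_inj hun hu' he
    exact hg
  refine ⟨t, ht, t', ht', h1, h4, by rw [hr]; exact add_le_add h2 h5, ?_⟩
  -- A repetition within one path contradicts its injectivity. One between the two paths is either
  -- at an inner vertex of the first, excluded by `h6`, or at a common end, where injectivity of the
  -- second fixes the position.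
  intro i hi i' hi' heq
  rw [glue, glue] at heq
  split_ifs at heq with hc1 hc2 hc2
  · have := hP.inj i hc1 i' hc2 heq
    omega
  · omega
  · rcases Nat.eq_zero_or_pos i' with rfl | h0
    · have := hQ.inj _ (by omega) 0 (by omega) (heq.trans (hP.start.trans hQ.start.symm))
      omega
    · rcases hc2.lt_or_eq with hlt | rfl
      · refine h6 (a + h - i) (by omega) ?_
        rw [heq]
        exact Finset.mem_image_of_mem _ (Finset.mem_Ioo.2 ⟨h0, hlt⟩)
      · have := hQ.inj _ (by omega) h le_rfl (heq.trans (hP.finish.trans hQ.finish.symm))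
        omega
  · have := hQ.inj _ (by omega) _ (by omega) heq
    omega

/-- Offers all combinations of paths as cycles. -/
def glueAll (S a h : ℕ) : Program := scan (tryGlue S a h) (S * S)

/-- Number of steps of `glueAll` per triple. -/
def glueCost (S a h : ℕ) : ℕ :=
  (loadTriple.maxCost + (Program.seqN (tryGlue S a h) (S * S)).maxCost) + 7

/-- Only `v` and `u` of a triple matter here. The needed pair `(c 0, c a)` does occur, since the
last step of the first arc is listed. All cycles are offered under the single key 0, so one maximum
remains. -/
theorem runs_glueAll {b n S a h : ℕ} {A : ℕ → ℕ → Prop} {ω : ℕ → ℕ → ℝ}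
    (hA : ∀ x y, A x y → x < n ∧ y < n) (hAs : ∀ x y, A x y → A y x)
    (hω : ∀ x y, ω x y = ω y x) (ha : 1 ≤ a) (hah : a ≤ h)
    (hb : n * n ≤ 2 ^ b) (hb1 : 1 < 2 ^ b) {s₀ : State}
    (hs₀ : Filled b (a + h) n S A ω h s₀) :
    Runs b (glueAll S a h) s₀ (glueCost S a h * (s₀.reg 4 + 1))
      (fun s => Sound (outSlot (a + h)) (fun _ => GoodCycle A ω (a + h)) s ∧
        ∀ c r, GoodCycle A ω (a + h) c r → Covered (a + h) h s₀ c →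
          Has (outSlot (a + h)) 0 r s) := by
  have hneA : ∀ t, sl a t ≠ outSlot (a + h) := by intro t; simp [outSlot]; omega
  have hneH : ∀ t, sl h t ≠ outSlot (a + h) := by intro t; simp [outSlot]; omega
  have hrun := runs_scan (b := b) hA hb hs₀.ctx (g := outSlot (a + h)) (N := S * S)
    (f := tryGlue S a h)
    (fun j _ => loopFree_tryGlue S a h j) (fun j _ => writes_tryGlue S a h j)
    (Good := fun _ => GoodCycle A ω (a + h))
    (Cand := fun v w u j => SV s₀ a (v * n + u) (j / S) ∧ SV s₀ h (v * n + u) (j % S) ∧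
        ∀ i < a + h, ∀ i' < i,
          glue (a + h) a (SP s₀ a (v * n + u) (j / S)) (SP s₀ h (v * n + u) (j % S)) i ≠
          glue (a + h) a (SP s₀ a (v * n + u) (j / S)) (SP s₀ h (v * n + u) (j % S)) i')
    (key := fun _ _ _ => 0)
    (R := fun v w u j => SW s₀ a (v * n + u) (j / S) + SW s₀ h (v * n + u) (j % S)) ?_
    (fun key hkey => (hs₀.empty _ (by omega) 0 key hkey).elim)
  · refine hrun.mono le_rfl ?_
    rintro s ⟨-, hsnd, hcomp⟩
    refine ⟨hsnd, fun c r hc hcov => ?_⟩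
    obtain ⟨t, ht, t', ht', h1, h2, h3, h4⟩ := exists_glue hA hAs hω ha hah hs₀ hc hcov
    have hS : 0 < S := by omega
    -- The index below `S * S` encodes the two nodes whose paths are combined.
    have e1 : (S * t + t') / S = t := by
      rw [Nat.mul_add_div hS, Nat.div_eq_of_lt ht', add_zero]
    have e2 : (S * t + t') % S = t' := by rw [Nat.mul_add_mod, Nat.mod_eq_of_lt ht']
    have htrip : Trip s₀ (c 0) (c (a - 1)) (c a) := by
      have := (hcov (a - 1) (by omega)).1
      rwa [Nat.sub_add_cancel ha] at this
    have := hcomp _ _ _ htrip (S * t + t') (by nlinarith)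
    rw [e1, e2] at this
    obtain ⟨g1, g2⟩ := this ⟨h1, h2, h4⟩
    exact ⟨g1, h3.trans g2⟩
  · intro v w u hv hwu j hj s hag hl hsnd
    have hS : 0 < S := Nat.pos_of_ne_zero (by rintro rfl; simp at hj)
    obtain ⟨hw, hu⟩ := hA _ _ hwu
    obtain ⟨s', p, he, hm, hr, h10, hreg, hw0, hp⟩ :=
      exists_run_tryGlue (b := b) (S := S) (a := a) (h := h) (j := j) hb1 hl
    obtain ⟨e1, e2, e3⟩ := hag.slot (hneA (j / S)) (v * n + u)
    obtain ⟨e4, e5, e6⟩ := hag.slot (hneH (j % S)) (v * n + u)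
    rw [e3, e6] at hw0
    rw [e1, e2, e4, e5] at hp
    rw [e2, e5] at hreg
    rw [he]
    refine ⟨Sound.run_offer hb1 ?_ ?_ ?_, fun κ r hH => Has.run_offer hb1 ?_, ?_⟩
    · intro key x y r hxy hc
      exact hc.congr fun i hi => hxy i (by omega)
    · intro key hkey
      rw [hm] at hkey ⊢
      rw [hr]
      exact hsnd key hkey
    · intro hp'
      obtain ⟨h1, h2, h3⟩ := hp.1 hp'
      rw [hw0]
      have hdiv : j / S < S := Nat.div_lt_of_lt_mul hj
      obtain ⟨v', u', hv', hu', hkey, hg⟩ := hs₀.sound a hah _ hdiv _ h1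
      obtain ⟨rfl, rfl⟩ := pair_index_inj hu hu' hkey
      obtain ⟨v', u', hv', hu', hkey, hg'⟩ := hs₀.sound h le_rfl _ (Nat.mod_lt j hS) _ h2
      obtain ⟨rfl, rfl⟩ := pair_index_inj hu hu' hkey
      exact (hg.glue hAs hω ha hg' h3).congr fun i hi => (hreg i (by omega)).symm
    · rw [Has, hm, hr]; exact hH
    · intro hc
      have := has_run_offer (g := outSlot (a + h)) (N := a + h + 1) hb1 (hp.2 hc)
      rwa [h10, hw0] at this

/-! ### Output -/

/-- Copies the best cycle to its place. -/
def output (k : ℕ) : Program :=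
  .seq (.ite (.eq (.get (cV (outSlot k)) (.const 0)) (.const 1)) (.assign 2 (.const 1))
    (.assign 2 (.const 0)))
    (.seqN (fun i => .store 2 (.const i) (.get (cP (outSlot k) i) (.const 0))) k)

theorem loopFree_output (k : ℕ) : (output k).LoopFree :=
  ⟨⟨trivial, trivial⟩, Program.loopFree_seqN fun _ _ => trivial⟩

/-- The answer in the memory is correct. -/
def Answer (A : ℕ → ℕ → Prop) (ω : ℕ → ℕ → ℝ) (k : ℕ) (s : State) : Prop :=
  (s.reg 2 = 1 ∧ ∃ x r, GoodCycle A ω k x r ∧ (∀ i < k, s.mem 2 i = x i) ∧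
    ∀ c r', GoodCycle A ω k c r' → r' ≤ r) ∨
  (s.reg 2 = 0 ∧ ∀ c r', ¬ GoodCycle A ω k c r')

/-- Soundness makes a stored record a genuine cycle and `hcomp` makes it a heaviest one; any cycle
would set the flag, so an unset flag means there is none. `hbk` keeps the literal output positions
from being reduced modulo `2 ^ b`. -/
theorem answer_run_output {b k : ℕ} {A : ℕ → ℕ → Prop} {ω : ℕ → ℕ → ℝ} (hb1 : 1 < 2 ^ b)
    (hbk : k ≤ 2 ^ b) {s : State} (hs : Sound (outSlot k) (fun _ => GoodCycle A ω k) s)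
    (hcomp : ∀ c r, GoodCycle A ω k c r → Has (outSlot k) 0 r s) :
    Answer A ω k ((output k).run b s) := by
  set P : Program := .ite (.eq (.get (cV (outSlot k)) (.const 0)) (.const 1)) (.assign 2 (.const 1))
    (.assign 2 (.const 0))
  set s₁ := P.run b s with hs₁
  have hm1 : s₁.mem = s.mem := by
    funext a
    refine ((show P.LoopFree from ⟨trivial, trivial⟩).agree s).mem a ?_
    simp [P, Program.writes]
  have hreg1 : s₁.reg 2 = if s.mem (cV (outSlot k)) 0 = 1 then 1 else 0 := by
    simp only [hs₁, P, Program.run, Test.Holds, WordExp.eval, Nat.mod_eq_of_lt hb1, Nat.zero_mod]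
    split_ifs <;> simp
  set f : ℕ → Program := fun i => .store 2 (.const i) (.get (cP (outSlot k) i) (.const 0))
  have hrun : (output k).run b s = (Program.seqN f k).run b s₁ := rfl
  have hag := (Program.loopFree_seqN (f := f) (N := k) (fun _ _ => trivial)).agree (b := b) s₁
  have hr : ((output k).run b s).reg 2 = s₁.reg 2 := hag.reg 2 (by simp [f, Program.writes])
  have hmem : ∀ i < k, ((output k).run b s).mem 2 i = s.mem (cP (outSlot k) i) 0 := by
    rw [hrun]
    refine Program.run_seqN_induct (b := b) (f := f) (N := k) (fun _ _ => trivial)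
      (fun j s' => ∀ i < j, s'.mem 2 i = s.mem (cP (outSlot k) i) 0) (by simp) ?_
    intro j hj s' hag' hI i hi
    have hcP : s'.mem (cP (outSlot k) j) = s.mem (cP (outSlot k) j) := by
      rw [← hm1]
      refine hag'.mem _ ?_
      have := ten_le_cP (outSlot k) j
      simp [f, Program.writes]
      omega
    simp only [f, Program.run, Function.update_self, WordExp.eval,
      Nat.mod_eq_of_lt (hj.trans_le hbk), Nat.zero_mod, hcP]
    rcases Nat.lt_succ_iff_lt_or_eq.1 hi with h | rfl
    · rw [Function.update_of_ne (by omega), hI i h]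
    · rw [Function.update_self]
  by_cases hflag : s.mem (cV (outSlot k)) 0 = 1
  · left
    refine ⟨by rw [hr, hreg1, if_pos hflag], _, _, hs 0 hflag, hmem, fun c r' hc => ?_⟩
    exact (hcomp c r' hc).2
  · right
    exact ⟨by rw [hr, hreg1, if_neg hflag], fun c r' hc => hflag (hcomp c r' hc).1⟩

/-! ### Reading the input -/

/-- The graph is given by `m` edges, the `i`-th with the end points `e₁ i` and `e₂ i`. -/
structure Input (n m : ℕ) (e₁ e₂ : ℕ → ℕ) (ω : ℕ → ℕ → ℝ) (s : State) : Prop where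
  reg_zero : s.reg 0 = n
  reg_one : s.reg 1 = m
  fst : ∀ i < m, s.mem 0 i = e₁ i
  snd : ∀ i < m, s.mem 1 i = e₂ i
  weight : ∀ i < m, s.rmem 0 i = ω (e₁ i) (e₂ i)
  mem : ∀ a ≥ 2, ∀ i, s.mem a i = 0
  rmem : ∀ a ≥ 1, ∀ i, s.rmem a i = 0

/-- First `f 0, …, f (m - 1)`, then `g 0, g 1, …`. -/
def orient (m : ℕ) (f g : ℕ → ℕ) (i : ℕ) : ℕ := if i < m then f i else g (i - m)

/-- The arrays `E₁`, `E₂` list the edges in both directions. -/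
structure Oriented (n m : ℕ) (E₁ E₂ : ℕ → ℕ) (ω : ℕ → ℕ → ℝ) (s : State) : Prop where
  reg_zero : s.reg 0 = n
  reg_one : s.reg 1 = m
  reg_two_mul : s.reg 16 = 2 * m
  fst : ∀ i < 2 * m, s.mem 0 i = E₁ i
  snd : ∀ i < 2 * m, s.mem 1 i = E₂ i
  weight : ∀ i < 2 * m, s.rmem 0 i = ω (E₁ i) (E₂ i)
  mem : ∀ a ≥ 2, ∀ i, s.mem a i = 0
  rmem : ∀ a ≥ 1, ∀ i, s.rmem a i = 0

/-- Lists the edge at the index in register `5` also in the other direction. -/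
def orientBody : Program :=
  .seq (.store 0 (.add (.reg 1) (.reg 5)) (.get 1 (.reg 5))) <|
  .seq (.store 1 (.add (.reg 1) (.reg 5)) (.get 0 (.reg 5)))
    (.rstore 0 (.add (.reg 1) (.reg 5)) (.get 0 (.reg 5)))

/-- Lists all edges in both directions. -/
def orientEdges : Program :=
  .seq (.assign 5 (.const 0)) <| .seq (.forTo 5 1 orientBody)
    (.assign 16 (.add (.reg 1) (.reg 1)))

theorem loopFree_orientBody : orientBody.LoopFree := ⟨trivial, trivial, trivial⟩

theorem runs_orientEdges {b n m : ℕ} {e₁ e₂ : ℕ → ℕ} {ω : ℕ → ℕ → ℝ}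
    (hω : ∀ x y, ω x y = ω y x) (hb : 2 * m < 2 ^ b) {s₀ : State} (h₀ : Input n m e₁ e₂ ω s₀) :
    Runs b orientEdges s₀ ((orientBody.maxCost + 20) * (m + 1))
      (Oriented n m (orient m e₁ e₂) (orient m e₂ e₁) ω) := by
  have hws : orientBody.writes = {.mem 0} ∪ ({.mem 1} ∪ {.rmem 0}) := rfl
  have hloop := Runs.forTo (b := b) (x := 5) (y := 1) (P := orientBody)
    (s₀ := (Program.assign 5 (.const 0)).run b s₀)
    (fun _ => orientBody.maxCost)
    (fun j s => s.reg 0 = n ∧ s.reg 1 = m ∧ (∀ i < m, s.mem 0 i = e₁ i ∧ s.mem 1 i = e₂ i ∧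
      s.rmem 0 i = ω (e₁ i) (e₂ i)) ∧ (∀ i < j, s.mem 0 (m + i) = e₂ i ∧
      s.mem 1 (m + i) = e₁ i ∧ s.rmem 0 (m + i) = ω (e₂ i) (e₁ i)) ∧
      (∀ a ≥ 2, ∀ i, s.mem a i = 0) ∧ ∀ a ≥ 1, ∀ i, s.rmem a i = 0)
    0 m (by simp [hws]) (by simp [hws]) (by omega)
    (by simp [Program.run, WordExp.eval]) (by simp [Program.run, h₀.reg_one]) (Nat.zero_le _)
    (by omega) (fun j s v h => h)
    ⟨h₀.reg_zero, h₀.reg_one, fun i hi => ⟨h₀.fst i hi, h₀.snd i hi, h₀.weight i hi⟩, by simp,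
      h₀.mem, h₀.rmem⟩ ?_
  · refine (Program.LoopFree.runs_seq (P := .assign 5 (.const 0)) trivial
      (hloop.seq (T' := 4) fun s hs => Program.LoopFree.runs
        (P := .assign 16 (.add (.reg 1) (.reg 1))) trivial ?_)).mono ?_ fun _ h => h
    · obtain ⟨-, h0, h1, h2, h3, h4, h5⟩ := hs
      have hc : ∀ i, i < 2 * m → i < m ∨ ∃ j < m, i = m + j := fun i hi => by
        by_cases h : i < m
        · exact .inl h
        · exact .inr ⟨i - m, by omega, by omega⟩
      refine ⟨h0, h1, ?_, fun i hi => ?_, fun i hi => ?_, fun i hi => ?_, h4, h5⟩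
      · simp [Program.run, WordExp.eval, h1]
        rw [Nat.mod_eq_of_lt (by omega)]; omega
      all_goals
        simp only [Program.run]
        rcases hc i hi with h | ⟨j, hj, rfl⟩
        · simp [orient, h, h2 i h]
        · simp [orient, h3 j hj]
    · simp only [Program.maxCost, WordExp.cost, Finset.sum_const, Nat.card_Ico, smul_eq_mul,
        Nat.sub_zero]
      ring_nf
      omega
  · rintro j - hj s - h5 ⟨h0, h1, h2, h3, h4, hr⟩
    refine loopFree_orientBody.runs ?_
    have e1 : (m + j) % 2 ^ b = m + j := Nat.mod_eq_of_lt (by omega)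
    -- The weight and the first end point are read at `j` when array 0 has already received an entry
    -- at `m + j`; the two cells differ.
    have hne : j ≠ m + j := by omega
    refine ⟨h0, h1, fun i hi => ?_, fun i hi => ?_, fun a ha i => ?_, fun a ha i => ?_⟩
    · have hne' : i ≠ m + j := by omega
      simp [orientBody, Program.run, WordExp.eval, RealExp.eval, h1, h5, e1, hne', h2 i hi]
    · rcases Nat.lt_succ_iff_lt_or_eq.1 hi with h | rfl
      · simp [orientBody, Program.run, WordExp.eval, RealExp.eval, h1, h5, e1, h3 i h,
          h.ne]
      · simp [orientBody, Program.run, WordExp.eval, RealExp.eval, h1, h5, e1,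
          Function.update_of_ne hne, h2 i hj, hω (e₂ i) (e₁ i)]
    · have g1 : a ≠ 0 := by omega
      have g2 : a ≠ 1 := by omega
      simp [orientBody, Program.run, g1, g2, h4 a ha]
    · have g1 : a ≠ 0 := by omega
      simp [orientBody, Program.run, g1, hr a ha]

/-! ### Weight, degree and adjacency tables, and the paths of length zero -/

/-- Number of edges from `v` among the first `e`. -/
def degUpTo (E₁ : ℕ → ℕ) (e v : ℕ) : ℕ := ((Finset.range e).filter fun i => E₁ i = v).card

theorem degUpTo_succ (E₁ : ℕ → ℕ) (e v : ℕ) :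
    degUpTo E₁ (e + 1) v = degUpTo E₁ e v + if E₁ e = v then 1 else 0 := by
  rw [degUpTo, degUpTo, Finset.range_add_one, Finset.filter_insert]
  split_ifs with h
  · rw [Finset.card_insert_of_notMem (by simp)]
  · rfl

theorem degUpTo_le (E₁ : ℕ → ℕ) (e v : ℕ) : degUpTo E₁ e v ≤ e :=
  (Finset.card_filter_le _ _).trans (by simp)

/-- The data structures after the first `e` directed edges were processed. -/
structure Indexed (n m : ℕ) (E₁ E₂ : ℕ → ℕ) (ω : ℕ → ℕ → ℝ) (e : ℕ) (s : State) : Prop where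
  reg_zero : s.reg 0 = n
  reg_one : s.reg 1 = m
  reg_two_mul : s.reg 16 = 2 * m
  fst : ∀ i < 2 * m, s.mem 0 i = E₁ i
  snd : ∀ i < 2 * m, s.mem 1 i = E₂ i
  input : ∀ i < 2 * m, s.rmem 0 i = ω (E₁ i) (E₂ i)
  weight : ∀ i < e, s.rmem 1 (E₁ i * n + E₂ i) = ω (E₁ i) (E₂ i)
  list : ∀ i < e, s.mem 5 i = E₁ i ∧ s.mem 6 i = E₁ i ∧ s.mem 7 i = E₂ i
  deg : ∀ v, s.mem 3 v = degUpTo E₁ e v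
  adj : ∀ i < e, ∃ j < degUpTo E₁ e (E₁ i), s.mem 4 (E₁ i * (2 * m) + j) = E₂ i
  adj_sound : ∀ v < n, ∀ j < degUpTo E₁ e v,
    ∃ i < e, E₁ i = v ∧ s.mem 4 (v * (2 * m) + j) = E₂ i
  root : ∀ i < e, SV s 0 (E₁ i * n + E₁ i) 0
  root_sound : ∀ key, SV s 0 key 0 → ∃ v < n, key = v * n + v ∧ SP s 0 key 0 0 = v
  flag : ∀ ℓ t, (ℓ, t) ≠ (0, 0) → ∀ key, s.mem (cV (sl ℓ t)) key = 0
  rmem : ∀ a ≥ 2, ∀ i, s.rmem a i = 0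

/-- Processes the directed edge at the index in register `5`. -/
def indexBody : Program :=
  .seq (.assign 6 (.get 0 (.reg 5))) <| .seq (.assign 8 (.get 1 (.reg 5))) <|
  .seq (.rstore 1 (.add (.mul (.reg 6) (.reg 0)) (.reg 8)) (.get 0 (.reg 5))) <|
  .seq (.store 4 (.add (.mul (.reg 6) (.reg 16)) (.get 3 (.reg 6))) (.reg 8)) <|
  .seq (.store 3 (.reg 6) (.add (.get 3 (.reg 6)) (.const 1))) <|
  .seq (.store 5 (.reg 5) (.reg 6)) <| .seq (.store 6 (.reg 5) (.reg 6)) <|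
  .seq (.store 7 (.reg 5) (.reg 8)) <|
  .seq (.store (cV (sl 0 0)) (.add (.mul (.reg 6) (.reg 0)) (.reg 6)) (.const 1))
    (.store (cP (sl 0 0) 0) (.add (.mul (.reg 6) (.reg 0)) (.reg 6)) (.reg 6))

/-- Builds the data structures. -/
def indexEdges : Program :=
  .seq (.assign 5 (.const 0)) <| .seq (.forTo 5 16 indexBody) (.assign 4 (.reg 16))

theorem loopFree_indexBody : indexBody.LoopFree :=
  ⟨trivial, trivial, trivial, trivial, trivial, trivial, trivial, trivial, trivial, trivial⟩

theorem add_mul_lt {v n m j : ℕ} (hv : v < n) (hj : j < m) : v * m + j < n * m := by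
  nlinarith

/-- The memory after `indexBody`. -/
theorem run_indexBody {b n m e v u d : ℕ} (hb : n * n ≤ 2 ^ b) (hb' : n * (2 * m) ≤ 2 ^ b)
    (hb1 : 2 * m + 1 < 2 ^ b) (hv : v < n) (hu : u < n) (hd : d < 2 * m) {s : State}
    (h0 : s.reg 0 = n) (h16 : s.reg 16 = 2 * m) (h5 : s.reg 5 = e) (h1 : s.mem 0 e = v)
    (h2 : s.mem 1 e = u) (h3 : s.mem 3 v = d) :
    (indexBody.run b s).rmem 0 = s.rmem 0 ∧
    (indexBody.run b s).rmem 1 = Function.update (s.rmem 1) (v * n + u) (s.rmem 0 e) ∧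
    (indexBody.run b s).mem 3 = Function.update (s.mem 3) v (d + 1) ∧
    (indexBody.run b s).mem 4 = Function.update (s.mem 4) (v * (2 * m) + d) u ∧
    (indexBody.run b s).mem 5 = Function.update (s.mem 5) e v ∧
    (indexBody.run b s).mem 6 = Function.update (s.mem 6) e v ∧
    (indexBody.run b s).mem 7 = Function.update (s.mem 7) e u ∧
    (indexBody.run b s).mem (cV (sl 0 0)) =
      Function.update (s.mem (cV (sl 0 0))) (v * n + v) 1 ∧
    (indexBody.run b s).mem (cP (sl 0 0) 0) =
      Function.update (s.mem (cP (sl 0 0) 0)) (v * n + v) v := by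
  have e1 := pair_index_mod hb hv hu
  have e2 := pair_index_mod hb hv hv
  have e3 : (v * (2 * m) % 2 ^ b + d) % 2 ^ b = v * (2 * m) + d := by
    have := add_mul_lt hv hd
    rw [Nat.mod_eq_of_lt (by omega : v * (2 * m) < 2 ^ b), Nat.mod_eq_of_lt (by omega)]
  have e4 : (d + 1) % 2 ^ b = d + 1 := Nat.mod_eq_of_lt (by omega)
  have e5 : 1 % 2 ^ b = 1 := Nat.mod_eq_of_lt (by omega)
  have g : ∀ c < 10, c ≠ cV (sl 0 0) := fun c hc => by have := ten_le_cV (sl 0 0); omega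
  have g' : ∀ c < 10, c ≠ cP (sl 0 0) 0 := fun c hc => by have := ten_le_cP (sl 0 0) 0; omega
  refine ⟨?_, ?_, ?_, ?_, ?_, ?_, ?_, ?_, ?_⟩ <;>
  simp [indexBody, Program.run, WordExp.eval, RealExp.eval, h0, h16, h5, h1, h2, h3, e1, e2, e3,
    e4, e5, -Nat.mod_add_mod, -Nat.add_mod_mod, g, g', (g _ _).symm, (g' _ _).symm]

theorem writes_indexBody : indexBody.writes ⊆ {l | l = .reg 6 ∨ l = .reg 8 ∨ l = .rmem 1 ∨
    (∃ a, 3 ≤ a ∧ a < 8 ∧ l = .mem a) ∨ l = .mem (cV (sl 0 0)) ∨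
    l = .mem (cP (sl 0 0) 0)} := by
  intro l hl
  simp only [indexBody, Program.writes, Set.mem_union, Set.mem_singleton_iff] at hl
  simp only [Set.mem_ofPred_eq]
  rcases hl with h | h | h | h | h | h | h | h | h | h
  · exact .inl h
  · exact .inr (.inl h)
  · exact .inr (.inr (.inl h))
  iterate 5 exact .inr (.inr (.inr (.inl ⟨_, by omega, by omega, h⟩)))
  · exact .inr (.inr (.inr (.inr (.inl h))))
  · exact .inr (.inr (.inr (.inr (.inr h))))

/-- The current degree of a vertex is the next free position in its row of neighbours. Rows have
length `2 * m`, and all positions in use lie below that, so rows never overlap. -/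
theorem Indexed.step {b n m e : ℕ} {E₁ E₂ : ℕ → ℕ} {ω : ℕ → ℕ → ℝ} (hb : n * n ≤ 2 ^ b)
    (hb' : n * (2 * m) ≤ 2 ^ b) (hb1 : 2 * m + 1 < 2 ^ b) (he : e < 2 * m)
    (hE : ∀ i < 2 * m, E₁ i < n ∧ E₂ i < n) {s : State} (hs : Indexed n m E₁ E₂ ω e s)
    (h5 : s.reg 5 = e) : Indexed n m E₁ E₂ ω (e + 1) (indexBody.run b s) := by
  obtain ⟨hv, hu⟩ := hE e he
  have hd : degUpTo E₁ e (E₁ e) < 2 * m := (degUpTo_le _ _ _).trans_lt he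
  obtain ⟨r0, r1, m3, m4, m5, m6, m7, mV, mP⟩ := run_indexBody hb hb' hb1 hv hu hd
    hs.reg_zero hs.reg_two_mul h5 (hs.fst e he) (hs.snd e he) (hs.deg (E₁ e))
  have hag := (loopFree_indexBody.agree (b := b) s).mono writes_indexBody
  have hreg : ∀ x, x ≠ 6 → x ≠ 8 → (indexBody.run b s).reg x = s.reg x := by
    intro x h6 h8
    exact hag.reg x (by simp [h6, h8])
  have hmem : ∀ a, (a < 3 ∨ 8 ≤ a) → a ≠ cV (sl 0 0) → a ≠ cP (sl 0 0) 0 →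
      (indexBody.run b s).mem a = s.mem a := by
    intro a h1 h2 h3
    refine hag.mem a ?_
    simp [h2, h3]
    omega
  have hlow : ∀ a < 3, (indexBody.run b s).mem a = s.mem a := fun a ha =>
    hmem a (.inl ha) (by have := ten_le_cV (sl 0 0); omega)
      (by have := ten_le_cP (sl 0 0) 0; omega)
  have hlt : ∀ {i}, i < e + 1 → i < e ∨ i = e := fun h => Nat.lt_succ_iff_lt_or_eq.1 h
  refine ⟨by rw [hreg 0 (by omega) (by omega), hs.reg_zero],
    by rw [hreg 1 (by omega) (by omega), hs.reg_one],
    by rw [hreg 16 (by omega) (by omega), hs.reg_two_mul],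
    by rw [hlow 0 (by omega)]; exact hs.fst, by rw [hlow 1 (by omega)]; exact hs.snd,
    by rw [r0]; exact hs.input, ?_, ?_, ?_, ?_, ?_, ?_, ?_, ?_, ?_⟩
  · intro i hi
    rw [r1]
    -- Should a pair occur again, its entry is rewritten with the same weight, so distinctness of
    -- the listed edges plays no role.
    by_cases heq : E₁ i * n + E₂ i = E₁ e * n + E₂ e
    · obtain ⟨g1, g2⟩ := pair_index_inj (hE i (by omega)).2 hu heq
      rw [heq, Function.update_self, g1, g2, hs.input e he]
    · rw [Function.update_of_ne heq]
      rcases hlt hi with h | rfl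
      · exact hs.weight i h
      · exact (heq rfl).elim
  · intro i hi
    rw [m5, m6, m7]
    rcases hlt hi with h | rfl
    · simpa only [Function.update_of_ne h.ne] using hs.list i h
    · simp
  · intro v
    rw [m3, degUpTo_succ]
    by_cases h : v = E₁ e
    · subst h; simp
    · rw [Function.update_of_ne h, hs.deg, if_neg (Ne.symm h), add_zero]
  · intro i hi
    rw [m4]
    rcases hlt hi with h | rfl
    · obtain ⟨j, hj, h1⟩ := hs.adj i h
      refine ⟨j, by rw [degUpTo_succ]; omega, ?_⟩
      rw [Function.update_of_ne, h1]
      intro heq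
      obtain ⟨g1, g2⟩ := pair_index_inj (hj.trans_le ((degUpTo_le _ _ _).trans he.le)) hd heq
      rw [g1] at hj
      omega
    · refine ⟨_, ?_, Function.update_self _ _ _⟩
      rw [degUpTo_succ, if_pos rfl]; omega
  · intro v hvn j hj
    rw [m4]
    rw [degUpTo_succ] at hj
    by_cases heq : v * (2 * m) + j = E₁ e * (2 * m) + degUpTo E₁ e (E₁ e)
    · rw [heq, Function.update_self]
      refine ⟨e, by omega, ?_, rfl⟩
      have hj' : j < 2 * m := by
        have := degUpTo_le E₁ e v
        split_ifs at hj
        · omega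
        · omega
      exact (pair_index_inj hj' hd heq).1.symm
    · rw [Function.update_of_ne heq]
      have hj' : j < degUpTo E₁ e v := by
        split_ifs at hj with hev
        · rcases Nat.lt_succ_iff_lt_or_eq.1 hj with h | rfl
          · exact h
          · subst hev; exact (heq rfl).elim
        · exact hj
      obtain ⟨i, hi, h1, h2⟩ := hs.adj_sound v hvn j hj'
      exact ⟨i, by omega, h1, h2⟩
  · intro i hi
    rw [SV, mV]
    rcases hlt hi with h | rfl
    · by_cases heq : E₁ i * n + E₁ i = E₁ e * n + E₁ e
      · rw [heq, Function.update_self]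
      · rw [Function.update_of_ne heq]; exact hs.root i h
    · rw [Function.update_self]
  · intro key hkey
    rw [SV, mV] at hkey
    rw [SP, mP]
    by_cases heq : key = E₁ e * n + E₁ e
    · exact ⟨E₁ e, hv, heq, by rw [heq, Function.update_self]⟩
    · rw [Function.update_of_ne heq] at hkey ⊢
      exact hs.root_sound key hkey
  · intro ℓ t hne key
    rw [hmem _ (.inr (by have := ten_le_cV (sl ℓ t); omega)) ?_ (by simp)]
    · exact hs.flag ℓ t hne key
    · intro h
      rw [cV_inj, sl_inj] at h
      exact hne (by rw [h.1, h.2])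
  · intro a ha i
    rw [hag.rmem a (by simp; omega)]
    exact hs.rmem a ha i

/-- Linear time in `m` although the index ranges are quadratic: the zeros of the initial memory
already are the degree counters and the cleared validity flags. -/
theorem runs_indexEdges {b n m : ℕ} {E₁ E₂ : ℕ → ℕ} {ω : ℕ → ℕ → ℝ} (hb : n * n ≤ 2 ^ b)
    (hb' : n * (2 * m) ≤ 2 ^ b) (hb1 : 2 * m + 1 < 2 ^ b)
    (hE : ∀ i < 2 * m, E₁ i < n ∧ E₂ i < n) {s₀ : State} (h₀ : Oriented n m E₁ E₂ ω s₀) :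
    Runs b indexEdges s₀ ((2 * indexBody.maxCost + 30) * (m + 1))
      (fun s => Indexed n m E₁ E₂ ω (2 * m) s ∧ s.reg 4 = 2 * m) := by
  have hsub := writes_indexBody
  have hx : ∀ x, x ≠ 6 → x ≠ 8 → Loc.reg x ∉ indexBody.writes := fun x h6 h8 h => by
    have := hsub h
    simp [h6, h8] at this
  have hcV : ∀ g, 2 ≤ cV g := fun g => by have := ten_le_cV g; omega
  have hbase : Indexed n m E₁ E₂ ω 0 ((Program.assign 5 (.const 0)).run b s₀) := by
    refine ⟨h₀.reg_zero, h₀.reg_one, h₀.reg_two_mul, h₀.fst, h₀.snd, h₀.weight, by simp, by simp,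
      fun v => (h₀.mem 3 (by omega) v).trans (by simp [degUpTo]), by simp, by simp [degUpTo],
      by simp, fun key hkey => ?_, fun ℓ t _ key => h₀.mem _ (hcV _) key,
      fun a ha i => h₀.rmem a (by omega) i⟩
    have : s₀.mem (cV (sl 0 0)) key = 1 := hkey
    rw [h₀.mem _ (hcV _)] at this
    omega
  have hloop := Runs.forTo (b := b) (x := 5) (y := 16) (P := indexBody)
    (s₀ := (Program.assign 5 (.const 0)).run b s₀) (fun _ => indexBody.maxCost)
    (fun e s => Indexed n m E₁ E₂ ω e s) 0 (2 * m) (hx 5 (by omega) (by omega))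
    (hx 16 (by omega) (by omega)) (by omega) (by simp [Program.run, WordExp.eval])
    (by simp [Program.run, h₀.reg_two_mul]) (Nat.zero_le _) (by omega)
    (fun e s v h => ⟨h.1, h.2, h.3, h.4, h.5, h.6, h.7, h.8, h.9, h.10, h.11, h.12, h.13, h.14,
      h.15⟩) hbase
    (fun e _ he s _ h5 hs => loopFree_indexBody.runs (hs.step hb hb' hb1 he hE h5))
  refine (Program.LoopFree.runs_seq (P := .assign 5 (.const 0)) trivial
    (hloop.seq (T' := 2) fun s hs => Program.LoopFree.runs
      (P := .assign 4 (.reg 16)) trivial ?_)).mono ?_ fun _ h => h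
  · obtain ⟨-, h⟩ := hs
    refine ⟨⟨h.1, h.2, h.3, h.4, h.5, h.6, h.7, h.8, h.9, h.10, h.11, h.12, h.13, h.14,
      h.15⟩, ?_⟩
    simp [Program.run, WordExp.eval, h.reg_two_mul]
  · simp only [Program.maxCost, WordExp.cost, Finset.sum_const, Nat.card_Ico, smul_eq_mul,
      Nat.sub_zero]
    ring_nf
    omega

/-! ### The degree threshold -/

/-- The power of register `3` with exponent `j`. -/
def powExp : ℕ → WordExp
  | 0 => .const 1
  | j + 1 => .mul (powExp j) (.reg 3)

theorem eval_powExp (b j : ℕ) (s : State) : (powExp j).eval b s = s.reg 3 ^ j % 2 ^ b := by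
  induction j with
  | zero => rfl
  | succ j ih => rw [powExp, WordExp.eval, ih, WordExp.eval, Nat.mod_mul_mod, pow_succ]

/-- Sets register `3` to the least positive number whose `h`-th power is at least register `1`. -/
def threshold (h : ℕ) : Program :=
  .seq (.assign 3 (.const 1))
    (.loop (.lt (powExp h) (.reg 1)) (.assign 3 (.add (.reg 3) (.const 1))))

theorem exists_threshold {h m : ℕ} (hh : 1 ≤ h) (hm : 1 ≤ m) :
    ∃ Δ, 1 ≤ Δ ∧ Δ ≤ m ∧ m ≤ Δ ^ h ∧ ∀ j < Δ, j ^ h < m := by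
  classical
  have hex : ∃ j, m ≤ j ^ h := ⟨m, Nat.le_self_pow (by omega) _⟩
  refine ⟨Nat.find hex, Nat.one_le_iff_ne_zero.2 fun h0 => ?_,
    Nat.find_min' hex (Nat.le_self_pow (by omega) _), Nat.find_spec hex,
    fun j hj => not_le.1 (Nat.find_min hex hj)⟩
  have := Nat.find_spec hex
  rw [h0, zero_pow (by omega)] at this
  omega

/-- Linear search is affordable because `Δ ≤ m`. Every number tested is at most `m`, so `m ^ h < 2 ^
b` makes the computed powers exact. -/
theorem runs_threshold {b h m Δ : ℕ} (hΔ : 1 ≤ Δ) (hΔm : Δ ≤ m) (hle : m ≤ Δ ^ h)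
    (hmin : ∀ j < Δ, j ^ h < m) (hb : m ^ h < 2 ^ b)
    (hb1 : m + 1 < 2 ^ b) {s₀ : State} (h1 : s₀.reg 1 = m) :
    Runs b (threshold h) s₀ (((powExp h).cost + 20) * (m + 1)) (fun s => s.reg 3 = Δ) := by
  obtain ⟨N, rfl⟩ : ∃ N, Δ = N + 1 := ⟨Δ - 1, by omega⟩
  have hloop := Runs.loop (b := b) (p := .lt (powExp h) (.reg 1))
    (P := .assign 3 (.add (.reg 3) (.const 1)))
    (s₀ := (Program.assign 3 (.const 1)).run b s₀) N (fun _ => 4)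
    (fun j s => s.reg 3 = j + 1 ∧ s.reg 1 = m)
    ⟨by simp [Program.run, WordExp.eval, Nat.mod_eq_of_lt (by omega : 1 < 2 ^ b)],
      by simp [Program.run, h1]⟩ ?_ ?_
  · refine (Program.LoopFree.runs_seq (P := .assign 3 (.const 1)) trivial hloop).mono ?_ ?_
    · simp only [Program.maxCost, WordExp.cost, Test.cost, Finset.sum_const, Finset.card_range,
        smul_eq_mul]
      nlinarith
    · exact fun s h => h.1
  · rintro j hj s - ⟨h3, h1⟩
    have : (j + 1) ^ h < 2 ^ b := (Nat.pow_le_pow_left (by omega) h).trans_lt hb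
    simp only [Test.Holds, WordExp.eval, eval_powExp, h3, h1, Nat.mod_eq_of_lt this]
    constructor
    · intro hlt
      by_contra hc
      have : j = N := by omega
      subst this
      omega
    · exact fun h => hmin _ (by omega)
  · rintro j hj s - ⟨h3, h1⟩
    refine Program.LoopFree.runs (P := .assign 3 (.add (.reg 3) (.const 1))) trivial ⟨?_, ?_⟩
    · simp [Program.run, WordExp.eval, h3]
      rw [Nat.mod_eq_of_lt (by omega)]
    · simp [Program.run, h1]

/-! ### Building the list of triples -/

/-- Appends a triple to the list. -/
def append (eV eW eU : WordExp) : Program :=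
  .seq (.store 5 (.reg 4) eV) <| .seq (.store 6 (.reg 4) eW) <| .seq (.store 7 (.reg 4) eU)
    (.assign 4 (.add (.reg 4) (.const 1)))

/-- Appends triples, one for each value of register `14` below register `15`. -/
def appendAll (eV eW eU : WordExp) : Program :=
  .seq (.assign 14 (.const 0)) (.forTo 14 15 (append eV eW eU))

/-- What `appendAll` changes. -/
def appendLocs : Set Loc :=
  {l | l = .reg 4 ∨ l = .reg 14 ∨ l = .mem 5 ∨ l = .mem 6 ∨ l = .mem 7}

theorem writes_append (eV eW eU : WordExp) :
    (append eV eW eU).writes ⊆ appendLocs ∧ Loc.reg 14 ∉ (append eV eW eU).writes ∧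
      Loc.reg 15 ∉ (append eV eW eU).writes := by
  refine ⟨fun l hl => ?_, by simp [append, Program.writes], by simp [append, Program.writes]⟩
  simp only [append, Program.writes, Set.mem_union, Set.mem_singleton_iff] at hl
  rcases hl with h | h | h | h
  · exact .inr (.inr (.inl h))
  · exact .inr (.inr (.inr (.inl h)))
  · exact .inr (.inr (.inr (.inr h)))
  · exact .inl h

theorem writes_appendAll (eV eW eU : WordExp) : (appendAll eV eW eU).writes ⊆ appendLocs := by
  intro l hl
  simp only [appendAll, Program.forTo, Program.writes, Set.mem_union, Set.mem_singleton_iff] at hl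
  rcases hl with h | h | h
  · exact .inr (.inl h)
  · exact (writes_append _ _ _).1 h
  · exact .inr (.inl h)

/-- The list of triples in `s'` is an extension of the one in `s`. -/
structure Grow (s s' : State) : Prop where
  len : s.reg 4 ≤ s'.reg 4
  fst : ∀ i < s.reg 4, s'.mem 5 i = s.mem 5 i
  snd : ∀ i < s.reg 4, s'.mem 6 i = s.mem 6 i
  trd : ∀ i < s.reg 4, s'.mem 7 i = s.mem 7 i

theorem Grow.trans {s s' s'' : State} (h : Grow s s') (h' : Grow s' s'') : Grow s s'' :=
  ⟨h.len.trans h'.len, fun i hi => (h'.fst i (hi.trans_le h.len)).trans (h.fst i hi),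
    fun i hi => (h'.snd i (hi.trans_le h.len)).trans (h.snd i hi),
    fun i hi => (h'.trd i (hi.trans_le h.len)).trans (h.trd i hi)⟩

theorem Grow.trip {s s' : State} (h : Grow s s') {v w u : ℕ} (ht : Trip s v w u) :
    Trip s' v w u := by
  obtain ⟨i, hi, rfl, rfl, rfl⟩ := ht
  exact ⟨i, hi.trans_le h.len, h.fst i hi, h.snd i hi, h.trd i hi⟩

/-- The expressions are evaluated while the list is growing, so their values are required in every
state that differs from the start only in `appendLocs`. -/
theorem runs_appendAll {b d v : ℕ} {fw fu : ℕ → ℕ} {eV eW eU : WordExp} {s₀ : State}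
    (hd : s₀.reg 15 = d) (hb : s₀.reg 4 + d < 2 ^ b) (hb1 : 1 < 2 ^ b)
    (hV : ∀ j < d, ∀ s, Agree appendLocs s₀ s → s.reg 14 = j → eV.eval b s = v)
    (hW : ∀ j < d, ∀ s, Agree appendLocs s₀ s → s.reg 14 = j → eW.eval b s = fw j)
    (hU : ∀ j < d, ∀ s, Agree appendLocs s₀ s → s.reg 14 = j → eU.eval b s = fu j) :
    Runs b (appendAll eV eW eU) s₀ (((append eV eW eU).maxCost + 12) * (d + 1))
      (fun s => Agree appendLocs s₀ s ∧ Grow s₀ s ∧ s.reg 4 = s₀.reg 4 + d ∧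
        ∀ j < d, s.mem 5 (s₀.reg 4 + j) = v ∧ s.mem 6 (s₀.reg 4 + j) = fw j ∧
          s.mem 7 (s₀.reg 4 + j) = fu j) := by
  obtain ⟨hw, hw14, hw15⟩ := writes_append eV eW eU
  set s₁ := (Program.assign 14 (.const 0)).run b s₀ with hs₁
  have h4 : s₁.reg 4 = s₀.reg 4 := by simp [hs₁, Program.run]
  have h01 : Agree appendLocs s₀ s₁ := by
    refine ((show (Program.assign 14 (.const 0)).LoopFree from trivial).agree s₀).mono ?_
    rintro l rfl
    exact .inr (.inl rfl)
  have hlf : (append eV eW eU).LoopFree := ⟨trivial, trivial, trivial, trivial⟩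
  have hloop := Runs.forTo (b := b) (x := 14) (y := 15) (P := append eV eW eU) (s₀ := s₁)
    (fun _ => (append eV eW eU).maxCost)
    (fun j s => Agree appendLocs s₀ s ∧ Grow s₀ s ∧ s.reg 4 = s₀.reg 4 + j ∧
        ∀ i < j, s.mem 5 (s₀.reg 4 + i) = v ∧ s.mem 6 (s₀.reg 4 + i) = fw i ∧
          s.mem 7 (s₀.reg 4 + i) = fu i) 0 d hw14 hw15 (by omega)
    (by simp [hs₁, Program.run, WordExp.eval]) (by simp [hs₁, Program.run, hd]) (Nat.zero_le _)
    (by omega) (fun j s v h => ⟨h.1.trans ⟨fun x hx => ?_, fun _ _ => rfl, fun _ _ => rfl,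
        fun _ _ => rfl⟩, ⟨h.2.1.1, h.2.1.2, h.2.1.3, h.2.1.4⟩, h.2.2.1, h.2.2.2⟩)
    ⟨h01, ⟨h4.ge, fun _ _ => rfl, fun _ _ => rfl, fun _ _ => rfl⟩, h4, by simp⟩ ?_
  · refine (Program.LoopFree.runs_seq (P := .assign 14 (.const 0)) trivial hloop).mono ?_ ?_
    · simp only [Program.maxCost, WordExp.cost, Finset.sum_const, Nat.card_Ico, smul_eq_mul,
        Nat.sub_zero]
      ring_nf
      omega
    · rintro s ⟨-, h⟩
      exact h
  · have : x ≠ 14 := by rintro rfl; exact hx (.inr (.inl rfl))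
    simp [this]
  · rintro j - hj s - h14 ⟨hag, hg, hlen, hent⟩
    refine hlf.runs ?_
    -- Each store keeps the counter and stays within `appendLocs`, so the hypotheses on the
    -- expressions also apply between the stores.
    have hst : ∀ P : Program, P.LoopFree → P.writes ⊆ appendLocs \ {.reg 14} → ∀ s,
        Agree appendLocs s₀ s → s.reg 14 = j →
        Agree appendLocs s₀ (P.run b s) ∧ (P.run b s).reg 14 = j := by
      intro P hP hsub s hag h14
      have := hP.agree (b := b) s
      refine ⟨hag.trans (this.mono fun l hl => (hsub hl).1), ?_⟩
      rw [this.reg 14 fun h => (hsub h).2 rfl, h14]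
    set t₁ := (Program.store 5 (.reg 4) eV).run b s with ht₁
    obtain ⟨a1, j1⟩ := hst (.store 5 (.reg 4) eV) trivial
      (by rintro l rfl; simp [appendLocs]) s hag h14
    set t₂ := (Program.store 6 (.reg 4) eW).run b t₁ with ht₂
    obtain ⟨a2, j2⟩ := hst (.store 6 (.reg 4) eW) trivial
      (by rintro l rfl; simp [appendLocs]) t₁ a1 j1
    set t₃ := (Program.store 7 (.reg 4) eU).run b t₂ with ht₃
    have hrun : (append eV eW eU).run b s =
      (Program.assign 4 (.add (.reg 4) (.const 1))).run b t₃ := rfl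
    have l1 : t₁.reg 4 = s₀.reg 4 + j := hlen
    have l2 : t₂.reg 4 = s₀.reg 4 + j := hlen
    have l3 : t₃.reg 4 = s₀.reg 4 + j := hlen
    have m5 : ((append eV eW eU).run b s).mem 5 =
        Function.update (s.mem 5) (s₀.reg 4 + j) v := by
      simp [hrun, ht₃, ht₂, ht₁, Program.run, WordExp.eval, hlen, hV j hj s hag h14]
    have m6 : ((append eV eW eU).run b s).mem 6 =
        Function.update (s.mem 6) (s₀.reg 4 + j) (fw j) := by
      have := hW j hj t₁ a1 j1
      have e : (Program.store 6 (.reg 4) eW).run b t₁ = t₂ := rfl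
      rw [hrun]
      simp only [Program.run, ht₃]
      rw [Function.update_of_ne (by omega), ht₂]
      simp [Program.run, WordExp.eval, l1, this]
      simp [ht₁, Program.run]
    have m7 : ((append eV eW eU).run b s).mem 7 =
        Function.update (s.mem 7) (s₀.reg 4 + j) (fu j) := by
      have := hU j hj t₂ a2 j2
      rw [hrun]
      simp only [Program.run, ht₃]
      simp [WordExp.eval, l2, this]
      simp [ht₂, ht₁, Program.run]
    have m4 : ((append eV eW eU).run b s).reg 4 = s₀.reg 4 + (j + 1) := by
      rw [hrun]
      simp [Program.run, WordExp.eval, l3, Nat.mod_eq_of_lt hb1]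
      rw [Nat.mod_eq_of_lt (by omega), add_assoc]
    refine ⟨hag.trans ((hlf.agree s).mono hw), ⟨by omega, fun i hi => ?_, fun i hi => ?_,
      fun i hi => ?_⟩, m4, fun i hi => ?_⟩
    · rw [m5, Function.update_of_ne (by omega), hg.fst i hi]
    · rw [m6, Function.update_of_ne (by omega), hg.snd i hi]
    · rw [m7, Function.update_of_ne (by omega), hg.trd i hi]
    · rw [m5, m6, m7]
      rcases Nat.lt_succ_iff_lt_or_eq.1 hi with h | rfl
      · have : s₀.reg 4 + i ≠ s₀.reg 4 + j := by omega
        simpa only [Function.update_of_ne this] using hent i h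
      · simp

/-- What the construction of the list changes. -/
def growLocs : Set Loc :=
  {l | (∃ x, 4 ≤ x ∧ x < 16 ∧ l = .reg x) ∨ l = .mem 5 ∨ l = .mem 6 ∨ l = .mem 7}

theorem appendLocs_subset_growLocs : appendLocs ⊆ growLocs := by
  rintro l (h | h | h | h | h)
  · exact .inl ⟨4, by omega, by omega, h⟩
  · exact .inl ⟨14, by omega, by omega, h⟩
  · exact .inr (.inl h)
  · exact .inr (.inr (.inl h))
  · exact .inr (.inr (.inr h))

/-- The data used for the construction of the list: the directed edges `E₁`, `E₂` and for each
vertex its degree and its neighbours. -/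
structure Ready (n m Δ : ℕ) (E₁ E₂ : ℕ → ℕ) (s : State) : Prop where
  reg_zero : s.reg 0 = n
  reg_two_mul : s.reg 16 = 2 * m
  reg_three : s.reg 3 = Δ
  fst : ∀ i < 2 * m, s.mem 0 i = E₁ i
  snd : ∀ i < 2 * m, s.mem 1 i = E₂ i
  deg : ∀ v, s.mem 3 v = degUpTo E₁ (2 * m) v
  adj : ∀ i < 2 * m, ∃ j < degUpTo E₁ (2 * m) (E₁ i), s.mem 4 (E₁ i * (2 * m) + j) = E₂ i
  adj_sound : ∀ v < n, ∀ j < degUpTo E₁ (2 * m) v,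
    ∃ i < 2 * m, E₁ i = v ∧ s.mem 4 (v * (2 * m) + j) = E₂ i

theorem Agree.grow_reg {s s' : State} (h : Agree growLocs s s') {x : ℕ} (hx : x < 4 ∨ 16 ≤ x) :
    s'.reg x = s.reg x := by
  refine h.reg x ?_
  simp [growLocs]
  omega

theorem Agree.grow_mem {s s' : State} (h : Agree growLocs s s') {a : ℕ} (h5 : a ≠ 5)
    (h6 : a ≠ 6) (h7 : a ≠ 7) : s'.mem a = s.mem a :=
  h.mem a (by simp [growLocs, h5, h6, h7])

theorem Agree.ready {n m Δ : ℕ} {E₁ E₂ : ℕ → ℕ} {s s' : State} (h : Agree growLocs s s')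
    (hs : Ready n m Δ E₁ E₂ s) : Ready n m Δ E₁ E₂ s' := by
  have h4 := h.grow_mem (show 4 ≠ 5 by omega) (by omega) (by omega)
  refine ⟨?_, ?_, ?_, ?_, ?_, ?_, ?_, ?_⟩
  · rw [h.grow_reg (by omega), hs.reg_zero]
  · rw [h.grow_reg (by omega), hs.reg_two_mul]
  · rw [h.grow_reg (by omega), hs.reg_three]
  · rw [h.grow_mem (by omega) (by omega) (by omega)]; exact hs.fst
  · rw [h.grow_mem (by omega) (by omega) (by omega)]; exact hs.snd
  · rw [h.grow_mem (by omega) (by omega) (by omega)]; exact hs.deg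
  · rw [h4]; exact hs.adj
  · rw [h4]; exact hs.adj_sound

/-- All triples of the list consist of a vertex and an edge. -/
def ListValid (n m : ℕ) (E₁ E₂ : ℕ → ℕ) (s : State) : Prop :=
  ∀ i < s.reg 4, s.mem 5 i < n ∧ ∃ e < 2 * m, s.mem 6 i = E₁ e ∧ s.mem 7 i = E₂ e

theorem Grow.listValid {n m L d : ℕ} {E₁ E₂ : ℕ → ℕ} {s s' : State} (h : Grow s s')
    (hs : ListValid n m E₁ E₂ s) (hL : s.reg 4 = L) (hL' : s'.reg 4 = L + d)
    (hnew : ∀ j < d, s'.mem 5 (L + j) < n ∧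
      ∃ e < 2 * m, s'.mem 6 (L + j) = E₁ e ∧ s'.mem 7 (L + j) = E₂ e) :
    ListValid n m E₁ E₂ s' := by
  intro i hi
  by_cases hiL : i < s.reg 4
  · rw [h.fst i hiL, h.snd i hiL, h.trd i hiL]
    exact hs i hiL
  · have := hnew (i - L) (by omega)
    rwa [Nat.add_sub_cancel' (by omega)] at this

/-! ### Walks with light inner vertices -/

/-- Extends the triple `(v, w, u)` at the index in register `5` to the triples `(v, u, y)` if the
degree of `u` is at most the threshold. -/
def lightBody : Program :=
  .seq (.seq (.assign 6 (.get 5 (.reg 5))) <| .seq (.assign 8 (.get 7 (.reg 5))) <|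
    .seq (.assign 15 (.get 3 (.reg 8)))
      (.ite (.lt (.reg 3) (.reg 15)) (.assign 15 (.const 0)) .skip))
    (appendAll (.reg 6) (.reg 8) (.get 4 (.add (.mul (.reg 8) (.reg 16)) (.reg 14))))

/-- Extends all triples with indices from register `12` to register `13`. -/
def lightStep : Program :=
  .seq (.assign 5 (.reg 12)) <| .seq (.forTo 5 13 lightBody) <|
    .seq (.assign 12 (.reg 13)) (.assign 13 (.reg 4))

/-- Bound for the number of steps of `lightBody` per new triple. -/
def lightCost : ℕ :=
  (Program.seq (.assign 6 (.get 5 (.reg 5))) <| .seq (.assign 8 (.get 7 (.reg 5))) <|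
    .seq (.assign 15 (.get 3 (.reg 8)))
      (.ite (.lt (.reg 3) (.reg 15)) (.assign 15 (.const 0)) .skip)).maxCost +
  (append (.reg 6) (.reg 8) (.get 4 (.add (.mul (.reg 8) (.reg 16)) (.reg 14)))).maxCost + 12

/-- What `lightBody` changes. -/
def lightLocs : Set Loc := appendLocs ∪ {.reg 6, .reg 8, .reg 15}

theorem lightLocs_subset : lightLocs ⊆ growLocs := by
  rintro l (h | h | h | h)
  · exact appendLocs_subset_growLocs h
  · exact .inl ⟨6, by omega, by omega, h⟩
  · exact .inl ⟨8, by omega, by omega, h⟩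
  · exact .inl ⟨15, by omega, by omega, h⟩

theorem writes_lightBody : lightBody.writes ⊆ lightLocs := by
  intro l hl
  simp only [lightBody, Program.writes, Set.mem_union, Set.mem_singleton_iff,
    Set.mem_empty_iff_false, or_false] at hl
  simp only [lightLocs, Set.mem_union, Set.mem_insert_iff, Set.mem_singleton_iff]
  rcases hl with (h | h | h | h) | h
  · exact .inr (.inl h)
  · exact .inr (.inr (.inl h))
  · exact .inr (.inr (.inr h))
  · exact .inr (.inr (.inr h))
  · exact .inl (writes_appendAll _ _ _ h)

/-- A heavy `u` is given the count `d = 0`, a light one its degree, so at most `Δ` triples are added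
in either case. -/
theorem runs_lightBody {b n m Δ i : ℕ} {E₁ E₂ : ℕ → ℕ} (hb' : n * (2 * m) ≤ 2 ^ b)
    (hb1 : 1 < 2 ^ b) (hE : ∀ i < 2 * m, E₁ i < n ∧ E₂ i < n) {s : State}
    (hs : Ready n m Δ E₁ E₂ s) (hv : ListValid n m E₁ E₂ s) (h5 : s.reg 5 = i)
    (hi : i < s.reg 4) (hb : s.reg 4 + Δ < 2 ^ b) :
    Runs b lightBody s (lightCost * (Δ + 1))
      (fun s' => Grow s s' ∧ ListValid n m E₁ E₂ s' ∧ s'.reg 4 ≤ s.reg 4 + Δ ∧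
        (degUpTo E₁ (2 * m) (s.mem 7 i) ≤ Δ → ∀ e < 2 * m, E₁ e = s.mem 7 i →
          ∃ j, s.reg 4 ≤ j ∧ j < s'.reg 4 ∧ s'.mem 5 j = s.mem 5 i ∧ s'.mem 6 j = s.mem 7 i ∧
            s'.mem 7 j = E₂ e)) := by
  set P : Program := .seq (.assign 6 (.get 5 (.reg 5))) <| .seq (.assign 8 (.get 7 (.reg 5))) <|
    .seq (.assign 15 (.get 3 (.reg 8)))
      (.ite (.lt (.reg 3) (.reg 15)) (.assign 15 (.const 0)) .skip) with hP
  have hlf : P.LoopFree := ⟨trivial, trivial, trivial, trivial, trivial⟩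
  set s₁ := P.run b s with hs₁
  obtain ⟨hvn, e₀, he₀, hw₀, hu₀⟩ := hv i hi
  set v := s.mem 5 i
  set u := s.mem 7 i
  have hun : u < n := by rw [hu₀]; exact (hE e₀ he₀).2
  set d := if Δ < degUpTo E₁ (2 * m) u then 0 else degUpTo E₁ (2 * m) u with hd
  have hdΔ : d ≤ Δ := by rw [hd]; split_ifs <;> omega
  have hdd : d ≤ degUpTo E₁ (2 * m) u := by rw [hd]; split_ifs <;> omega
  have hdm : d ≤ 2 * m := hdd.trans (degUpTo_le _ _ _)
  have hag : Agree {.reg 6, .reg 8, .reg 15} s s₁ := by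
    refine (hlf.agree s).mono ?_
    intro l hl
    simp only [hP, Program.writes, Set.mem_union, Set.mem_singleton_iff,
      Set.mem_empty_iff_false, or_false] at hl
    simp only [Set.mem_insert_iff, Set.mem_singleton_iff]
    tauto
  have hreg : ∀ x, x ≠ 6 → x ≠ 8 → x ≠ 15 → s₁.reg x = s.reg x := by
    intro x h1 h2 h3
    exact hag.reg x (by simp [h1, h2, h3])
  have hmem : s₁.mem = s.mem := funext fun a => hag.mem a (by simp)
  have r4 : s₁.reg 4 = s.reg 4 := hreg 4 (by omega) (by omega) (by omega)
  set t : State := (Program.seq (.assign 6 (.get 5 (.reg 5))) <|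
    .seq (.assign 8 (.get 7 (.reg 5))) (.assign 15 (.get 3 (.reg 8)))).run b s with ht
  have t6 : t.reg 6 = v := by simp [ht, Program.run, WordExp.eval, h5, v]
  have t8 : t.reg 8 = u := by simp [ht, Program.run, WordExp.eval, h5, u]
  have t15 : t.reg 15 = degUpTo E₁ (2 * m) u := by
    simp [ht, Program.run, WordExp.eval, h5, u, hs.deg]
  have t3 : t.reg 3 = Δ := by simp [ht, Program.run, hs.reg_three]
  have hs1 : s₁ = (Program.ite (.lt (.reg 3) (.reg 15)) (.assign 15 (.const 0)) .skip).run b t :=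
    rfl
  have hcond : (Test.lt (.reg 3) (.reg 15)).Holds b t ↔ Δ < degUpTo E₁ (2 * m) u := by
    simp [Test.Holds, WordExp.eval, t3, t15]
  have hregs : s₁.reg 6 = v ∧ s₁.reg 8 = u ∧ s₁.reg 15 = d := by
    rw [hs1, Program.run, hd]
    by_cases hc : Δ < degUpTo E₁ (2 * m) u
    · rw [if_pos (hcond.2 hc), if_pos hc]
      simp [Program.run, WordExp.eval, t6, t8]
    · rw [if_neg (fun h => hc (hcond.1 h)), if_neg hc]
      exact ⟨t6, t8, t15⟩
  obtain ⟨r6, r8, r15⟩ := hregs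
  have hrun := runs_appendAll (b := b) (d := d) (v := v) (fw := fun _ => u)
    (fu := fun j => s.mem 4 (u * (2 * m) + j)) (eV := .reg 6) (eW := .reg 8)
    (eU := .get 4 (.add (.mul (.reg 8) (.reg 16)) (.reg 14))) (s₀ := s₁) r15
    (by omega) hb1
    (fun j _ s' h' _ => by
      rw [WordExp.eval, h'.reg 6 (by simp [appendLocs]), r6])
    (fun j _ s' h' _ => by
      rw [WordExp.eval, h'.reg 8 (by simp [appendLocs]), r8])
    (fun j hj s' h' h14 => by
      have e1 : (u * (2 * m) % 2 ^ b + j) % 2 ^ b = u * (2 * m) + j := by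
        have := add_mul_lt hun (show j < 2 * m by omega)
        rw [Nat.mod_eq_of_lt (by omega : u * (2 * m) < 2 ^ b), Nat.mod_eq_of_lt (by omega)]
      simp only [WordExp.eval]
      rw [h'.reg 8 (by simp [appendLocs]), r8, h'.reg 16 (by simp [appendLocs]),
        hreg 16 (by omega) (by omega) (by omega), hs.reg_two_mul, h14, e1,
        h'.mem 4 (by simp [appendLocs]), hmem])
  refine (hlf.runs_seq hrun).mono ?_ ?_
  · rw [lightCost]
    nlinarith
  · rintro s' ⟨hag', hg, h4, hent⟩
    have hgs : Grow s s' := by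
      refine Grow.trans ⟨r4.ge, fun _ _ => ?_, fun _ _ => ?_, fun _ _ => ?_⟩ hg <;> rw [hmem]
    rw [r4] at h4 hent
    refine ⟨hgs, hgs.listValid hv rfl h4 fun j hj => ?_, by omega, fun hdeg e he heu => ?_⟩
    · obtain ⟨g1, g2, g3⟩ := hent j hj
      obtain ⟨e, he, h1, h2⟩ := hs.adj_sound u hun j (by omega)
      rw [g1, g2, g3]
      exact ⟨hvn, e, he, h1.symm, h2⟩
    · obtain ⟨j, hj, hadj⟩ := hs.adj e he
      rw [heu] at hj hadj
      have hdeq : d = degUpTo E₁ (2 * m) u := by rw [hd, if_neg (by omega)]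
      obtain ⟨g1, g2, g3⟩ := hent j (by omega)
      exact ⟨s.reg 4 + j, by omega, by omega, g1, g2, g3.trans hadj⟩

/-- Adjacency in the graph with the directed edges `E₁`, `E₂`. -/
def EAdj (m : ℕ) (E₁ E₂ : ℕ → ℕ) (x y : ℕ) : Prop := ∃ e < 2 * m, E₁ e = x ∧ E₂ e = y

theorem agree_assign {b x : ℕ} {e : WordExp} {W : Set Loc} (hx : Loc.reg x ∈ W) (s : State) :
    Agree W s ((Program.assign x e).run b s) :=
  ((show (Program.assign x e).LoopFree from trivial).agree s).mono (by rintro l rfl; exact hx)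

theorem reg_mem_growLocs {x : ℕ} (h : 4 ≤ x) (h' : x < 16) : Loc.reg x ∈ growLocs :=
  .inl ⟨x, h, h', rfl⟩

/-- The end of the old level is frozen in register 13 while the list grows, so triples appended in
this pass are not extended in it. -/
theorem runs_lightStep {b n m Δ lo hi : ℕ} {E₁ E₂ : ℕ → ℕ} (hb' : n * (2 * m) ≤ 2 ^ b)
    (hb1 : 1 < 2 ^ b) (hE : ∀ i < 2 * m, E₁ i < n ∧ E₂ i < n) {s₀ : State}
    (hs : Ready n m Δ E₁ E₂ s₀) (hv : ListValid n m E₁ E₂ s₀) (h12 : s₀.reg 12 = lo)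
    (h13 : s₀.reg 13 = hi) (h4 : s₀.reg 4 = hi) (hlo : lo ≤ hi)
    (hb : hi + (hi - lo) * Δ < 2 ^ b) :
    Runs b lightStep s₀ ((hi - lo) * (lightCost * (Δ + 1) + 7) + 20)
      (fun s => Agree growLocs s₀ s ∧ Grow s₀ s ∧ ListValid n m E₁ E₂ s ∧ s.reg 12 = hi ∧
        s.reg 13 = s.reg 4 ∧ s.reg 4 ≤ hi + (hi - lo) * Δ ∧
        ∀ i, lo ≤ i → i < hi → degUpTo E₁ (2 * m) (s₀.mem 7 i) ≤ Δ →
          ∀ e < 2 * m, E₁ e = s₀.mem 7 i → ∃ j, hi ≤ j ∧ j < s.reg 4 ∧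
            s.mem 5 j = s₀.mem 5 i ∧ s.mem 6 j = s₀.mem 7 i ∧ s.mem 7 j = E₂ e) := by
  have hnot : ∀ x, x ≠ 4 → x ≠ 14 → x ≠ 6 → x ≠ 8 → x ≠ 15 →
      Loc.reg x ∉ lightBody.writes := by
    intro x h1 h2 h3 h4 h5 h
    have := writes_lightBody h
    simp [lightLocs, appendLocs, h1, h2, h3, h4, h5] at this
  set s₁ := (Program.assign 5 (.reg 12)).run b s₀ with hs₁
  have h01 : Agree growLocs s₀ s₁ := agree_assign (reg_mem_growLocs (by omega) (by omega)) s₀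
  have r4 : s₁.reg 4 = hi := by simp [hs₁, Program.run, h4]
  have hloop := Runs.forTo (b := b) (x := 5) (y := 13) (P := lightBody) (s₀ := s₁)
    (fun _ => lightCost * (Δ + 1))
    (fun i s => Agree growLocs s₀ s ∧ Grow s₀ s ∧ ListValid n m E₁ E₂ s ∧
      s.reg 4 ≤ hi + (i - lo) * Δ ∧
      ∀ i', lo ≤ i' → i' < i → degUpTo E₁ (2 * m) (s₀.mem 7 i') ≤ Δ →
          ∀ e < 2 * m, E₁ e = s₀.mem 7 i' → ∃ j, hi ≤ j ∧ j < s.reg 4 ∧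
            s.mem 5 j = s₀.mem 5 i' ∧ s.mem 6 j = s₀.mem 7 i' ∧ s.mem 7 j = E₂ e) lo hi
    (hnot 5 (by omega) (by omega) (by omega) (by omega) (by omega))
    (hnot 13 (by omega) (by omega) (by omega) (by omega) (by omega)) (by omega)
    (by simp [hs₁, Program.run, WordExp.eval, h12]) (by simp [hs₁, Program.run, h13]) hlo
    (lt_of_le_of_lt (Nat.le_add_right _ _) hb)
    (fun i s v h => ⟨h.1.trans ⟨fun x hx => ?_, fun _ _ => rfl, fun _ _ => rfl,
        fun _ _ => rfl⟩, ⟨h.2.1.1, h.2.1.2, h.2.1.3, h.2.1.4⟩, h.2.2.1, h.2.2.2⟩)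
    ⟨h01, ⟨by omega, fun _ _ => rfl, fun _ _ => rfl, fun _ _ => rfl⟩, hv, by omega,
      fun i' h h' => by omega⟩ ?_
  · refine (Program.LoopFree.runs_seq (P := .assign 5 (.reg 12)) trivial (hloop.frame.seq
      (T' := 4) fun s hs => Program.LoopFree.runs
      (P := .seq (.assign 12 (.reg 13)) (.assign 13 (.reg 4))) ⟨trivial, trivial⟩ ?_)).mono ?_
      fun _ h => h
    · obtain ⟨hag, -, h1, h2, h3, h4, h5⟩ := hs
      have r13 : s.reg 13 = hi := by
        rw [hag.reg 13, hs₁]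
        · simp [Program.run, h13]
        · intro h
          rcases h with h | h
          · exact hnot 13 (by omega) (by omega) (by omega) (by omega) (by omega) h
          · simp [Program.writes] at h
      refine ⟨(h1.trans (agree_assign (reg_mem_growLocs (by omega) (by omega)) _)).trans
        (agree_assign (reg_mem_growLocs (by omega) (by omega)) _),
        ⟨h2.1, h2.2, h2.3, h2.4⟩, h3, ?_, ?_, h4, h5⟩
      · simp [Program.run, WordExp.eval, r13]
      · simp [Program.run, WordExp.eval]
    · simp only [Program.maxCost, WordExp.cost, Finset.sum_const, Nat.card_Ico, smul_eq_mul]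
      omega
  · have : x ≠ 5 := by rintro rfl; exact hx (reg_mem_growLocs (by omega) (by omega))
    simp [this]
  · rintro i hli hih s - h5 ⟨hag, hg, hval, hlen, hcov⟩
    have hle : (i + 1 - lo) * Δ ≤ (hi - lo) * Δ := Nat.mul_le_mul_right _ (by omega)
    have hsucc : (i + 1 - lo) * Δ = (i - lo) * Δ + Δ := by
      rw [Nat.sub_add_comm hli, Nat.succ_mul]
    have hi4 : i < s.reg 4 := by have := hg.len; omega
    refine (runs_lightBody hb' hb1 hE (hag.ready hs) hval h5 hi4 (by omega)).frame.mono le_rfl ?_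
    rintro s' ⟨hag', hg', hval', hlen', hnew⟩
    rw [hg.fst i (by omega), hg.trd i (by omega)] at hnew
    refine ⟨hag.trans (hag'.mono (writes_lightBody.trans lightLocs_subset)), hg.trans hg', hval',
      by omega, fun i' hli' hi' hdeg e he heq => ?_⟩
    rcases Nat.lt_succ_iff_lt_or_eq.1 hi' with h | rfl
    · obtain ⟨j, hj, hj', g1, g2, g3⟩ := hcov i' hli' h hdeg e he heq
      exact ⟨j, hj, hj'.trans_le hg'.len, (hg'.fst j hj').trans g1, (hg'.snd j hj').trans g2,
        (hg'.trd j hj').trans g3⟩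
    · obtain ⟨j, hj, hj', g1, g2, g3⟩ := hnew hdeg e he heq
      have := hg.len
      exact ⟨j, by omega, hj', g1, g2, g3⟩

/-- The list contains all walks with at most `ℓ` light inner vertices; the last level lies
between the registers `12` and `13`. -/
structure LightInv (n m Δ : ℕ) (E₁ E₂ : ℕ → ℕ) (ℓ : ℕ) (s : State) : Prop where
  valid : ListValid n m E₁ E₂ s
  reg_hi : s.reg 13 = s.reg 4
  reg_lo : s.reg 12 ≤ s.reg 4
  width : s.reg 4 - s.reg 12 ≤ 2 * m * Δ ^ ℓ
  len : s.reg 4 ≤ 2 * m * (ℓ + 1) * Δ ^ ℓ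
  last : ∀ x : ℕ → ℕ, (∀ i ≤ ℓ, EAdj m E₁ E₂ (x i) (x (i + 1))) →
    (∀ i ≤ ℓ, 1 ≤ i → degUpTo E₁ (2 * m) (x i) ≤ Δ) → ∃ i, s.reg 12 ≤ i ∧ i < s.reg 4 ∧
      s.mem 5 i = x 0 ∧ s.mem 6 i = x ℓ ∧ s.mem 7 i = x (ℓ + 1)
  trip : ∀ ℓ' ≤ ℓ, ∀ x : ℕ → ℕ, (∀ i ≤ ℓ', EAdj m E₁ E₂ (x i) (x (i + 1))) →
    (∀ i ≤ ℓ', 1 ≤ i → degUpTo E₁ (2 * m) (x i) ≤ Δ) → Trip s (x 0) (x ℓ') (x (ℓ' + 1))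

/-- Lists the walks with up to `h` light inner vertices. -/
def lightSteps (h : ℕ) : Program :=
  .seq (.seq (.assign 12 (.const 0)) (.assign 13 (.reg 4))) (.seqN (fun _ => lightStep) h)

/-- Each pass multiplies the width of the last level by at most `Δ`, starting from `2 * m`. The
total length is bounded crudely by the number of levels times the bound for the widest. Repeated
triples are harmless and are not removed. -/
theorem runs_lightSteps {b n m Δ h : ℕ} {E₁ E₂ : ℕ → ℕ} (hb' : n * (2 * m) ≤ 2 ^ b)
    (hb1 : 1 < 2 ^ b) (hE : ∀ i < 2 * m, E₁ i < n ∧ E₂ i < n) (hm : 1 ≤ m) (hΔ : 1 ≤ Δ)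
    (hb : 2 * m * (h + 1) * Δ ^ h < 2 ^ b) {s₀ : State}
    (hs : Ready n m Δ E₁ E₂ s₀) (h4 : s₀.reg 4 = 2 * m)
    (hlist : ∀ i < 2 * m, s₀.mem 5 i = E₁ i ∧ s₀.mem 6 i = E₁ i ∧ s₀.mem 7 i = E₂ i) :
    Runs b (lightSteps h) s₀ ((h * (4 * (lightCost + 7) + 20) + 5) * (m * Δ ^ h))
      (fun s => Agree growLocs s₀ s ∧ LightInv n m Δ E₁ E₂ h s) := by
  have hX : 1 ≤ m * Δ ^ h := Nat.mul_pos hm (Nat.pow_pos hΔ)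
  have hpow : ∀ {i j}, i ≤ j → Δ ^ i ≤ Δ ^ j := fun hij => Nat.pow_le_pow_right hΔ hij
  set s₁ := (Program.seq (.assign 12 (.const 0)) (.assign 13 (.reg 4))).run b s₀ with hs₁
  have r12 : s₁.reg 12 = 0 := by simp [hs₁, Program.run, WordExp.eval]
  have r13 : s₁.reg 13 = 2 * m := by simp [hs₁, Program.run, WordExp.eval, h4]
  have r4 : s₁.reg 4 = 2 * m := by simp [hs₁, Program.run, h4]
  have h01 : Agree growLocs s₀ s₁ :=
    (agree_assign (reg_mem_growLocs (by omega) (by omega)) s₀).trans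
      (agree_assign (reg_mem_growLocs (by omega) (by omega)) _)
  have hm1 : s₁.mem = s₀.mem := rfl
  -- At level 0 the start of the walk is also the tail of its only edge, so the edge table itself
  -- serves as the list.
  have hbase : ∀ x : ℕ → ℕ, EAdj m E₁ E₂ (x 0) (x 1) → ∃ i, s₁.reg 12 ≤ i ∧ i < s₁.reg 4 ∧
      s₁.mem 5 i = x 0 ∧ s₁.mem 6 i = x 0 ∧ s₁.mem 7 i = x 1 := by
    rintro x ⟨e, he, h1, h2⟩
    obtain ⟨g1, g2, g3⟩ := hlist e he
    exact ⟨e, by omega, by omega, by rw [hm1, g1, h1], by rw [hm1, g2, h1], by rw [hm1, g3, h2]⟩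
  have hrun := Runs.seqN (b := b) (f := fun _ => lightStep) (N := h)
    (fun ℓ s => Agree growLocs s₀ s ∧ LightInv n m Δ E₁ E₂ ℓ s)
    ((4 * (lightCost + 7) + 20) * (m * Δ ^ h)) (s₀ := s₁) ⟨h01, ?_⟩ ?_
  · refine (Program.LoopFree.runs_seq
      (P := .seq (.assign 12 (.const 0)) (.assign 13 (.reg 4))) ⟨trivial, trivial⟩ hrun).mono ?_
      fun _ h => h
    simp only [Program.maxCost, WordExp.cost]
    nlinarith
  · refine ⟨?_, by rw [r13, r4], by omega, by rw [r4]; simp, by rw [r4]; simp, ?_, ?_⟩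
    · intro i hi
      rw [r4] at hi
      obtain ⟨g1, g2, g3⟩ := hlist i hi
      rw [hm1, g1, g2, g3]
      exact ⟨(hE i hi).1, i, hi, rfl, rfl⟩
    · intro x hx _
      exact hbase x (hx 0 le_rfl)
    · intro ℓ' hℓ' x hx _
      obtain rfl : ℓ' = 0 := by omega
      obtain ⟨i, -, hi, g⟩ := hbase x (hx 0 le_rfl)
      exact ⟨i, hi, g⟩
  · rintro ℓ hℓ s ⟨hag, hI⟩
    have hw : (s.reg 4 - s.reg 12) * Δ ≤ 2 * m * Δ ^ (ℓ + 1) := by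
      rw [pow_succ, ← mul_assoc]
      exact Nat.mul_le_mul_right _ hI.width
    have hlen : s.reg 4 + (s.reg 4 - s.reg 12) * Δ ≤ 2 * m * (ℓ + 1 + 1) * Δ ^ (ℓ + 1) := by
      have := hI.len
      have h2 : 2 * m * (ℓ + 1) * Δ ^ ℓ ≤ 2 * m * (ℓ + 1) * Δ ^ (ℓ + 1) :=
        Nat.mul_le_mul_left _ (hpow (Nat.le_succ ℓ))
      nlinarith
    have hlen' : 2 * m * (ℓ + 1 + 1) * Δ ^ (ℓ + 1) ≤ 2 * m * (h + 1) * Δ ^ h :=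
      Nat.mul_le_mul (Nat.mul_le_mul_left _ (by omega)) (hpow hℓ)
    refine (runs_lightStep (b := b) hb' hb1 hE (hag.ready hs) hI.valid rfl hI.reg_hi rfl hI.reg_lo
      (by omega)).mono ?_ ?_
    · have h1 : lightCost * (Δ + 1) + 7 ≤ 2 * (lightCost + 7) * Δ := by nlinarith
      have h2 : (s.reg 4 - s.reg 12) * (lightCost * (Δ + 1) + 7) ≤
          2 * (lightCost + 7) * ((s.reg 4 - s.reg 12) * Δ) := by
        calc _ ≤ (s.reg 4 - s.reg 12) * (2 * (lightCost + 7) * Δ) := Nat.mul_le_mul_left _ h1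
          _ = _ := by ring
      have h3 : 2 * m * Δ ^ (ℓ + 1) ≤ 2 * (m * Δ ^ h) := by
        rw [mul_assoc]
        exact Nat.mul_le_mul_left _ (Nat.mul_le_mul_left _ (hpow hℓ))
      have h4 : 2 * (lightCost + 7) * ((s.reg 4 - s.reg 12) * Δ) ≤
          2 * (lightCost + 7) * (2 * (m * Δ ^ h)) := Nat.mul_le_mul_left _ (hw.trans h3)
      nlinarith
    · rintro s' ⟨hag', hg, hval, r12', r13', hlen'', hnew⟩
      have hlast : ∀ x : ℕ → ℕ, (∀ i ≤ ℓ + 1, EAdj m E₁ E₂ (x i) (x (i + 1))) →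
          (∀ i ≤ ℓ + 1, 1 ≤ i → degUpTo E₁ (2 * m) (x i) ≤ Δ) → ∃ i, s'.reg 12 ≤ i ∧
          i < s'.reg 4 ∧ s'.mem 5 i = x 0 ∧ s'.mem 6 i = x (ℓ + 1) ∧
            s'.mem 7 i = x (ℓ + 1 + 1) := by
        intro x hx hdeg
        obtain ⟨i, hlo, hhi, g1, g2, g3⟩ := hI.last x (fun i hi => hx i (by omega))
          (fun i hi => hdeg i (by omega))
        obtain ⟨e, he, e1, e2⟩ := hx (ℓ + 1) le_rfl
        obtain ⟨j, hj, hj', k1, k2, k3⟩ := hnew i hlo hhi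
          (by rw [g3]; exact hdeg _ le_rfl (by omega)) e he (by rw [e1, g3])
        exact ⟨j, by omega, hj', by rw [k1, g1], by rw [k2, g3], by rw [k3, e2]⟩
      refine ⟨hag.trans hag', hval, r13', by have := hg.len; omega, by rw [r12']; omega,
        hlen''.trans hlen, hlast, fun ℓ' hℓ' x hx hdeg => ?_⟩
      rcases Nat.le_succ_iff.1 hℓ' with h | rfl
      · exact hg.trip (hI.trip ℓ' h x hx hdeg)
      · obtain ⟨i, -, hi, g⟩ := hlast x hx hdeg
        exact ⟨i, hi, g⟩

/-! ### Heavy vertices -/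

/-- Number of vertices below `v` whose degree exceeds the threshold. -/
def heavyCount (m Δ : ℕ) (E₁ : ℕ → ℕ) (v : ℕ) : ℕ :=
  ((Finset.range v).filter fun i => Δ < degUpTo E₁ (2 * m) i).card

theorem heavyCount_succ (m Δ : ℕ) (E₁ : ℕ → ℕ) (v : ℕ) : heavyCount m Δ E₁ (v + 1) =
    heavyCount m Δ E₁ v + if Δ < degUpTo E₁ (2 * m) v then 1 else 0 := by
  rw [heavyCount, heavyCount, Finset.range_add_one, Finset.filter_insert]
  split_ifs with h
  · rw [Finset.card_insert_of_notMem (by simp)]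
  · rfl

theorem heavyCount_le (m Δ : ℕ) (E₁ : ℕ → ℕ) (v : ℕ) : heavyCount m Δ E₁ v ≤ v :=
  (Finset.card_filter_le _ _).trans (by simp)

/-- The degrees sum to `2 * m`, and every heavy vertex contributes at least `Δ`. -/
theorem heavyCount_mul_le {n m Δ : ℕ} {E₁ : ℕ → ℕ} (hE : ∀ i < 2 * m, E₁ i < n) :
    heavyCount m Δ E₁ n * Δ ≤ 2 * m := by
  have h1 : (Finset.range (2 * m)).card =
      ∑ v ∈ Finset.range n, degUpTo E₁ (2 * m) v :=
    Finset.card_eq_sum_card_fiberwise fun i hi => by simpa using hE i (by simpa using hi)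
  rw [Finset.card_range] at h1
  rw [h1, heavyCount, ← smul_eq_mul, ← Finset.sum_const]
  calc _ ≤ ∑ v ∈ (Finset.range n).filter fun i => Δ < degUpTo E₁ (2 * m) i,
        degUpTo E₁ (2 * m) v :=
        Finset.sum_le_sum fun v hv => (Finset.mem_filter.1 hv).2.le
    _ ≤ _ := Finset.sum_le_sum_of_subset (Finset.filter_subset _ _)

/-- Sets register `15` to the number of directed edges if the vertex in register `6` is heavy,
and to `0` otherwise. -/
def heavyTest : Program :=
  .seq (.assign 15 (.const 0)) (.ite (.lt (.reg 3) (.get 3 (.reg 6))) (.assign 15 (.reg 16)) .skip)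

/-- Lists the vertex in register `6` together with all directed edges if it is heavy. -/
def heavyBody : Program :=
  .seq heavyTest (appendAll (.reg 6) (.get 0 (.reg 14)) (.get 1 (.reg 14)))

/-- Lists all heavy vertices together with all directed edges. -/
def heavySteps : Program := .seq (.assign 6 (.const 0)) (.forTo 6 0 heavyBody)

/-- Bound for the number of steps of `heavyBody` per new triple. -/
def heavyCost : ℕ :=
  heavyTest.maxCost + (append (.reg 6) (.get 0 (.reg 14)) (.get 1 (.reg 14))).maxCost + 12

theorem writes_heavyBody : heavyBody.writes ⊆ appendLocs ∪ {.reg 15} := by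
  intro l hl
  simp only [heavyBody, heavyTest, Program.writes, Set.mem_union, Set.mem_singleton_iff,
    Set.mem_empty_iff_false, or_false, or_self] at hl
  rcases hl with h | h
  · exact .inr h
  · exact .inl (writes_appendAll _ _ _ h)

theorem runs_heavyBody {b n m Δ v : ℕ} {E₁ E₂ : ℕ → ℕ} (hb1 : 1 < 2 ^ b) (hvn : v < n)
    {s : State} (hs : Ready n m Δ E₁ E₂ s) (hv : ListValid n m E₁ E₂ s) (h6 : s.reg 6 = v)
    (hb : s.reg 4 + 2 * m < 2 ^ b) :
    Runs b heavyBody s (heavyCost * (2 * m * (if Δ < degUpTo E₁ (2 * m) v then 1 else 0) + 1))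
      (fun s' => Grow s s' ∧ ListValid n m E₁ E₂ s' ∧
        s'.reg 4 = s.reg 4 + 2 * m * (if Δ < degUpTo E₁ (2 * m) v then 1 else 0) ∧
        (Δ < degUpTo E₁ (2 * m) v → ∀ e < 2 * m, Trip s' v (E₁ e) (E₂ e))) := by
  have hlf : heavyTest.LoopFree := ⟨trivial, trivial, trivial⟩
  set s₁ := heavyTest.run b s with hs₁
  set d := 2 * m * (if Δ < degUpTo E₁ (2 * m) v then 1 else 0) with hd
  have hdm : d ≤ 2 * m := by rw [hd]; split_ifs <;> simp
  have hag : Agree {.reg 15} s s₁ := by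
    refine (hlf.agree s).mono ?_
    intro l hl
    simpa [heavyTest, Program.writes] using hl
  have hreg : ∀ x, x ≠ 15 → s₁.reg x = s.reg x := fun x h => hag.reg x (by simp [h])
  have hmem : s₁.mem = s.mem := funext fun a => hag.mem a (by simp)
  have r4 : s₁.reg 4 = s.reg 4 := hreg 4 (by omega)
  have r15 : s₁.reg 15 = d := by
    set t := (Program.assign 15 (.const 0)).run b s with ht
    have t6 : t.reg 6 = v := by simp [ht, Program.run, h6]
    have t3 : t.reg 3 = Δ := by simp [ht, Program.run, hs.reg_three]
    have t16 : t.reg 16 = 2 * m := by simp [ht, Program.run, hs.reg_two_mul]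
    have t15 : t.reg 15 = 0 := by simp [ht, Program.run, WordExp.eval]
    have tm : t.mem = s.mem := rfl
    have hs1 : s₁ = (Program.ite (.lt (.reg 3) (.get 3 (.reg 6))) (.assign 15 (.reg 16))
      .skip).run b t := rfl
    have hcond : (Test.lt (.reg 3) (.get 3 (.reg 6))).Holds b t ↔
        Δ < degUpTo E₁ (2 * m) v := by
      simp [Test.Holds, WordExp.eval, t3, t6, tm, hs.deg]
    rw [hs1, Program.run, hd]
    by_cases hc : Δ < degUpTo E₁ (2 * m) v
    · rw [if_pos (hcond.2 hc), if_pos hc]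
      simp [Program.run, WordExp.eval, t16]
    · rw [if_neg (fun h => hc (hcond.1 h)), if_neg hc]
      exact t15
  have hrun := runs_appendAll (b := b) (d := d) (v := v) (fw := E₁) (fu := E₂) (eV := .reg 6)
    (eW := .get 0 (.reg 14)) (eU := .get 1 (.reg 14)) (s₀ := s₁) r15 (by omega) hb1
    (fun j _ s' h' _ => by
      rw [WordExp.eval, h'.reg 6 (by simp [appendLocs]), hreg 6 (by omega), h6])
    (fun j hj s' h' h14 => by
      simp only [WordExp.eval]
      rw [h'.mem 0 (by simp [appendLocs]), hmem, h14, hs.fst j (by omega)])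
    (fun j hj s' h' h14 => by
      simp only [WordExp.eval]
      rw [h'.mem 1 (by simp [appendLocs]), hmem, h14, hs.snd j (by omega)])
  refine (hlf.runs_seq hrun).mono ?_ ?_
  · rw [heavyCost]
    nlinarith
  · rintro s' ⟨hag', hg, h4, hent⟩
    have hgs : Grow s s' := by
      refine Grow.trans ⟨r4.ge, fun _ _ => ?_, fun _ _ => ?_, fun _ _ => ?_⟩ hg <;> rw [hmem]
    rw [r4] at h4 hent
    refine ⟨hgs, hgs.listValid hv rfl h4 fun j hj => ?_, h4, fun hh e he => ?_⟩
    · obtain ⟨g1, g2, g3⟩ := hent j hj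
      rw [g1, g2, g3]
      exact ⟨hvn, j, by omega, rfl, rfl⟩
    · have hde : d = 2 * m := by rw [hd, if_pos hh, mul_one]
      exact ⟨s.reg 4 + e, by omega, hent e (by omega)⟩

/-- Light vertices cost a bounded number of steps each and heavy ones a number linear in `m`; hence
the separate term `n`. -/
theorem runs_heavySteps {b n m Δ L : ℕ} {E₁ E₂ : ℕ → ℕ} (hb1 : 1 < 2 ^ b) {s₀ : State}
    (hs : Ready n m Δ E₁ E₂ s₀) (hv : ListValid n m E₁ E₂ s₀) (h4 : s₀.reg 4 = L)
    (hb : L + 2 * m * n + n < 2 ^ b) :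
    Runs b heavySteps s₀
      ((heavyCost + 7) * (2 * m * heavyCount m Δ E₁ n + n) + 5)
      (fun s => Agree growLocs s₀ s ∧ Grow s₀ s ∧ ListValid n m E₁ E₂ s ∧
        s.reg 4 = L + 2 * m * heavyCount m Δ E₁ n ∧
        ∀ v < n, Δ < degUpTo E₁ (2 * m) v → ∀ e < 2 * m, Trip s v (E₁ e) (E₂ e)) := by
  have hnot : ∀ x, x ≠ 4 → x ≠ 14 → x ≠ 15 → Loc.reg x ∉ heavyBody.writes := by
    intro x h1 h2 h3 h
    have := writes_heavyBody h
    simp [appendLocs, h1, h2, h3] at this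
  set s₁ := (Program.assign 6 (.const 0)).run b s₀ with hs₁
  have h01 : Agree growLocs s₀ s₁ := agree_assign (reg_mem_growLocs (by omega) (by omega)) s₀
  have r4 : s₁.reg 4 = L := by simp [hs₁, Program.run, h4]
  have hloop := Runs.forTo (b := b) (x := 6) (y := 0) (P := heavyBody) (s₀ := s₁)
    (fun v => heavyCost * (2 * m * (if Δ < degUpTo E₁ (2 * m) v then 1 else 0) + 1))
    (fun v s => Agree growLocs s₀ s ∧ Grow s₀ s ∧ ListValid n m E₁ E₂ s ∧
      s.reg 4 = L + 2 * m * heavyCount m Δ E₁ v ∧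
      ∀ v' < v, Δ < degUpTo E₁ (2 * m) v' → ∀ e < 2 * m, Trip s v' (E₁ e) (E₂ e)) 0 n
    (hnot 6 (by omega) (by omega) (by omega)) (hnot 0 (by omega) (by omega) (by omega))
    (by omega) (by simp [hs₁, Program.run, WordExp.eval])
    (by simp [hs₁, Program.run, hs.reg_zero]) (Nat.zero_le _) (by omega)
    (fun i s v h => ⟨h.1.trans ⟨fun x hx => ?_, fun _ _ => rfl, fun _ _ => rfl,
        fun _ _ => rfl⟩, ⟨h.2.1.1, h.2.1.2, h.2.1.3, h.2.1.4⟩, h.2.2.1, h.2.2.2⟩)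
    ⟨h01, ⟨by omega, fun _ _ => rfl, fun _ _ => rfl, fun _ _ => rfl⟩, hv,
      by simpa [heavyCount] using r4, by simp⟩ ?_
  · refine (Program.LoopFree.runs_seq (P := .assign 6 (.const 0)) trivial hloop).mono ?_
      fun s h => h.2
    have hsum : ∑ j ∈ Finset.Ico 0 n, (heavyCost *
        (2 * m * (if Δ < degUpTo E₁ (2 * m) j then 1 else 0) + 1) + 7) =
        heavyCost * (2 * m * heavyCount m Δ E₁ n) + heavyCost * n + 7 * n := by
      rw [Finset.sum_add_distrib, ← Finset.mul_sum, Finset.sum_add_distrib, ← Finset.mul_sum,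
        heavyCount, Finset.card_filter, Finset.range_eq_Ico]
      simp
      ring
    rw [hsum]
    simp only [Program.maxCost, WordExp.cost]
    nlinarith
  · have : x ≠ 6 := by rintro rfl; exact hx (reg_mem_growLocs (by omega) (by omega))
    simp [this]
  · rintro v - hvn s - h6 ⟨hag, hg, hval, hlen, hcov⟩
    have hle : 2 * m * heavyCount m Δ E₁ v + 2 * m ≤ 2 * m * n := by
      have := heavyCount_le m Δ E₁ v
      nlinarith
    refine (runs_heavyBody hb1 hvn (hag.ready hs) hval h6 (by omega)).frame.mono le_rfl ?_
    rintro s' ⟨hag', hg', hval', hlen', hnew⟩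
    refine ⟨hag.trans (hag'.mono (writes_heavyBody.trans ?_)), hg.trans hg', hval', ?_, ?_⟩
    · rintro l (h | h)
      · exact appendLocs_subset_growLocs h
      · exact .inl ⟨15, by omega, by omega, h⟩
    · rw [hlen', hlen, heavyCount_succ]; ring
    · intro v' hv' hh e he
      rcases Nat.lt_succ_iff_lt_or_eq.1 hv' with h | rfl
      · exact hg'.trip (hcov v' h hh e he)
      · exact hnew hh e he

/-! ### The whole program -/

theorem eAdj_orient {m : ℕ} {e₁ e₂ : ℕ → ℕ} {x y : ℕ} :
    EAdj m (orient m e₁ e₂) (orient m e₂ e₁) x y ↔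
      ∃ i < m, (e₁ i = x ∧ e₂ i = y) ∨ (e₁ i = y ∧ e₂ i = x) := by
  constructor
  · rintro ⟨e, he, h1, h2⟩
    by_cases h : e < m
    · rw [orient, if_pos h] at h1 h2
      exact ⟨e, h, .inl ⟨h1, h2⟩⟩
    · rw [orient, if_neg h] at h1 h2
      exact ⟨e - m, by omega, .inr ⟨h2, h1⟩⟩
  · rintro ⟨i, hi, ⟨h1, h2⟩ | ⟨h1, h2⟩⟩
    · exact ⟨i, by omega, by rw [orient, if_pos hi, h1], by rw [orient, if_pos hi, h2]⟩
    · refine ⟨m + i, by omega, ?_, ?_⟩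
      · rw [orient, if_neg (by omega), Nat.add_sub_cancel_left, h2]
      · rw [orient, if_neg (by omega), Nat.add_sub_cancel_left, h1]

theorem GoodCycle.exists_rotate {A : ℕ → ℕ → Prop} {ω : ℕ → ℕ → ℝ} {k : ℕ} {c : ℕ → ℕ} {r : ℝ}
    (hc : GoodCycle A ω k c r) {i : ℕ} (hi : i < k) :
    ∃ c', GoodCycle A ω k c' r ∧ c' 0 = c i := by
  suffices h : ∃ c', GoodCycle A ω k c' r ∧ ∀ j, i + j < k → c' j = c (i + j) by
    obtain ⟨c', h1, h2⟩ := h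
    exact ⟨c', h1, h2 0 hi⟩
  induction i with
  | zero => exact ⟨c, hc, fun j _ => by rw [zero_add]⟩
  | succ i ih =>
    obtain ⟨c', h, hj⟩ := ih (by omega)
    obtain ⟨k, rfl⟩ : ∃ k', k = k' + 1 := ⟨k - 1, by omega⟩
    have e1 : ∀ j, j ≤ k → (if j ≤ k then c' (j + 1) else c' 1) = c' (j + 1) :=
      fun j hj => if_pos hj
    -- A rotation by one step. The length is now `k + 1`, and the closing position `k + 1` would
    -- read past the end of `c'`, so it is given the new starting vertex.
    refine ⟨fun j => if j ≤ k then c' (j + 1) else c' 1, ⟨?_, ?_, ?_, ?_⟩, ?_⟩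
    · simp
    · intro j hj
      rcases Nat.lt_succ_iff_lt_or_eq.1 hj with h' | rfl
      · simp only [e1 j h'.le, e1 (j + 1) h']
        exact h.adj (j + 1) (by omega)
      · simp only [le_refl, if_true, h.closed]
        rw [if_neg (by omega)]
        exact h.adj 0 (by omega)
    · have hz : ∀ j, j ≤ k → ∃ i < k + 1, c' (j + 1) = c' i ∧ (j < k → i = j + 1) ∧
          (j = k → i = 0) := by
        intro j hj
        rcases hj.lt_or_eq with h' | rfl
        · exact ⟨j + 1, by omega, rfl, fun _ => rfl, by omega⟩
        · exact ⟨0, by omega, h.closed, by omega, fun _ => rfl⟩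
      intro j hj j' hj' heq
      rw [e1 j (by omega), e1 j' (by omega)] at heq
      obtain ⟨z, hz1, hz2, hz3, hz4⟩ := hz j (by omega)
      obtain ⟨z', hz1', hz2', hz3', hz4'⟩ := hz j' (by omega)
      have := h.inj z hz1 z' hz1' (by rw [← hz2, ← hz2', heq])
      omega
    · rw [h.weight, Finset.sum_range_succ', Finset.sum_range_succ]
      congr 1
      · refine Finset.sum_congr rfl fun j hj => ?_
        rw [Finset.mem_range] at hj
        rw [e1 j hj.le, e1 (j + 1) hj]
      · simp [h.closed]
    · intro j hj'
      simp only [e1 j (by omega)]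
      rw [hj (j + 1) (by omega)]
      congr 1; omega

/-- Every cycle has a rotation whose steps are listed, if the list contains the walks with light
inner vertices and everything at heavy vertices. -/
theorem exists_covered {n m Δ k h : ℕ} {E₁ E₂ : ℕ → ℕ} {ω : ℕ → ℕ → ℝ} {s : State}
    (hE : ∀ i < 2 * m, E₁ i < n ∧ E₂ i < n)
    (hsymm : ∀ x y, EAdj m E₁ E₂ x y → EAdj m E₁ E₂ y x) (hh : h < k)
    (htrip : ∀ ℓ < h, ∀ x : ℕ → ℕ, (∀ i ≤ ℓ, EAdj m E₁ E₂ (x i) (x (i + 1))) →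
      (∀ i ≤ ℓ, 1 ≤ i → degUpTo E₁ (2 * m) (x i) ≤ Δ) → Trip s (x 0) (x ℓ) (x (ℓ + 1)))
    (hheavy : ∀ v < n, Δ < degUpTo E₁ (2 * m) v → ∀ e < 2 * m, Trip s v (E₁ e) (E₂ e))
    {c : ℕ → ℕ} {r : ℝ} (hc : GoodCycle (EAdj m E₁ E₂) ω k c r) :
    ∃ c', GoodCycle (EAdj m E₁ E₂) ω k c' r ∧ Covered k h s c' := by
  have hback : ∀ {c : ℕ → ℕ}, GoodCycle (EAdj m E₁ E₂) ω k c r → ∀ i < k,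
      EAdj m E₁ E₂ (c (k - i)) (c (k - (i + 1))) := by
    intro c hc i hi
    have := hc.adj (k - (i + 1)) (by omega)
    rw [show k - (i + 1) + 1 = k - i by omega] at this
    exact hsymm _ _ this
  -- A heavy vertex on the cycle becomes its start, since it is listed with every directed edge.
  -- Without one, both directions around the cycle are walks with light inner vertices.
  by_cases hex : ∃ i < k, Δ < degUpTo E₁ (2 * m) (c i)
  · obtain ⟨i, hi, hdeg⟩ := hex
    obtain ⟨c', hc', h0⟩ := hc.exists_rotate hi
    refine ⟨c', hc', fun j hj => ?_⟩
    have hadj : ∀ x y, EAdj m E₁ E₂ x y → Trip s (c' 0) x y := by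
      rintro x y ⟨e, he, rfl, rfl⟩
      rw [h0]
      obtain ⟨e', he', h1, -⟩ := hc.adj i hi
      exact hheavy _ (h1 ▸ (hE e' he').1) hdeg e he
    exact ⟨hadj _ _ (hc'.adj j (by omega)), hadj _ _ (hback hc' j (by omega))⟩
  · push Not at hex
    refine ⟨c, hc, fun j hj => ⟨?_, ?_⟩⟩
    · exact htrip j hj c (fun i hi => hc.adj i (by omega)) fun i hi _ => hex i (by omega)
    -- The backward walk starts at `c k`, which closedness identifies with `c 0`.
    · have := htrip j hj (fun i => c (k - i)) (fun i hi => hback hc i (by omega))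
        fun i hi hi' => hex _ (by omega)
      simpa only [Nat.sub_zero, hc.closed] using this

theorem Indexed.congr {n m e : ℕ} {E₁ E₂ : ℕ → ℕ} {ω : ℕ → ℕ → ℝ} {s s' : State}
    (h : Indexed n m E₁ E₂ ω e s) (h0 : s'.reg 0 = s.reg 0) (h1 : s'.reg 1 = s.reg 1)
    (h16 : s'.reg 16 = s.reg 16) (hm : s'.mem = s.mem) (hr : s'.rmem = s.rmem) :
    Indexed n m E₁ E₂ ω e s' := by
  obtain ⟨⟩ := h
  constructor <;> simp only [SV, SP, hm, hr, h0, h1, h16] at * <;> assumption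

/-- Reads the input and builds the list of triples. -/
def build (h : ℕ) : Program :=
  .seq orientEdges <| .seq indexEdges <| .seq (threshold h) <|
    .seq (lightSteps (h - 1)) heavySteps

/-- Number of steps of `build`, up to the size of the list. -/
def buildCost (h : ℕ) : ℕ :=
  2 * (orientBody.maxCost + 20) + 2 * (2 * indexBody.maxCost + 30) + 2 * ((powExp h).cost + 20) +
    ((h - 1) * (4 * (lightCost + 7) + 20) + 5) + 2 * (heavyCost + 7) + (heavyCost + 7) * 2 + 5

/-- Every vertex is the tail of a directed edge. This lets work linear in `n` count as work linear
in `m`. -/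
theorem card_le_two_mul {n m : ℕ} {E₁ E₂ : ℕ → ℕ} (hdeg : ∀ v < n, ∃ u, EAdj m E₁ E₂ v u) :
    n ≤ 2 * m := by
  have : Finset.range n ⊆ (Finset.range (2 * m)).image E₁ := by
    intro v hv
    obtain ⟨u, e, he, h1, -⟩ := hdeg v (Finset.mem_range.1 hv)
    exact Finset.mem_image.2 ⟨e, Finset.mem_range.2 he, h1⟩
  simpa using (Finset.card_le_card this).trans Finset.card_image_le

/-- Level 0 of the dynamic programming is ready afterwards: indexing has recorded the one-vertex
paths at node 0, and every vertex has one because none is isolated. The list has the initial triples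
and those of the light and heavy phases, all within a constant depending on `h` times the stated
quantity. -/
theorem runs_build {b n m k h S Δ : ℕ} {e₁ e₂ : ℕ → ℕ} {ω : ℕ → ℕ → ℝ}
    (hω : ∀ x y, ω x y = ω y x) (hE : ∀ i < m, e₁ i < n ∧ e₂ i < n) (hm : 1 ≤ m)
    (hdeg : ∀ v < n, ∃ u, EAdj m (orient m e₁ e₂) (orient m e₂ e₁) v u)
    (hh : 1 ≤ h) (hhk : h < k) (hS : 1 ≤ S)
    (hΔ : 1 ≤ Δ) (hΔm : Δ ≤ m) (hle : m ≤ Δ ^ h) (hmin : ∀ j < Δ, j ^ h < m)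
    (hb : n * n + n * (2 * m) + 2 * m * h * m ^ (h - 1) + 2 * m * n + n + m ^ h + 2 * m + 4 ≤
      2 ^ b) {s₀ : State} (h₀ : Input n m e₁ e₂ ω s₀) :
    Runs b (build h) s₀
      (buildCost h * (m * Δ ^ (h - 1) + m * heavyCount m Δ (orient m e₁ e₂) n))
      (fun s => Filled b k n S (EAdj m (orient m e₁ e₂) (orient m e₂ e₁)) ω 0 s ∧
        s.reg 4 ≤ 2 * h * (m * Δ ^ (h - 1) + m * heavyCount m Δ (orient m e₁ e₂) n) + 
          2 * (m * Δ ^ (h - 1) + m * heavyCount m Δ (orient m e₁ e₂) n) ∧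
        ∀ c r, GoodCycle (EAdj m (orient m e₁ e₂) (orient m e₂ e₁)) ω k c r →
          ∃ c', GoodCycle (EAdj m (orient m e₁ e₂) (orient m e₂ e₁)) ω k c' r ∧
            Covered k h s c') := by
  set E₁ := orient m e₁ e₂ with hE₁
  set E₂ := orient m e₂ e₁ with hE₂
  set H := heavyCount m Δ E₁ n with hH
  have hE' : ∀ i < 2 * m, E₁ i < n ∧ E₂ i < n := by
    intro i hi
    rw [hE₁, hE₂, orient, orient]
    split_ifs with h
    · exact hE i h
    · exact (hE (i - m) (by omega)).symm
  have hsymm : ∀ x y, EAdj m E₁ E₂ x y → EAdj m E₁ E₂ y x := by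
    intro x y hxy
    rw [eAdj_orient] at hxy ⊢
    obtain ⟨i, hi, h⟩ := hxy
    exact ⟨i, hi, h.symm⟩
  have hn2 : n ≤ 2 * m := card_le_two_mul hdeg
  have hpow : Δ ^ (h - 1) ≤ m ^ (h - 1) := Nat.pow_le_pow_left hΔm _
  have hX : m ≤ m * Δ ^ (h - 1) := Nat.le_mul_of_pos_right _ (Nat.pow_pos hΔ)
  have hlight : 2 * m * (h - 1 + 1) * Δ ^ (h - 1) ≤ 2 * m * h * m ^ (h - 1) := by
    rw [Nat.sub_add_cancel hh]
    exact Nat.mul_le_mul_left _ hpow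
  have hrun := (runs_orientEdges (b := b) hω (by omega) h₀).seq fun s₁ h₁ =>
    (runs_indexEdges (b := b) (by omega) (by omega) (by omega) hE' h₁).seq fun s₂ h₂ =>
    (runs_threshold (b := b) hΔ hΔm hle hmin (by omega) (by omega) h₂.1.reg_one).frame.seq
      (P' := .seq (lightSteps (h - 1)) heavySteps)
      (T' := ((h - 1) * (4 * (lightCost + 7) + 20) + 5) * (m * Δ ^ (h - 1)) +
        ((heavyCost + 7) * (2 * m * H + n) + 5))
      (Q' := fun s => Filled b k n S (EAdj m E₁ E₂) ω 0 s ∧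
        s.reg 4 ≤ 2 * h * (m * Δ ^ (h - 1) + m * H) + 2 * (m * Δ ^ (h - 1) + m * H) ∧
        ∀ c r, GoodCycle (EAdj m E₁ E₂) ω k c r →
          ∃ c', GoodCycle (EAdj m E₁ E₂) ω k c' r ∧ Covered k h s c') fun s₃ h₃ => ?_
  · refine hrun.mono ?_ fun _ h => h
    rw [buildCost]
    set X := m * Δ ^ (h - 1) + m * H
    have hx1 : m + 1 ≤ 2 * X := by omega
    have hx2 : 2 * m * H + n ≤ 4 * X := by
      have : 2 * m * H = 2 * (m * H) := by ring
      omega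
    have hx3 : m * Δ ^ (h - 1) ≤ X := Nat.le_add_right _ _
    have t1 := Nat.mul_le_mul_left (orientBody.maxCost + 20) hx1
    have t2 := Nat.mul_le_mul_left (2 * indexBody.maxCost + 30) hx1
    have t3 := Nat.mul_le_mul_left ((powExp h).cost + 20) hx1
    have t4 := Nat.mul_le_mul_left ((h - 1) * (4 * (lightCost + 7) + 20) + 5) hx3
    have t5 := Nat.mul_le_mul_left (heavyCost + 7) hx2
    have hX1 : 1 ≤ X := by omega
    nlinarith
  · obtain ⟨hI, h4⟩ := h₂
    obtain ⟨hag, hr3⟩ := h₃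
    have hI₃ : Indexed n m E₁ E₂ ω (2 * m) s₃ := by
      refine hI.congr (hag.reg 0 ?_) (hag.reg 1 ?_) (hag.reg 16 ?_)
        (funext fun a => hag.mem a ?_) (funext fun a => hag.rmem a ?_) <;>
      simp [threshold, Program.writes]
    have h4₃ : s₃.reg 4 = 2 * m := by
      rw [hag.reg 4 (by simp [threshold, Program.writes]), h4]
    have hR₃ : Ready n m Δ E₁ E₂ s₃ := ⟨hI₃.reg_zero, hI₃.reg_two_mul, hr3, hI₃.fst, hI₃.snd,
      hI₃.deg, hI₃.adj, hI₃.adj_sound⟩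
    refine (runs_lightSteps (b := b) (by omega) (by omega) hE' hm hΔ (by omega) hR₃ h4₃
      hI₃.list).seq ?_
    rintro s₄ ⟨hag₄, hL⟩
    have hlen := hL.len
    have hlen' : s₄.reg 4 ≤ 2 * h * (m * Δ ^ (h - 1)) := by
      rw [Nat.sub_add_cancel hh] at hlen
      calc _ ≤ _ := hlen
        _ = _ := by ring
    refine (runs_heavySteps (b := b) (by omega) (hag₄.ready hR₃) hL.valid rfl (by omega)).mono
      le_rfl ?_
    rintro s ⟨hag₅, hg, hval, h4₅, hheavy⟩
    rw [← hH] at h4₅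
    have hags : Agree growLocs s₃ s := hag₄.trans hag₅
    have hHn : H ≤ n := heavyCount_le _ _ _ _
    have hHm : 2 * m * H ≤ 2 * m * n := Nat.mul_le_mul_left _ hHn
    have hSV : ∀ ℓ key t, SV s ℓ key t ↔ SV s₃ ℓ key t := fun ℓ key t => by
      have := ten_le_cV (sl ℓ t)
      rw [SV, SV, hags.grow_mem (by omega) (by omega) (by omega)]
    have hSP : ∀ ℓ key t i, SP s ℓ key t i = SP s₃ ℓ key t i := fun ℓ key t i => by
      have := ten_le_cP (sl ℓ t) i
      rw [SP, SP, hags.grow_mem (by omega) (by omega) (by omega)]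
    have hrm : s.rmem = s₃.rmem := funext fun a => hags.rmem a (by simp [growLocs])
    -- The model has no real constants; weight zero comes from real cells that are still untouched.
    have hSW : ∀ key t, SW s 0 key t = 0 := fun key t => by
      rw [SW, hrm]; exact hI₃.rmem _ (two_le_cW _) _
    have hroot : ∀ key t, SV s 0 key t → t = 0 ∧ ∃ v < n, key = v * n + v ∧ SP s 0 key 0 0 = v := by
      intro key t hkey
      rw [hSV] at hkey
      by_cases ht : t = 0
      · subst ht
        obtain ⟨v, hv, h1, h2⟩ := hI₃.root_sound key hkey
        exact ⟨rfl, v, hv, h1, by rw [hSP, h2]⟩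
      · have := hI₃.flag 0 t (by simp [ht]) key
        rw [SV, this] at hkey
        omega
    refine ⟨⟨⟨?_, by omega, ?_, ?_⟩, ?_, ?_, ?_⟩, ?_, ?_⟩
    · rw [hags.grow_reg (by omega), hI₃.reg_zero]
    · intro i hi
      obtain ⟨h1, e, he, h2, h3⟩ := hval i hi
      exact ⟨h1, e, he, h2.symm, h3.symm⟩
    · rintro x y ⟨e, he, rfl, rfl⟩
      rw [hrm]
      exact hI₃.weight e he
    · intro ℓ hℓ t _ key hkey
      obtain rfl : ℓ = 0 := by omega
      obtain ⟨rfl, v, hv, h1, h2⟩ := hroot key t hkey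
      exact ⟨v, v, hv, hv, h1, h2, h2, by simp, fun i hi j hj _ => by omega, by simp [hSW]⟩
    · intro ℓ hℓ v u x r hv hx _ B _ hB
      obtain rfl : ℓ = 0 := by omega
      obtain rfl : v = u := by rw [← hx.start, ← hx.finish]
      obtain ⟨u', e, he, h1, -⟩ := hdeg v hv
      have hV : SV s 0 (v * n + v) 0 := by
        rw [hSV, ← h1]; exact hI₃.root e he
      -- The root serves every `B`, as there is only one path of length 0 from `v` to `v`.
      refine ⟨0, by omega, hV, by rw [hSW, hx.weight]; simp, fun i hi => ?_⟩
      obtain rfl : i = 0 := by omega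
      obtain ⟨-, v', hv', h2, h3⟩ := hroot _ 0 hV
      obtain ⟨rfl, -⟩ := pair_index_inj hv hv' h2
      rw [h3, ← hx.start]
      exact hB 0 le_rfl
    · intro ℓ hℓ t key hkey
      rw [hSV] at hkey
      have := hI₃.flag ℓ t (by simp; omega) key
      rw [SV, this] at hkey
      omega
    · rw [h4₅, mul_add (2 * h), mul_add 2, mul_assoc 2 m H]
      omega
    · intro c r hc
      refine exists_covered hE' hsymm hhk (fun ℓ hℓ x hx hd => ?_) hheavy hc
      exact hg.trip (hL.trip ℓ (by omega) x hx hd)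

/-! ### The assembled algorithm -/

/-- Finds a cycle of length `k = a + h` of maximum weight. -/
def maxCycle (a h : ℕ) : Program :=
  .seq (build h) <| .seq (dynProg (a + h) (treeSize (a + h) (a + h)) h) <|
    .seq (glueAll (treeSize (a + h) (a + h)) a h) (output (a + h))

theorem deterministic_maxCycle (a h : ℕ) : (maxCycle a h).Deterministic := by
  refine ⟨⟨⟨trivial, ⟨loopFree_orientBody.deterministic, trivial⟩, trivial⟩,
    ⟨trivial, ⟨loopFree_indexBody.deterministic, trivial⟩, trivial⟩, ⟨trivial, trivial⟩,
    ⟨⟨trivial, trivial⟩, Program.deterministic_seqN fun _ _ => ?_⟩, ?_⟩,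
    deterministic_dynProg _ _ _, deterministic_scan fun _ _ => loopFree_tryGlue _ _ _ _,
    (loopFree_output _).deterministic⟩
  · simp [lightStep, lightBody, appendAll, append, Program.forTo, Program.Deterministic]
  · simp [heavySteps, heavyBody, heavyTest, appendAll, append, Program.forTo,
      Program.Deterministic]

/-- Number of steps of `maxCycle`, up to the size of the list. -/
def maxCycleCost (a h : ℕ) : ℕ :=
  buildCost h + (dynCost (a + h) (treeSize (a + h) (a + h)) h +
    glueCost (treeSize (a + h) (a + h)) a h) * (2 * h + 3) + (output (a + h)).maxCost

theorem Covered.of_agree {k h : ℕ} {s s' : State} {c : ℕ → ℕ} (hag : Agree dpLocs s s')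
    (hc : Covered k h s c) : Covered k h s' c :=
  fun i hi => ⟨hag.dp_trip.2 (hc i hi).1, hag.dp_trip.2 (hc i hi).2⟩

/-- After the list is built, everything is a number of passes over it that depends on `a` and `h`
only, each with bounded work per triple. A cycle may have to be rotated before its steps are
covered, which does not change its weight. -/
theorem runs_maxCycle {b n m a h Δ : ℕ} {e₁ e₂ : ℕ → ℕ} {ω : ℕ → ℕ → ℝ}
    (hω : ∀ x y, ω x y = ω y x) (hE : ∀ i < m, e₁ i < n ∧ e₂ i < n) (hm : 1 ≤ m)
    (hdeg : ∀ v < n, ∃ u, EAdj m (orient m e₁ e₂) (orient m e₂ e₁) v u)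
    (ha : 1 ≤ a) (hah : a ≤ h)
    (hΔ : 1 ≤ Δ) (hΔm : Δ ≤ m) (hle : m ≤ Δ ^ h) (hmin : ∀ j < Δ, j ^ h < m)
    (hb : n * n + n * (2 * m) + 2 * m * h * m ^ (h - 1) + 2 * m * n + n + m ^ h + 2 * m + 4 ≤
      2 ^ b) (hbk : a + h ≤ 2 ^ b) {s₀ : State} (h₀ : Input n m e₁ e₂ ω s₀) :
    Runs b (maxCycle a h) s₀
      (maxCycleCost a h * (m * Δ ^ (h - 1) + m * heavyCount m Δ (orient m e₁ e₂) n))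
      (Answer (EAdj m (orient m e₁ e₂) (orient m e₂ e₁)) ω (a + h)) := by
  set k := a + h with hk
  set E₁ := orient m e₁ e₂ with hE₁
  set E₂ := orient m e₂ e₁ with hE₂
  set X := m * Δ ^ (h - 1) + m * heavyCount m Δ E₁ n with hX
  set S := treeSize k k with hS
  have hX1 : 1 ≤ X := by
    have : m ≤ m * Δ ^ (h - 1) := Nat.le_mul_of_pos_right _ (Nat.pow_pos hΔ)
    omega
  have hS1 : 1 ≤ S := (treeSize_mono (by omega) (Nat.zero_le k) : treeSize k 0 ≤ treeSize k k)
  have hA : ∀ x y, EAdj m E₁ E₂ x y → x < n ∧ y < n := by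
    intro x y hxy
    rw [eAdj_orient] at hxy
    obtain ⟨i, hi, ⟨rfl, rfl⟩ | ⟨rfl, rfl⟩⟩ := hxy
    · exact hE i hi
    · exact (hE i hi).symm
  have hAs : ∀ x y, EAdj m E₁ E₂ x y → EAdj m E₁ E₂ y x := by
    intro x y hxy
    rw [eAdj_orient] at hxy ⊢
    obtain ⟨i, hi, h⟩ := hxy
    exact ⟨i, hi, h.symm⟩
  have hlen : ∀ r, r ≤ 2 * h * X + 2 * X → r + 1 ≤ (2 * h + 3) * X := by
    intro r hr
    nlinarith
  have hrun := (runs_build (k := k) (S := S) hω hE hm hdeg (by omega : 1 ≤ h) (by omega) hS1 hΔ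
    hΔm hle hmin hb h₀).seq
    (P' := .seq (dynProg k S h) (.seq (glueAll S a h) (output k)))
    (T' := dynCost k S h * ((2 * h + 3) * X) +
      (glueCost S a h * ((2 * h + 3) * X) + (output k).maxCost))
    (Q' := Answer (EAdj m E₁ E₂) ω k) fun s₁ ⟨hF, h4, hcov⟩ => ?_
  · refine hrun.mono ?_ fun _ h => h
    rw [maxCycleCost]
    nlinarith
  · refine ((runs_dynProg (b := b) hA (by omega) (by omega) (by omega : h < k) le_rfl
      hF).mono (Nat.mul_le_mul_left _ (hlen _ h4)) fun _ h => h).seq ?_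
    rintro s₂ ⟨hag, hF₂⟩
    refine ((runs_glueAll (b := b) hA hAs hω ha hah (by omega) (by omega) hF₂).mono
      (Nat.mul_le_mul_left _ (hlen _ ?_)) fun _ h => h).seq ?_
    · rw [hag.dp_reg (by omega)]; exact h4
    · rintro s₃ ⟨hsnd, hcomp⟩
      refine (loopFree_output k).runs (answer_run_output (by omega) hbk hsnd fun c r hc => ?_)
      obtain ⟨c', hc', hcv⟩ := hcov c r hc
      exact hcomp c' r hc' (hcv.of_agree hag)

/-! ### Sequences of vertices and cycles of the graph -/

theorem exists_walk_of_forall_adj {V : Type*} {G : SimpleGraph V} {N : ℕ} {x : ℕ → V}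
    (hx : ∀ i < N, G.Adj (x i) (x (i + 1))) :
    ∃ p : G.Walk (x 0) (x N), p.length = N ∧ ∀ i ≤ N, p.getVert i = x i := by
  induction N generalizing x with
  | zero => exact ⟨.nil, rfl, fun i hi => by rw [Nat.le_zero.1 hi]; rfl⟩
  | succ N ih =>
    obtain ⟨p, hp, hv⟩ := ih (x := fun i => x (i + 1)) fun i hi => hx (i + 1) (by omega)
    refine ⟨.cons (hx 0 (by omega)) p, by simp [hp], fun i hi => ?_⟩
    cases i with
    | zero => rfl
    | succ i => simpa using hv i (by omega)

/-- A closed walk of length at least 3 is a cycle once its tail is a path. The tail visits `x 1, …,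
x k`, so injectivity is first shifted from positions below `k` to positions from 1 to `k`. -/
theorem exists_isCycle {V : Type*} {G : SimpleGraph V} {k : ℕ} (hk : 3 ≤ k) {x : ℕ → V}
    (hx : ∀ i < k, G.Adj (x i) (x (i + 1))) (hc : x k = x 0)
    (hinj : ∀ i < k, ∀ j < k, x i = x j → i = j) :
    ∃ p : G.Walk (x 0) (x 0), p.IsCycle ∧ p.length = k ∧ ∀ i ≤ k, p.getVert i = x i := by
  obtain ⟨p, hp, hv⟩ := exists_walk_of_forall_adj hx
  refine ⟨p.copy rfl hc, ?_, by simpa using hp, fun i hi => by simpa using hv i hi⟩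
  have hinj' : ∀ i ≤ k, 1 ≤ i → ∀ j ≤ k, 1 ≤ j → x i = x j → i = j := by
    intro i hi hi1 j hj hj1 hij
    rcases hi.lt_or_eq with hi | rfl <;> rcases hj.lt_or_eq with hj | rfl
    · exact hinj i hi j hj hij
    · have := hinj i hi 0 (by omega) (hij.trans hc)
      omega
    · have := hinj j hj 0 (by omega) (hij.symm.trans hc)
      omega
    · rfl
  refine SimpleGraph.Walk.isCycle_iff_isPath_tail_and_le_length.2 ⟨?_, by simpa [hp] using hk⟩
  rw [SimpleGraph.Walk.isPath_iff_injective_get_support]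
  have hnil : ¬ (p.copy rfl hc).Nil := by
    rw [← SimpleGraph.Walk.length_eq_zero_iff]
    simp only [SimpleGraph.Walk.length_copy]
    omega
  have hlen := SimpleGraph.Walk.length_tail_add_one hnil
  simp only [SimpleGraph.Walk.length_copy, hp] at hlen
  rintro ⟨i, hi⟩ ⟨j, hj⟩ hij
  rw [SimpleGraph.Walk.length_support] at hi hj
  simp only [List.get_eq_getElem, SimpleGraph.Walk.support_getElem_eq_getVert,
    SimpleGraph.Walk.getVert_tail, SimpleGraph.Walk.getVert_copy] at hij
  rw [hv _ (by omega), hv _ (by omega)] at hij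
  have := hinj' _ (by omega) (by omega) _ (by omega) (by omega) hij
  simp only [Fin.mk.injEq]
  omega

/-- A weight function on the pairs of vertices, as a function of two numbers. -/
def natWeight {n : ℕ} (w : Sym2 (Fin n) → ℝ) (x y : ℕ) : ℝ :=
  if h : x < n ∧ y < n then w s(⟨x, h.1⟩, ⟨y, h.2⟩) else 0

theorem natWeight_comm {n : ℕ} (w : Sym2 (Fin n) → ℝ) (x y : ℕ) :
    natWeight w x y = natWeight w y x := by
  by_cases h : x < n ∧ y < n
  · rw [natWeight, natWeight, dif_pos h, dif_pos h.symm, Sym2.eq_swap]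
  · rw [natWeight, natWeight, dif_neg h, dif_neg fun h' => h h'.symm]

@[simp]
theorem natWeight_val {n : ℕ} (w : Sym2 (Fin n) → ℝ) (u v : Fin n) :
    natWeight w u v = w s(u, v) := by
  rw [natWeight, dif_pos ⟨u.2, v.2⟩]

/-- Adjacency as a relation between numbers. -/
def natAdj {n : ℕ} (G : SimpleGraph (Fin n)) (x y : ℕ) : Prop :=
  ∃ u v : Fin n, x = u ∧ y = v ∧ G.Adj u v

theorem walkWeight_eq_sum {n : ℕ} {G : SimpleGraph (Fin n)} (w : Sym2 (Fin n) → ℝ) {u v : Fin n}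
    (p : G.Walk u v) : walkWeight w p =
      ∑ i ∈ Finset.range p.length, natWeight w (p.getVert i) (p.getVert (i + 1)) := by
  induction p with
  | nil => simp [walkWeight]
  | cons h p ih =>
    rw [SimpleGraph.Walk.length_cons, Finset.sum_range_succ']
    simp only [walkWeight, SimpleGraph.Walk.edges_cons, List.map_cons, List.sum_cons,
      SimpleGraph.Walk.getVert_cons_succ, SimpleGraph.Walk.getVert_zero, natWeight_val] at ih ⊢
    rw [ih, add_comm]

theorem goodCycle_of_isCycle {n : ℕ} {G : SimpleGraph (Fin n)} (w : Sym2 (Fin n) → ℝ) {u : Fin n}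
    {p : G.Walk u u} (hp : p.IsCycle) :
    GoodCycle (natAdj G) (natWeight w) p.length (fun i => p.getVert i) (walkWeight w p) where
  closed := by simp
  adj i hi := ⟨_, _, rfl, rfl, p.adj_getVert_succ hi⟩
  inj i hi j hj hij := hp.getVert_injOn' (by simp only [Set.mem_ofPred_eq]; omega)
    (by simp only [Set.mem_ofPred_eq]; omega) (Fin.ext hij)
  weight := walkWeight_eq_sum w p

theorem GoodCycle.exists_isCycle {n k : ℕ} {G : SimpleGraph (Fin n)} {w : Sym2 (Fin n) → ℝ}
    (hk : 3 ≤ k) {x : ℕ → ℕ} {r : ℝ} (hx : GoodCycle (natAdj G) (natWeight w) k x r) :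
    ∃ (u : Fin n) (p : G.Walk u u), p.IsCycle ∧ p.length = k ∧ (∀ i ≤ k, x i = p.getVert i) ∧
      walkWeight w p = r := by
  -- The choice needs a vertex for every index, but only indices up to `k` are constrained; at `k`
  -- itself closedness supplies it.
  have hex : ∀ i, ∃ v : Fin n, i ≤ k → x i = v := by
    intro i
    by_cases hi : i < k
    · obtain ⟨u, -, hu, -⟩ := hx.adj i hi
      exact ⟨u, fun _ => hu⟩
    · obtain ⟨u, -, hu, -⟩ := hx.adj 0 (by omega)
      refine ⟨u, fun hi' => ?_⟩
      obtain rfl : i = k := by omega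
      rw [hx.closed, hu]
  choose y hy using hex
  obtain ⟨p, hp, hlen, hv⟩ := RealRAM.exists_isCycle (G := G) (x := y) hk (fun i hi => by
      obtain ⟨u, v, hu, hv, huv⟩ := hx.adj i hi
      rw [hy i hi.le] at hu
      rw [hy (i + 1) hi] at hv
      rwa [Fin.ext hu, Fin.ext hv])
    (Fin.ext (by rw [← hy k le_rfl, ← hy 0 (by omega), hx.closed]))
    (fun i hi j hj hij => hx.inj i hi j hj (by rw [hy i hi.le, hy j hj.le, hij]))
  have hxp : ∀ i ≤ k, x i = p.getVert i := fun i hi => by rw [hv i hi, hy i hi]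
  refine ⟨_, p, hp, hlen, hxp, ?_⟩
  rw [walkWeight_eq_sum, hx.weight, hlen]
  refine Finset.sum_congr rfl fun i hi => ?_
  have hi := Finset.mem_range.1 hi
  rw [hxp i hi.le, hxp (i + 1) hi]

theorem Answer.correctAnswer {n k : ℕ} {G : SimpleGraph (Fin n)} {w : Sym2 (Fin n) → ℝ}
    {s : State} (hk : 3 ≤ k) (h : Answer (natAdj G) (natWeight w) k s) :
    CorrectAnswer G w k s := by
  rcases h with ⟨h1, x, r, hx, hs, hmax⟩ | ⟨h0, hno⟩
  · obtain ⟨u, p, hp, hlen, hxp, hr⟩ := hx.exists_isCycle hk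
    refine .inl ⟨h1, u, p, ⟨hp, hlen, fun v q hq hql => ?_⟩, fun i hi => ?_⟩
    · subst hql
      rw [hr]
      exact hmax _ _ (goodCycle_of_isCycle w hq)
    · rw [hs i hi, hxp i hi.le]
  · refine .inr ⟨h0, ?_⟩
    rintro ⟨u, p, hp, rfl⟩
    exact hno _ _ (goodCycle_of_isCycle w hp)

/-- An endpoint list as a function on numbers. -/
def natEnds {n m : ℕ} (f : Fin m → Fin n) (i : ℕ) : ℕ := if h : i < m then f ⟨i, h⟩ else 0

theorem natEnds_of_lt {n m i : ℕ} (f : Fin m → Fin n) (h : i < m) : natEnds f i = f ⟨i, h⟩ :=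
  dif_pos h

theorem ListsEdges.eAdj_iff {n m : ℕ} {G : SimpleGraph (Fin n)} {src dst : Fin m → Fin n}
    (h : ListsEdges G src dst) {x y : ℕ} :
    EAdj m (orient m (natEnds src) (natEnds dst)) (orient m (natEnds dst) (natEnds src)) x y ↔
      natAdj G x y := by
  have hadj : ∀ u v, G.Adj u v ↔ ∃ i, s(src i, dst i) = s(u, v) := fun u v => by
    rw [← SimpleGraph.mem_edgeSet, ← h.2]
    rfl
  rw [eAdj_orient]
  constructor
  · rintro ⟨i, hi, ⟨rfl, rfl⟩ | ⟨rfl, rfl⟩⟩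
    · exact ⟨src ⟨i, hi⟩, dst ⟨i, hi⟩, natEnds_of_lt _ hi, natEnds_of_lt _ hi,
        (hadj _ _).2 ⟨_, rfl⟩⟩
    · exact ⟨dst ⟨i, hi⟩, src ⟨i, hi⟩, natEnds_of_lt _ hi, natEnds_of_lt _ hi,
        (hadj _ _).2 ⟨_, Sym2.eq_swap⟩⟩
  · rintro ⟨u, v, rfl, rfl, huv⟩
    obtain ⟨i, hi⟩ := (hadj u v).1 huv
    refine ⟨i, i.2, ?_⟩
    rw [natEnds_of_lt _ i.2, natEnds_of_lt _ i.2]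
    rcases Sym2.eq_iff.1 hi with ⟨h1, h2⟩ | ⟨h1, h2⟩
    · exact .inl ⟨congrArg _ h1, congrArg _ h2⟩
    · exact .inr ⟨congrArg _ h1, congrArg _ h2⟩

theorem input_initState {n m : ℕ} (w : Sym2 (Fin n) → ℝ) (src dst : Fin m → Fin n)
    (coins : ℕ → Bool) : Input n m (natEnds src) (natEnds dst) (natWeight w)
      (initState n m src dst (fun i => w s(src i, dst i)) coins) where
  reg_zero := rfl
  reg_one := rfl
  fst i hi := by simp [initState, natEnds, hi]
  snd i hi := by simp [initState, natEnds, hi]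
  weight i hi := by simp [initState, natEnds_of_lt _ hi, hi]
  mem a ha i := by
    simp only [initState, if_neg (show a ≠ 0 by omega), if_neg (show a ≠ 1 by omega), dite_eq_ite,
      ite_self]
  rmem a ha i := by
    simp only [initState, if_neg (show a ≠ 0 by omega), dite_eq_ite, ite_self]

/-! ### Numerical estimates -/

/-- With `2 * m + 4` taken together, each summand is at most `(m + 2) ^ (2 * h + 4)`; there are
fewer than `8 ≤ (m + 2) ^ 3` of them. -/
theorem word_bound {n m h a : ℕ} (hn : n ≤ 2 * m) (hm : 1 ≤ m) (hh : 1 ≤ h) (hah : a ≤ h) :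
    n * n + n * (2 * m) + 2 * m * h * m ^ (h - 1) + 2 * m * n + n + m ^ h + 2 * m + 4 ≤
      (m + 2) ^ (2 * h + 7) ∧ a + h ≤ (m + 2) ^ (2 * h + 7) := by
  set M := m + 2 with hM
  have hmono : ∀ {i j}, i ≤ j → M ^ i ≤ M ^ j := fun hij => Nat.pow_le_pow_right (by omega) hij
  have h2m : 2 * m + 4 ≤ M ^ 2 := by nlinarith
  have hhM : h ≤ M ^ h := (Nat.lt_pow_self (by omega)).le
  have hmM : m ^ h ≤ M ^ h := Nat.pow_le_pow_left (by omega) _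
  have h44 : ∀ x y, x ≤ M ^ 2 → y ≤ M ^ 2 → x * y ≤ M ^ (2 * h + 4) := fun x y hx hy =>
    (Nat.mul_le_mul hx hy).trans (by rw [← pow_add]; exact hmono (by omega))
  have e1 := h44 n n (by omega) (by omega)
  have e2 := h44 n (2 * m) (by omega) (by omega)
  have e3 := h44 (2 * m) n (by omega) (by omega)
  have e4 : 2 * m * h * m ^ (h - 1) ≤ M ^ (2 * h + 4) := by
    obtain ⟨l, rfl⟩ : ∃ l, h = l + 1 := ⟨h - 1, by omega⟩
    calc 2 * m * (l + 1) * m ^ (l + 1 - 1) = 2 * ((l + 1) * m ^ (l + 1)) := by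
          rw [Nat.add_sub_cancel]; ring
      _ ≤ M * (M ^ (l + 1) * M ^ (l + 1)) :=
          Nat.mul_le_mul (by omega) (Nat.mul_le_mul hhM hmM)
      _ = M ^ (2 * (l + 1) + 1) := by ring
      _ ≤ _ := hmono (by omega)
  have e5 : M ^ 2 ≤ M ^ (2 * h + 4) := hmono (by omega)
  have e6 : M ^ h ≤ M ^ (2 * h + 4) := hmono (by omega)
  have e7 : 8 * M ^ (2 * h + 4) ≤ M ^ (2 * h + 7) := by
    rw [show 2 * h + 7 = 3 + (2 * h + 4) by ring, pow_add M 3]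
    exact Nat.mul_le_mul_right _ (Nat.pow_le_pow_left (show 2 ≤ M by omega) 3)
  constructor <;> omega

/-- Let `μ` be the `h`-th root of `m`. Minimality gives `Δ - 1 < μ`, hence `Δ ≤ 2 * μ` because `1 ≤
μ`, and `m ≤ Δ ^ h` gives `μ ≤ Δ`. So `Δ ^ (h - 1) ≤ 2 ^ (h - 1) * μ ^ (h - 1)`, while `H ≤ 2 * m /
μ = 2 * μ ^ (h - 1)`, and `m * μ ^ (h - 1)` is the desired power of `m`. -/
theorem rpow_bound {m h Δ H : ℕ} (hm : 1 ≤ m) (hh : 1 ≤ h) (hΔ : 1 ≤ Δ) (hle : m ≤ Δ ^ h)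
    (hmin : ∀ j < Δ, j ^ h < m) (hH : H * Δ ≤ 2 * m) :
    ((m * Δ ^ (h - 1) + m * H : ℕ) : ℝ) ≤
      (2 ^ (h - 1) + 2) * (m : ℝ) ^ (2 - 1 / (h : ℝ)) := by
  have hm0 : (1 : ℝ) ≤ m := by exact_mod_cast hm
  have hh0 : (h : ℝ) ≠ 0 := by positivity
  obtain ⟨μ, hμ⟩ : ∃ μ : ℝ, μ = (m : ℝ) ^ (1 / (h : ℝ)) := ⟨_, rfl⟩
  have hμ1 : 1 ≤ μ := hμ ▸ Real.one_le_rpow hm0 (by positivity)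
  have hμh : μ ^ h = m := by
    rw [hμ, ← Real.rpow_natCast, ← Real.rpow_mul (by positivity), one_div_mul_cancel hh0,
      Real.rpow_one]
  have hpow : (m : ℝ) ^ (2 - 1 / (h : ℝ)) = m * μ ^ (h - 1) := by
    have : (m : ℝ) ^ (2 - 1 / (h : ℝ)) * μ = m * μ ^ (h - 1) * μ := by
      rw [mul_assoc, ← pow_succ, Nat.sub_add_cancel hh, hμh, hμ,
        ← Real.rpow_add (by positivity), sub_add_cancel, Real.rpow_ofNat, sq]
    exact mul_right_cancel₀ (by positivity) this
  have hΔ2 : (Δ : ℝ) ≤ 2 * μ := by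
    have h1 : ((Δ - 1 : ℕ) : ℝ) ^ h < μ ^ h := by
      rw [hμh]
      exact_mod_cast hmin (Δ - 1) (by omega)
    have h2 := lt_of_pow_lt_pow_left₀ h (by positivity) h1
    rw [Nat.cast_sub hΔ, Nat.cast_one] at h2
    linarith
  have hμΔ : μ ≤ Δ := by
    refine le_of_pow_le_pow_left₀ (n := h) (by omega) (by positivity) ?_
    rw [hμh]
    exact_mod_cast hle
  have hHμ : (H : ℝ) ≤ 2 * μ ^ (h - 1) := by
    have h1 : (H : ℝ) * Δ ≤ 2 * m := by exact_mod_cast hH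
    refine le_of_mul_le_mul_right (a := μ) ?_ (by positivity)
    rw [mul_assoc, ← pow_succ, Nat.sub_add_cancel hh, hμh]
    exact (mul_le_mul_of_nonneg_left hμΔ (by positivity)).trans h1
  have hΔp : (Δ : ℝ) ^ (h - 1) ≤ 2 ^ (h - 1) * μ ^ (h - 1) := by
    rw [← mul_pow]
    exact pow_le_pow_left₀ (by positivity) hΔ2 _
  rw [hpow]
  push_cast
  calc (m : ℝ) * Δ ^ (h - 1) + m * H = m * (Δ ^ (h - 1) + H) := by ring
    _ ≤ m * (2 ^ (h - 1) * μ ^ (h - 1) + 2 * μ ^ (h - 1)) := by gcongr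
    _ = _ := by ring

theorem natCeil_half (k : ℕ) : ⌈(k : ℝ) / 2⌉₊ = (k + 1) / 2 := by
  apply le_antisymm
  · rw [Nat.ceil_le, div_le_iff₀ (by norm_num)]
    exact_mod_cast (by omega : k ≤ (k + 1) / 2 * 2)
  · have h := Nat.le_ceil ((k : ℝ) / 2)
    rw [div_le_iff₀ (by norm_num)] at h
    have : k ≤ ⌈(k : ℝ) / 2⌉₊ * 2 := by exact_mod_cast h
    omega

/-- The program `maxCycle` finds a maximum-weight cycle of length `k` in
`O(m ^ (2 - 1 / ⌈k / 2⌉))` time. -/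
theorem exec_maxCycle {k n m b : ℕ} (hk : 3 ≤ k) {G : SimpleGraph (Fin n)}
    (w : Sym2 (Fin n) → ℝ) {src dst : Fin m → Fin n} (hG : ListsEdges G src dst) (hm : 1 ≤ m)
    (hdeg : ∀ v, ∃ u, G.Adj v u) (hb : (m + 2) ^ (2 * ((k + 1) / 2) + 7) ≤ 2 ^ b)
    (coins : ℕ → Bool) :
    ∃ t s, Exec b (maxCycle (k / 2) ((k + 1) / 2))
        (initState n m src dst (fun i => w s(src i, dst i)) coins) t s ∧
      (t : ℝ) ≤ maxCycleCost (k / 2) ((k + 1) / 2) * (2 ^ ((k + 1) / 2 - 1) + 2) *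
        (m : ℝ) ^ (2 - 1 / (⌈(k : ℝ) / 2⌉₊ : ℝ)) ∧
      CorrectAnswer G w k s := by
  rw [natCeil_half]
  obtain ⟨a, ha⟩ : ∃ a, a = k / 2 := ⟨_, rfl⟩
  obtain ⟨h, hh⟩ : ∃ h, h = (k + 1) / 2 := ⟨_, rfl⟩
  rw [← hh] at hb
  rw [← ha, ← hh]
  have hE : ∀ i < m, natEnds src i < n ∧ natEnds dst i < n := fun i hi => by
    rw [natEnds_of_lt _ hi, natEnds_of_lt _ hi]
    exact ⟨Fin.is_lt _, Fin.is_lt _⟩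
  have hdeg' : ∀ v < n, ∃ u, EAdj m (orient m (natEnds src) (natEnds dst))
      (orient m (natEnds dst) (natEnds src)) v u := fun v hv => by
    obtain ⟨u, hu⟩ := hdeg ⟨v, hv⟩
    exact ⟨u, hG.eAdj_iff.2 ⟨_, _, rfl, rfl, hu⟩⟩
  have hE₁ : ∀ i < 2 * m, orient m (natEnds src) (natEnds dst) i < n := fun i hi => by
    rw [orient]
    split_ifs with him
    · exact (hE i him).1
    · exact (hE (i - m) (by omega)).2
  have hA : EAdj m (orient m (natEnds src) (natEnds dst)) (orient m (natEnds dst) (natEnds src)) =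
      natAdj G := funext₂ fun x y => propext hG.eAdj_iff
  obtain ⟨Δ, hΔ, hΔm, hle, hmin⟩ := exists_threshold (h := h) (by omega) hm
  obtain ⟨hb1, hb2⟩ := word_bound (h := h) (a := a) (card_le_two_mul hdeg') hm (by omega)
    (by omega)
  obtain ⟨t, s, hexec, ht, hans⟩ := runs_maxCycle (a := a) (natWeight_comm w) hE hm hdeg'
    (by omega) (by omega) hΔ hΔm hle hmin (hb1.trans hb) (hb2.trans hb)
    (input_initState w src dst coins)
  rw [hA, show a + h = k by omega] at hans
  refine ⟨t, s, hexec, ?_, hans.correctAnswer hk⟩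
  calc (t : ℝ) ≤ _ := Nat.cast_le.2 ht
    _ = (maxCycleCost a h : ℝ) * _ := Nat.cast_mul _ _
    _ ≤ maxCycleCost a h * ((2 ^ (h - 1) + 2) * (m : ℝ) ^ (2 - 1 / (h : ℝ))) :=
      mul_le_mul_of_nonneg_left
        (rpow_bound hm (by omega) hΔ hle hmin (heavyCount_mul_le hE₁)) (Nat.cast_nonneg _)
    _ = _ := by ring

/-- The ends of an edge differ. This keeps `Real.log n` away from zero in the deterministic bound.
-/
theorem two_le_card {n m : ℕ} {G : SimpleGraph (Fin n)} {src dst : Fin m → Fin n}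
    (hG : ListsEdges G src dst) (hm : 1 ≤ m) : 2 ≤ n := by
  have : s(src ⟨0, hm⟩, dst ⟨0, hm⟩) ∈ G.edgeSet := hG.2 ▸ ⟨_, rfl⟩
  have hne := (SimpleGraph.mem_edgeSet _).1 this |>.ne
  have h1 := (src ⟨0, hm⟩).2
  have h2 := (dst ⟨0, hm⟩).2
  have h3 := mt Fin.ext hne
  omega

instance : IsProbabilityMeasure coinMeasure := by
  rw [coinMeasure]
  infer_instance

end RealRAM

theorem theorem3 (k : ℕ) (hk : 3 ≤ k) :
    -- randomized: worst-case time bound, correct with probability at least 1 - 1 / n ^ c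
    (∀ c : ℕ, ∃ (P : RealRAM.Program) (C : ℝ) (d : ℕ),
      ∀ (n m : ℕ) (G : SimpleGraph (Fin n)) (w : Sym2 (Fin n) → ℝ) (src dst : Fin m → Fin n),
        RealRAM.ListsEdges G src dst → 1 ≤ m → (∀ v, ∃ u, G.Adj v u) →
        ∀ b : ℕ, (m + 2) ^ d ≤ 2 ^ b →
          (∀ coins : ℕ → Bool, ∃ (t : ℕ) (s : RealRAM.State),
            RealRAM.Exec b P
              (RealRAM.initState n m src dst (fun i => w s(src i, dst i)) coins) t s ∧
            (t : ℝ) ≤ C * (m : ℝ) ^ (2 - 1 / (⌈(k : ℝ) / 2⌉₊ : ℝ))) ∧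
          ENNReal.ofReal (1 - 1 / (n : ℝ) ^ c) ≤
            RealRAM.coinMeasure {coins | ∃ (t : ℕ) (s : RealRAM.State),
              RealRAM.Exec b P
                (RealRAM.initState n m src dst (fun i => w s(src i, dst i)) coins) t s ∧
              RealRAM.CorrectAnswer G w k s}) ∧
    -- deterministic
    (∃ (P : RealRAM.Program) (C : ℝ) (d : ℕ), P.Deterministic ∧
      ∀ (n m : ℕ) (G : SimpleGraph (Fin n)) (w : Sym2 (Fin n) → ℝ) (src dst : Fin m → Fin n),
        RealRAM.ListsEdges G src dst → 1 ≤ m → (∀ v, ∃ u, G.Adj v u) →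
        ∀ b : ℕ, (m + 2) ^ d ≤ 2 ^ b →
          ∀ coins : ℕ → Bool, ∃ (t : ℕ) (s : RealRAM.State),
            RealRAM.Exec b P
              (RealRAM.initState n m src dst (fun i => w s(src i, dst i)) coins) t s ∧
            (t : ℝ) ≤ C * (m : ℝ) ^ (2 - 1 / (⌈(k : ℝ) / 2⌉₊ : ℝ)) * Real.log n ∧
            RealRAM.CorrectAnswer G w k s) := by
  obtain ⟨C, hC⟩ : ∃ C : ℝ, C = RealRAM.maxCycleCost (k / 2) ((k + 1) / 2) *
    (2 ^ ((k + 1) / 2 - 1) + 2) := ⟨_, rfl⟩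
  refine ⟨fun c => ⟨RealRAM.maxCycle (k / 2) ((k + 1) / 2), C, 2 * ((k + 1) / 2) + 7,
      fun n m G w src dst hG hm hdeg b hb => ⟨fun coins => ?_, ?_⟩⟩,
    -- The constant is divided by `Real.log 2` so that `Real.log n ≥ Real.log 2` makes up for it.
    RealRAM.maxCycle (k / 2) ((k + 1) / 2), C / Real.log 2, 2 * ((k + 1) / 2) + 7,
    RealRAM.deterministic_maxCycle _ _, fun n m G w src dst hG hm hdeg b hb coins => ?_⟩
  · obtain ⟨t, s, hexec, ht, -⟩ := RealRAM.exec_maxCycle hk w hG hm hdeg hb coins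
    exact ⟨t, s, hexec, hC ▸ ht⟩
  -- The run is correct for each coin stream, so the event is everything and has probability one.
  · have huniv : {coins | ∃ (t : ℕ) (s : RealRAM.State),
        RealRAM.Exec b (RealRAM.maxCycle (k / 2) ((k + 1) / 2))
          (RealRAM.initState n m src dst (fun i => w s(src i, dst i)) coins) t s ∧
        RealRAM.CorrectAnswer G w k s} = Set.univ := by
      refine Set.eq_univ_of_forall fun coins => ?_
      obtain ⟨t, s, hexec, -, hs⟩ := RealRAM.exec_maxCycle hk w hG hm hdeg hb coins
      exact ⟨t, s, hexec, hs⟩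
    rw [huniv, measure_univ, ENNReal.ofReal_le_one]
    have : 0 ≤ 1 / (n : ℝ) ^ c := by positivity
    linarith
  · obtain ⟨t, s, hexec, ht, hs⟩ := RealRAM.exec_maxCycle hk w hG hm hdeg hb coins
    refine ⟨t, s, hexec, ht.trans ?_, hs⟩
    rw [← hC]
    have hlog2 : 0 < Real.log 2 := Real.log_pos (by norm_num)
    have hlog : Real.log 2 ≤ Real.log n :=
      Real.log_le_log (by norm_num) (by exact_mod_cast RealRAM.two_le_card hG hm)
    have hC0 : 0 ≤ C := by rw [hC]; positivity
    calc C * (m : ℝ) ^ (2 - 1 / (⌈(k : ℝ) / 2⌉₊ : ℝ)) =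
        C / Real.log 2 * (m : ℝ) ^ (2 - 1 / (⌈(k : ℝ) / 2⌉₊ : ℝ)) * Real.log 2 := by
          field_simp
      _ ≤ _ := mul_le_mul_of_nonneg_left hlog (by positivity)
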